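/- Let $\lambda>0$, $\nu:=\sqrt{\tfrac14+\lambda}$, $T\in(0,\infty]$, $\dot{\mathbb R}:=\mathbb R\setminus\{0\}$, and $$G(t,x,y)=\frac{\Theta(xy)\sqrt{xy}}{2\,i^{\nu+1}t}\;e^{-\frac{x^2+y^2}{4it}}\;J_\nu\!\Big(\frac{xy}{2t}\Big),\qquad t\in(0,T),\ x,y\in\dot{\mathbb R},$$ where $\Theta$ is the step function, $J_\nu$ is the Bessel function of the first kind, and $i^{\nu+1}=e^{i\pi(\nu+1)/2}$. Then $G$ satisfies the following conditions, which define a Green's function of the Schrödinger equation on $\dot{\mathbb R}$ with the repulsive centrifugal potential $V(t,x)=\lambda/x^2$ and the transmission matrices $M=I$, $N=0$ (Dirichlet conditions at $0^\pm$). Notation: for an open interval $I$, $\operatorname{AC}(I)$ is the set of $f$ for which there is $g\in L^1_{\rm loc}(I)$ with $f(y)-f(x)=\int_x^y g(s)\,ds$ for all $x,y\in I$; $f\in\operatorname{AC}(\dot{\mathbb R})$ means that the restrictions of $f$ to $(-\infty,0)$ and to $(0,\infty)$ are in $\operatorname{AC}$; $\operatorname{AC}_{1,2}((0,T)\times\dot{\mathbb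 R})$ is the set of $\Psi:(0,T)\times\dot{\mathbb R}\to\mathbb C$ with $\Psi(\cdot,x)\in\operatorname{AC}((0,T))$ for all $x\in\dot{\mathbb R}$, and with $\Psi(t,\cdot)$ differentiable on $\dot{\mathbb R}$ and $\Psi(t,\cdot),\Psi_x(t,\cdot)\in\operatorname{AC}(\dot{\mathbb R})$ for all $t\in(0,T)$. There are an angle $\alpha\in(0,\frac\pi2)$ and a continuation of $G$ to a function $G:(0,T)\times\dot{\mathbb R}\times S_\alpha\to\mathbb C$ on the double sector $S_\alpha=\{z\in\mathbb C\setminus\{0\}:\operatorname{Arg}z\in[0,\alpha]\cup[\pi,\pi+\alpha]\}$ such that for all $t\in(0,T)$, $x\in\dot{\mathbb R}$ the map $G(t,x,\cdot)$ is continuous on $S_\alpha$ and holomorphic on $\operatorname{int}S_\alpha$, and: (i) For every $z\in S_\alpha$, $G(\cdot,\cdot,z)\in\operatorname{AC}_{1,2}((0,T)\times\dot{\mathbb R})$ and $$i\,\partial_tG(t,x,z)=\Big(-\partial_x^2+\frac{\lambda}{x^2}\Big)G(t,x,z)\quad\text{for a.e. }(t,x)\in(0,T)\times\dot{\mathbb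 R}.$$ For every $y\in\dot{\mathbb R}$ and $t\in(0,T)$ the one-sided limits of $G(t,x,y)$ and $G_x(t,x,y)$ as $x\to0^\pm$ exist and $$M\begin{pmatrix}G(t,0^+,y)\\G(t,0^-,y)\end{pmatrix}=N\begin{pmatrix}G_x(t,0^+,y)\\-G_x(t,0^-,y)\end{pmatrix}\quad\text{with } M=I,\ N=0,$$ that is, $G(t,0^\pm,y)=0$. (ii) For every $x\in\dot{\mathbb R}$ there is $x_0>|x|$ such that $$\lim_{t\to0^+}\int_{-x_0}^{x_0}G(t,x,y)\varphi(y)\,dy=\varphi(x)\quad\text{for all complex-valued }\varphi\in C^\infty([-x_0,x_0]).$$ (iii) There are $a\in\operatorname{AC}((0,T))$ with $a(t)>0$ and $\lim_{t\to0^+}a(t)=\infty$, an exponent $p\in(0,2)$, and continuous functions $A_j,B_j:(0,T)\times\dot{\mathbb R}\to[0,\infty)$, $j=0,1,2$, such that the function $\widetilde G$ defined by $G(t,x,z)=e^{ia(t)(z-x)^2}\widetilde G(t,x,z)$ has the derivatives below at every $t\in(0,T)$, $x\in\dot{\mathbb R}$, $z\in S_\alpha$, and satisfies there $$|\widetilde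 G|\le A_0(t,x)e^{B_0(t,x)|z|^p},\qquad|\partial_x\widetilde G|\le A_1(t,x)e^{B_1(t,x)|z|^p},\qquad|\partial_x^2\widetilde G|,\,|\partial_t\widetilde G|\le A_2(t,x)e^{B_2(t,x)|z|^p}.$$ Moreover, for every $x\in\dot{\mathbb R}$, $A_0(t,x)/\sqrt{a(t)}$ and $B_0(t,x)$ are bounded as $t\to0^+$; and for every $t\in(0,T)$, $A_0(t,\cdot)$ and $B_0(t,\cdot)$ are bounded as $x\to0^\pm$. -/

import Mathlib

open Filter Topology MeasureTheory
open scoped ContDiff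

noncomputable section

namespace SchrodingerGreen

/-- The double sector `{z ≠ 0 | Arg z ∈ [0, α] ∪ [π, π + α]}`. As `Complex.arg` takes values
in `(-π, π]`, the second range of arguments of `z` is written as `Arg (-z) ∈ [0, α]`. -/
def doubleSector (α : ℝ) : Set ℂ :=
  {z | z ≠ 0 ∧ (Complex.arg z ∈ Set.Icc 0 α ∨ Complex.arg (-z) ∈ Set.Icc 0 α)}

/-- The time interval `(0, T)` for `T ∈ (0, ∞]`. -/
def timeInterval (T : EReal) : Set ℝ :=
  {t | 0 < t ∧ (t : EReal) < T}

/-- The space `AC(I)` for an open interval `I`: functions that are integrals of an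
`L¹_loc(I)` function. -/
def ACOn {E : Type*} [NormedAddCommGroup E] [NormedSpace ℝ E] (f : ℝ → E) (I : Set ℝ) : Prop :=
  ∃ g : ℝ → E, LocallyIntegrableOn g I volume ∧
    ∀ x ∈ I, ∀ y ∈ I, f y - f x = ∫ s in x..y, g s

/-- The space `AC(ℝ ∖ {0})`. -/
def ACDot (f : ℝ → ℂ) : Prop :=
  ACOn f (Set.Iio 0) ∧ ACOn f (Set.Ioi 0)

/-- The space `AC_{1,2}((0,T) × (ℝ ∖ {0}))`. -/
structure AC12 (T : EReal) (Ψ : ℝ → ℝ → ℂ) : Prop where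
  time : ∀ x : ℝ, x ≠ 0 → ACOn (fun t => Ψ t x) (timeInterval T)
  space : ∀ t ∈ timeInterval T, ACDot (Ψ t)
  differentiable : ∀ t ∈ timeInterval T, ∀ x : ℝ, x ≠ 0 → DifferentiableAt ℝ (Ψ t) x
  space_deriv : ∀ t ∈ timeInterval T, ACDot (deriv (Ψ t))

/-- `Ψ` solves `i ∂ₜΨ = (-∂ₓ² + V)Ψ` for almost every `(t, x) ∈ (0,T) × (ℝ ∖ {0})`. -/
def SolvesSchrodinger (T : EReal) (V Ψ : ℝ → ℝ → ℂ) : Prop :=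
  ∀ᵐ q : ℝ × ℝ, q.1 ∈ timeInterval T → q.2 ≠ 0 →
    ∃ dt dxx : ℂ, HasDerivAt (fun s => Ψ s q.2) dt q.1 ∧ HasDerivAt (deriv (Ψ q.1)) dxx q.2 ∧
      Complex.I * dt = -dxx + V q.1 q.2 * Ψ q.1 q.2

/-- The one-sided limits of `f` and `f'` at `0` exist and
`M (f(0⁺), f(0⁻))ᵀ = N (f'(0⁺), -f'(0⁻))ᵀ`. -/
def TransmissionCondition (M N : Matrix (Fin 2) (Fin 2) ℂ) (f : ℝ → ℂ) : Prop :=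
  ∃ fp fm dp dm : ℂ,
    Tendsto f (𝓝[>] 0) (𝓝 fp) ∧ Tendsto f (𝓝[<] 0) (𝓝 fm) ∧
    Tendsto (deriv f) (𝓝[>] 0) (𝓝 dp) ∧ Tendsto (deriv f) (𝓝[<] 0) (𝓝 dm) ∧
    M.mulVec ![fp, fm] = N.mulVec ![dp, -dm]

/-- `f` is bounded near the limit point described by the filter `l`. -/
def BoundedAs (l : Filter ℝ) (f : ℝ → ℝ) : Prop :=
  ∃ C : ℝ, ∀ᶠ s in l, |f s| ≤ C

/-- A continuous coefficient `(0,T) × (ℝ ∖ {0}) → [0,∞)`. -/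
def IsCoefficient (T : EReal) (A : ℝ → ℝ → ℝ) : Prop :=
  ContinuousOn (fun q : ℝ × ℝ => A q.1 q.2) (timeInterval T ×ˢ {0}ᶜ) ∧
    ∀ t ∈ timeInterval T, ∀ x : ℝ, x ≠ 0 → 0 ≤ A t x

/-- The factor `Gt` in `G(t,x,z) = e^{i a(t) (z-x)²} Gt(t,x,z)` and its derivatives are
exponentially bounded on `S`, with growth order `p` and coefficients `A`, `B`
(indexed by `0, 1, 2`). -/
structure ExponentialBounds (T : EReal) (M N : Matrix (Fin 2) (Fin 2) ℂ) (S : Set ℂ)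
    (G Gt : ℝ → ℝ → ℂ → ℂ) (a : ℝ → ℝ) (p : ℝ) (A B : Fin 3 → ℝ → ℝ → ℝ) : Prop where
  ac : ACOn a (timeInterval T)
  pos : ∀ t ∈ timeInterval T, 0 < a t
  tendsto : Tendsto a (𝓝[>] 0) atTop
  decomposition : ∀ t ∈ timeInterval T, ∀ x : ℝ, x ≠ 0 → ∀ z ∈ S,
    G t x z = Complex.exp (Complex.I * a t * (z - x) ^ 2) * Gt t x z
  p_mem : p ∈ Set.Ioo (0 : ℝ) 2
  coeffA : ∀ j, IsCoefficient T (A j)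
  coeffB : ∀ j, IsCoefficient T (B j)
  bound : ∀ t ∈ timeInterval T, ∀ x : ℝ, x ≠ 0 → ∀ z ∈ S,
    ‖Gt t x z‖ ≤ A 0 t x * Real.exp (B 0 t x * ‖z‖ ^ p)
  bound_x : ∀ t ∈ timeInterval T, ∀ x : ℝ, x ≠ 0 → ∀ z ∈ S,
    ∃ d : ℂ, HasDerivAt (fun x' => Gt t x' z) d x ∧
      ‖d‖ ≤ A 1 t x * Real.exp (B 1 t x * ‖z‖ ^ p)
  bound_xx : ∀ t ∈ timeInterval T, ∀ x : ℝ, x ≠ 0 → ∀ z ∈ S,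
    ∃ d : ℂ, HasDerivAt (deriv fun x' => Gt t x' z) d x ∧
      ‖d‖ ≤ A 2 t x * Real.exp (B 2 t x * ‖z‖ ^ p)
  bound_t : ∀ t ∈ timeInterval T, ∀ x : ℝ, x ≠ 0 → ∀ z ∈ S,
    ∃ d : ℂ, HasDerivAt (fun t' => Gt t' x z) d t ∧
      ‖d‖ ≤ A 2 t x * Real.exp (B 2 t x * ‖z‖ ^ p)
  bounded_time : ∀ x : ℝ, x ≠ 0 →
    BoundedAs (𝓝[>] 0) (fun t => A 0 t x / √(a t)) ∧ BoundedAs (𝓝[>] 0) (fun t => B 0 t x)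
  bounded_space : M ≠ 0 → N = 0 → ∀ t ∈ timeInterval T,
    BoundedAs (𝓝[≠] 0) (A 0 t) ∧ BoundedAs (𝓝[≠] 0) (B 0 t)
  bounded_space_deriv : N ≠ 0 → ∀ t ∈ timeInterval T,
    BoundedAs (𝓝[≠] 0) (A 0 t) ∧ BoundedAs (𝓝[≠] 0) (A 1 t) ∧
    BoundedAs (𝓝[≠] 0) (B 0 t) ∧ BoundedAs (𝓝[≠] 0) (B 1 t)

/-- `Gc` is a continuation of `G` to the double sector of angle `α` with all the properties
required of a Green's function for the potential `V` and the transmission matrices `M`, `N`. -/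
structure IsGreenContinuation (T : EReal) (V : ℝ → ℝ → ℂ) (M N : Matrix (Fin 2) (Fin 2) ℂ)
    (G : ℝ → ℝ → ℝ → ℂ) (α : ℝ) (Gc : ℝ → ℝ → ℂ → ℂ) : Prop where
  extends_G : ∀ t ∈ timeInterval T, ∀ x : ℝ, x ≠ 0 → ∀ y : ℝ, y ≠ 0 → Gc t x y = G t x y
  continuousOn : ∀ t ∈ timeInterval T, ∀ x : ℝ, x ≠ 0 →
    ContinuousOn (Gc t x) (doubleSector α)
  holomorphic : ∀ t ∈ timeInterval T, ∀ x : ℝ, x ≠ 0 →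
    DifferentiableOn ℂ (Gc t x) (interior (doubleSector α))
  ac12 : ∀ z ∈ doubleSector α, AC12 T (fun t x => Gc t x z)
  schrodinger : ∀ z ∈ doubleSector α, SolvesSchrodinger T V (fun t x => Gc t x z)
  transmission : ∀ y : ℝ, y ≠ 0 → ∀ t ∈ timeInterval T,
    TransmissionCondition M N (fun x => G t x y)
  initial : ∀ x : ℝ, x ≠ 0 → ∃ x₀ : ℝ, |x| < x₀ ∧
    ∀ φ : ℝ → ℂ, ContDiffOn ℝ ∞ φ (Set.Icc (-x₀) x₀) →
      Tendsto (fun t => ∫ y in (-x₀)..x₀, G t x y * φ y) (𝓝[>] 0) (𝓝 (φ x))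
  bounds : ∃ (a : ℝ → ℝ) (Gt : ℝ → ℝ → ℂ → ℂ) (p : ℝ) (A B : Fin 3 → ℝ → ℝ → ℝ),
    ExponentialBounds T M N (doubleSector α) Gc Gt a p A B

/-- The conditions on a Green's function `G : (0,T) × (ℝ ∖ {0}) × (ℝ ∖ {0}) → ℂ` of the
Schrödinger equation with potential `V` and transmission matrices `M`, `N`. Only the values of
`G` and `V` on these domains matter. -/
def GreenAssumption (T : EReal) (V : ℝ → ℝ → ℂ) (M N : Matrix (Fin 2) (Fin 2) ℂ)
    (G : ℝ → ℝ → ℝ → ℂ) : Prop :=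
  ∃ α ∈ Set.Ioo 0 (Real.pi / 2), ∃ Gc : ℝ → ℝ → ℂ → ℂ, IsGreenContinuation T V M N G α Gc

/-- The Bessel function of the first kind
`J_ν(w) = (w/2)^ν ∑ₖ (-1)ᵏ / (k! Γ(ν+k+1)) (w/2)^{2k}`, with the principal branch of the power. -/
def besselJ (ν w : ℂ) : ℂ :=
  (w / 2) ^ ν *
    ∑' k : ℕ, (-1) ^ k / ((k.factorial : ℂ) * Complex.Gamma (ν + k + 1)) * (w / 2) ^ (2 * k)

/-- The step function `Θ`. -/
def heaviside (s : ℝ) : ℝ :=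
  if 0 < s then 1 else 0

/-- The kernel `Θ(xy) √(xy) / (2 i^{ν+1} t) · e^{-(x²+y²)/(4it)} · J_ν(xy/(2t))`. -/
def besselKernel (ν t x y : ℝ) : ℂ :=
  (heaviside (x * y) * √(x * y) : ℝ) / (2 * Complex.I ^ ((ν : ℂ) + 1) * t) *
    Complex.exp (-((x : ℂ) ^ 2 + (y : ℂ) ^ 2) / (4 * Complex.I * t)) *
    besselJ ν (x * y / (2 * t))

end SchrodingerGreen

end

open Filter Topology MeasureTheory
open scoped ContDiff

noncomputable section

namespace SchrodingerGreen

/-! Put H(w) = e^{iw} √w J_ν(w). Since (x² + y²)/(4t) = (x - y)²/(4t) + xy/(2t), the kernel on xy >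
0 is a constant times t^{-1/2} e^{i(x-y)²/(4t)} H(xy/(2t)). The continuation replaces y by z where x
Re z > 0 and is 0 elsewhere. On the double sector of angle π/4, Re z never vanishes, and xz/(2t)
lies in the closed first quadrant as soon as x Re z > 0. Everything thus reduces to the behaviour of
H on that quadrant.

Differential equation and boundary values: K = √w J_ν satisfies K'' = ((ν² - 1/4)/w² - 1)K with ν² -
1/4 = λ, and the Schrödinger equation follows by direct computation (`kernelCore_schrodinger`).
Poisson's integral, available because λ > 0 means ν > 1/2, yields the derivatives, the equation and
the bound |w|^{ν-1/2} for K and K' near 0. Hence G and even G_x tend to 0 as x → 0.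

Exponential bounds: H'' = 2iH' + (λ/w²)H. Along a ray, the energy |H'|² + |2iH - H'|² has
logarithmic derivative at most 2λ/r², because 2iH' is dissipative for Im w ≥ 0 (`energy_le`). This
is integrable at infinity, so H and H' are bounded on the quadrant (`exists_norm_modBessel_le`), and
only powers of |z| from the chain rule remain.

Initial condition: H(r) = i^{ν+1/2}/√(2π) + D e^{2ir} + O(1/r) (`exists_modBessel_asymptotics`). The
constant term is found on the imaginary axis, where Poisson's integral becomes a Laplace integral,
and is carried to the real axis by 2iH - H', whose derivative is O(|w|^{-2}) on the whole quadrant.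
The constant term gives the free kernel, which reproduces φ(x) by a Fresnel integral. The D term
turns e^{i(y-x)²/(4t)} into e^{i(y+x)²/(4t)}, a free kernel centred outside the interval, which
vanishes in the limit; so D need not be computed. The remainder contributes a positive power of t.
-/

/-! ### Fourier–Laplace transforms on `[-1, 1]` -/

/-- The Fourier–Laplace transform `w ↦ ∫_{-1}^{1} k(s) e^{iws} ds`. -/
def unitTransform (k : ℝ → ℂ) (w : ℂ) : ℂ :=
  ∫ s in (-1 : ℝ)..1, k s * Complex.exp (Complex.I * w * s)

lemma norm_exp_I_mul_le {w : ℂ} {s R : ℝ} (hs : |s| ≤ 1) (hR : ‖w‖ ≤ R) :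
    ‖Complex.exp (Complex.I * w * s)‖ ≤ Real.exp R := by
  rw [Complex.norm_exp]
  refine Real.exp_le_exp.2 ((Complex.re_le_norm _).trans ?_)
  rw [norm_mul, norm_mul, Complex.norm_I, one_mul, Complex.norm_real, Real.norm_eq_abs]
  calc ‖w‖ * |s| ≤ R * 1 := mul_le_mul hR hs (abs_nonneg _) ((norm_nonneg _).trans hR)
    _ = R := mul_one R

lemma abs_le_one_of_mem_uIoc {s : ℝ} (hs : s ∈ Set.uIoc (-1 : ℝ) 1) : |s| ≤ 1 := by
  rw [Set.uIoc_of_le (by norm_num)] at hs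
  exact abs_le.2 ⟨hs.1.le, hs.2⟩

/-- Differentiation under the integral; on the unit ball around w the exponential is at most
e^{‖w‖+1}. -/
lemma hasDerivAt_unitTransform {k : ℝ → ℂ} (hk : Continuous k) (w : ℂ) :
    HasDerivAt (unitTransform k) (unitTransform (fun s => k s * (Complex.I * s)) w) w := by
  have key := intervalIntegral.hasDerivAt_integral_of_dominated_loc_of_deriv_le
    (μ := volume) (a := (-1 : ℝ)) (b := 1) (𝕜 := ℂ)
    (F := fun w s => k s * Complex.exp (Complex.I * w * s))
    (F' := fun w s => k s * (Complex.I * s) * Complex.exp (Complex.I * w * s))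
    (bound := fun s => ‖k s‖ * Real.exp (‖w‖ + 1)) (s := Metric.ball w 1) (x₀ := w)
    (Metric.ball_mem_nhds w one_pos)
    (Eventually.of_forall fun w' => Continuous.aestronglyMeasurable (by fun_prop))
    (Continuous.intervalIntegrable (by fun_prop) _ _)
    (Continuous.aestronglyMeasurable (by fun_prop))
    (Eventually.of_forall fun s hs w' hw' => ?_)
    (Continuous.intervalIntegrable (by fun_prop) _ _)
    (Eventually.of_forall fun s hs w' hw' => ?_)
  · exact key.2
  · have hs' := abs_le_one_of_mem_uIoc hs
    have hw : ‖w'‖ ≤ ‖w‖ + 1 := by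
      have h1 : ‖w' - w‖ < 1 := by simpa [dist_eq_norm] using hw'
      have h2 := norm_sub_norm_le w' w
      linarith
    rw [norm_mul, norm_mul, norm_mul, Complex.norm_I, one_mul, Complex.norm_real,
      Real.norm_eq_abs]
    exact mul_le_mul (mul_le_of_le_one_right (norm_nonneg _) hs') (norm_exp_I_mul_le hs' hw)
      (norm_nonneg _) (norm_nonneg _)
  · have h1 : HasDerivAt (fun w : ℂ => Complex.I * w * s) (Complex.I * s) w' := by
      simpa using ((hasDerivAt_id w').const_mul Complex.I).mul_const (s : ℂ)
    have := (h1.cexp).const_mul (k s)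
    exact this.congr_deriv (by ring)

lemma exists_norm_unitTransform_le {k : ℝ → ℂ} (hk : Continuous k) (R : ℝ) :
    ∃ C, 0 ≤ C ∧ ∀ w : ℂ, ‖w‖ ≤ R → ‖unitTransform k w‖ ≤ C := by
  have hcont : Continuous (unitTransform k) :=
    continuous_iff_continuousAt.2 fun w => (hasDerivAt_unitTransform hk w).continuousAt
  obtain ⟨C, hC⟩ := (isCompact_closedBall (0 : ℂ) R).exists_bound_of_continuousOn
    hcont.continuousOn
  exact ⟨max C 0, le_max_right _ _, fun w hw =>
    (hC w (by simpa using hw)).trans (le_max_left _ _)⟩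

/-! ### The weight `(1 - s²)^{ν - 1/2}` -/

/-- The weight of the Poisson representation of the Bessel function. -/
def poissonWeight (ν s : ℝ) : ℝ := (1 - s ^ 2) ^ (ν - 1 / 2)

lemma continuous_poissonWeight {ν : ℝ} (hν : 1 / 2 < ν) : Continuous (poissonWeight ν) := by
  unfold poissonWeight
  exact Continuous.rpow_const (by fun_prop) fun s => Or.inr (by linarith)

lemma poissonWeight_neg (ν s : ℝ) : poissonWeight ν (-s) = poissonWeight ν s := by
  simp [poissonWeight]

/-- Raising the index makes the weight a primitive. This drives the two integrations by parts below:
the moment recursion and the Bessel equation. -/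
lemma hasDerivAt_poissonWeight_succ {ν s : ℝ} (hs : s ∈ Set.Ioo (-1 : ℝ) 1) :
    HasDerivAt (poissonWeight (ν + 1)) (-(2 * ν + 1) * s * poissonWeight ν s) s := by
  have hpos : 0 < 1 - s ^ 2 := by nlinarith [hs.1, hs.2]
  have h1 : HasDerivAt (fun s : ℝ => 1 - s ^ 2) (-(2 * s)) s := by
    simpa using ((hasDerivAt_id s).pow 2).const_sub 1
  have h2 := h1.rpow_const (p := ν + 1 - 1 / 2) (Or.inl hpos.ne')
  refine h2.congr_deriv ?_
  rw [poissonWeight, show ν + 1 - 1 / 2 - 1 = ν - 1 / 2 by ring]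
  ring

lemma poissonWeight_succ {ν s : ℝ} (hν : 1 / 2 < ν) (hs : s ∈ Set.Icc (-1 : ℝ) 1) :
    poissonWeight (ν + 1) s = (1 - s ^ 2) * poissonWeight ν s := by
  have h0 : 0 ≤ 1 - s ^ 2 := by nlinarith [hs.1, hs.2]
  rw [poissonWeight, poissonWeight, show ν + 1 - 1 / 2 = 1 + (ν - 1 / 2) by ring,
    Real.rpow_add_of_nonneg h0 zero_le_one (by linarith), Real.rpow_one]

lemma poissonWeight_one {ν : ℝ} (hν : 1 / 2 < ν) : poissonWeight ν 1 = 0 := by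
  rw [poissonWeight]; norm_num
  exact Real.zero_rpow (by linarith)

lemma poissonWeight_neg_one {ν : ℝ} (hν : 1 / 2 < ν) : poissonWeight ν (-1) = 0 := by
  rw [poissonWeight_neg, poissonWeight_one hν]

/-- The even moments of the weight. -/
def poissonMoment (ν : ℝ) (k : ℕ) : ℝ := ∫ s in (-1 : ℝ)..1, s ^ (2 * k) * poissonWeight ν s

/-- The derivative of s^{2k+1}(1 - s²)^{ν+1/2} integrates to zero over [-1, 1]. -/
lemma poissonMoment_succ {ν : ℝ} (hν : 1 / 2 < ν) (k : ℕ) :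
    2 * (ν + k + 1) * poissonMoment ν (k + 1) = (2 * k + 1) * poissonMoment ν k := by
  have hc := continuous_poissonWeight hν
  have hc1 := continuous_poissonWeight (ν := ν + 1) (by linarith)
  have hint : ∀ n : ℕ, IntervalIntegrable (fun s : ℝ => s ^ n * poissonWeight ν s)
      volume (-1) 1 := fun n => Continuous.intervalIntegrable (by fun_prop) _ _
  have key := intervalIntegral.integral_eq_sub_of_hasDerivAt_of_le (a := (-1 : ℝ)) (b := 1)
    (f := fun s => s ^ (2 * k + 1) * poissonWeight (ν + 1) s)
    (f' := fun s => (2 * k + 1) * (s ^ (2 * k) * poissonWeight ν s)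
      - 2 * (ν + k + 1) * (s ^ (2 * (k + 1)) * poissonWeight ν s)) (by norm_num)
    (Continuous.continuousOn (by fun_prop)) (fun s hs => ?_)
    (((hint _).const_mul _).sub ((hint _).const_mul _))
  · rw [intervalIntegral.integral_sub ((hint _).const_mul _) ((hint _).const_mul _),
      intervalIntegral.integral_const_mul, intervalIntegral.integral_const_mul,
      poissonWeight_one (by linarith), poissonWeight_neg_one (by linarith)] at key
    simp only [poissonMoment]
    linarith
  · have h := ((hasDerivAt_pow (2 * k + 1) s).mul
      (hasDerivAt_poissonWeight_succ (ν := ν) hs))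
    refine h.congr_deriv ?_
    rw [poissonWeight_succ hν ⟨hs.1.le, hs.2.le⟩]
    push_cast
    ring

/-- The substitution s = 2u - 1 gives the Beta integral B(ν + 1/2, ν + 1/2); Legendre duplication at
ν + 1/2 then removes Γ(2ν + 1). -/
lemma poissonMoment_zero {ν : ℝ} (hν : 1 / 2 < ν) :
    poissonMoment ν 0 = √Real.pi * Real.Gamma (ν + 1 / 2) / Real.Gamma (ν + 1) := by
  have h1 : poissonMoment ν 0 = 2 ^ (2 * ν) * ∫ u in (0 : ℝ)..1,
      u ^ (ν - 1 / 2) * (1 - u) ^ (ν - 1 / 2) := by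
    have h' : ∫ s in (-1 : ℝ)..1, poissonWeight ν s
        = 2 * ∫ x in (0 : ℝ)..1, poissonWeight ν (2 * x + -1) := by
      rw [intervalIntegral.integral_comp_mul_add _ two_ne_zero, smul_eq_mul, ← mul_assoc,
        mul_inv_cancel₀ two_ne_zero, one_mul]
      norm_num
    simp only [poissonMoment, mul_zero, pow_zero, one_mul]
    rw [h', ← intervalIntegral.integral_const_mul, ← intervalIntegral.integral_const_mul]
    refine intervalIntegral.integral_congr fun u hu => ?_
    rw [Set.uIcc_of_le zero_le_one] at hu
    simp only [poissonWeight]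
    rw [show 1 - (2 * u + -1) ^ 2 = 4 * (u * (1 - u)) by ring,
      Real.mul_rpow (by norm_num) (mul_nonneg hu.1 (by linarith [hu.2])),
      Real.mul_rpow hu.1 (by linarith [hu.2]), ← mul_assoc]
    congr 1
    rw [show (4 : ℝ) = 2 ^ (2 : ℝ) by norm_num, ← Real.rpow_mul (by norm_num),
      show (2 : ℝ) * ν = 1 + 2 * (ν - 1 / 2) by ring, Real.rpow_add (by norm_num),
      Real.rpow_one]
  have h2 : ((∫ u in (0 : ℝ)..1, u ^ (ν - 1 / 2) * (1 - u) ^ (ν - 1 / 2) : ℝ) : ℂ)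
      = Complex.betaIntegral ((ν + 1 / 2 : ℝ) : ℂ) ((ν + 1 / 2 : ℝ) : ℂ) := by
    rw [Complex.betaIntegral, ← intervalIntegral.integral_ofReal]
    refine intervalIntegral.integral_congr fun u hu => ?_
    rw [Set.uIcc_of_le zero_le_one] at hu
    have e : ((ν + 1 / 2 : ℝ) : ℂ) - 1 = ((ν - 1 / 2 : ℝ) : ℂ) := by push_cast; ring
    simp only [e]
    rw [show (1 : ℂ) - (u : ℂ) = ((1 - u : ℝ) : ℂ) by push_cast; ring,
      ← Complex.ofReal_cpow hu.1, ← Complex.ofReal_cpow (by linarith [hu.2])]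
    push_cast; rfl
  have hre : 0 < (((ν + 1 / 2 : ℝ) : ℂ)).re := by rw [Complex.ofReal_re]; linarith
  have h3 := Complex.Gamma_mul_Gamma_eq_betaIntegral hre hre
  rw [← h2, ← Complex.ofReal_add, Complex.Gamma_ofReal, Complex.Gamma_ofReal] at h3
  norm_cast at h3
  have h4 := Real.Gamma_mul_Gamma_add_half (ν + 1 / 2)
  rw [show ν + 1 / 2 + 1 / 2 = ν + 1 by ring, show 2 * (ν + 1 / 2) = ν + 1 / 2 + (ν + 1 / 2) by ring,
    show 1 - (ν + 1 / 2 + (ν + 1 / 2)) = -(2 * ν) by ring, Real.rpow_neg (by norm_num)] at h4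
  have g1 : 0 < Real.Gamma (ν + 1) := Real.Gamma_pos_of_pos (by linarith)
  have g2 : 0 < Real.Gamma (ν + 1 / 2) := Real.Gamma_pos_of_pos (by linarith)
  have g3 : 0 < Real.Gamma (ν + 1 / 2 + (ν + 1 / 2)) := Real.Gamma_pos_of_pos (by linarith)
  have g4 : (0 : ℝ) < 2 ^ (2 * ν) := by positivity
  rw [h1, eq_div_iff g1.ne']
  have h5 : Real.Gamma (ν + 1 / 2) * Real.Gamma (ν + 1) * 2 ^ (2 * ν)
      = Real.Gamma (ν + 1 / 2 + (ν + 1 / 2)) * √Real.pi := by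
    rw [h4]; field_simp
  apply mul_left_cancel₀ g3.ne'
  linear_combination (-Real.Gamma (ν + 1) * 2 ^ (2 * ν)) * h3 + Real.Gamma (ν + 1 / 2) * h5

/-! ### The Poisson representation -/

/-- The entire part `J_ν(w) / (w/2)^ν` of the Bessel function. -/
def besselEntire (ν : ℝ) (w : ℂ) : ℂ :=
  ∑' k : ℕ, (-1) ^ k / ((k.factorial : ℂ) * Complex.Gamma ((ν : ℂ) + k + 1)) * (w / 2) ^ (2 * k)

lemma besselJ_eq (ν : ℝ) (w : ℂ) : besselJ ν w = (w / 2) ^ (ν : ℂ) * besselEntire ν w := rfl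

/-- Matches the k-th term of the cosine series, integrated against the weight, with the k-th term of
the Bessel series. -/
lemma poissonMoment_div_factorial {ν : ℝ} (hν : 1 / 2 < ν) (k : ℕ) :
    poissonMoment ν k / (2 * k).factorial = √Real.pi * Real.Gamma (ν + 1 / 2) /
      (k.factorial * Real.Gamma (ν + k + 1) * 4 ^ k) := by
  induction k with
  | zero => simp [poissonMoment_zero hν]
  | succ k ih =>
    have hs := poissonMoment_succ hν k
    have hk : (0 : ℝ) ≤ k := Nat.cast_nonneg k
    have hp : (0 : ℝ) < ν + k + 1 := by linarith
    have hG : Real.Gamma (ν + (k + 1 : ℕ) + 1) = (ν + k + 1) * Real.Gamma (ν + k + 1) := by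
      push_cast
      rw [← Real.Gamma_add_one hp.ne']; congr 1; ring
    have hf : ((2 * (k + 1)).factorial : ℝ)
        = (2 * k + 2) * (2 * k + 1) * (2 * k).factorial := by
      rw [show 2 * (k + 1) = 2 * k + 1 + 1 by ring, Nat.factorial_succ, Nat.factorial_succ]
      push_cast; ring
    have g : 0 < Real.Gamma (ν + k + 1) := Real.Gamma_pos_of_pos hp
    have hM : poissonMoment ν (k + 1) = (2 * k + 1) * poissonMoment ν k / (2 * (ν + k + 1)) := by
      rw [eq_div_iff (by positivity)]; linarith
    rw [hG, hf, hM, Nat.factorial_succ]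
    push_cast
    calc _ = (poissonMoment ν k / (2 * k).factorial) / (4 * (k + 1) * (ν + k + 1)) := by
          field_simp; ring
      _ = _ := by rw [ih]; field_simp; ring

/-- The weight is even, so averaging over s and -s leaves the cosine. -/
lemma unitTransform_poissonWeight_eq_cos {ν : ℝ} (hν : 1 / 2 < ν) (w : ℂ) :
    unitTransform (fun s => (poissonWeight ν s : ℂ)) w
      = ∫ s in (-1 : ℝ)..1, (poissonWeight ν s : ℂ) * Complex.cos (w * s) := by
  have hc := continuous_poissonWeight hν
  have h1 : unitTransform (fun s => (poissonWeight ν s : ℂ)) w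
      = ∫ s in (-1 : ℝ)..1, (poissonWeight ν s : ℂ) * Complex.exp (-(Complex.I * w * s)) := by
    have := intervalIntegral.integral_comp_neg (a := (-1 : ℝ)) (b := 1)
      (fun s : ℝ => (poissonWeight ν s : ℂ) * Complex.exp (Complex.I * w * s))
    simp only [poissonWeight_neg, neg_neg, Complex.ofReal_neg, mul_neg] at this
    rw [unitTransform, this]
  have h2 : unitTransform (fun s => (poissonWeight ν s : ℂ)) w
      = (unitTransform (fun s => (poissonWeight ν s : ℂ)) w
        + unitTransform (fun s => (poissonWeight ν s : ℂ)) w) / 2 := by ring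
  rw [h2]
  nth_rewrite 2 [h1]
  rw [unitTransform, ← intervalIntegral.integral_add
    (Continuous.intervalIntegrable (by fun_prop) _ _)
    (Continuous.intervalIntegrable (by fun_prop) _ _), ← intervalIntegral.integral_div]
  refine intervalIntegral.integral_congr fun s _ => ?_
  simp only [Complex.cos]
  rw [show w * s * Complex.I = Complex.I * w * s by ring,
    show -(w * s) * Complex.I = -(Complex.I * w * s) by ring]
  ring

/-- Poisson's integral representation of the Bessel function. -/
theorem besselEntire_eq_unitTransform {ν : ℝ} (hν : 1 / 2 < ν) (w : ℂ) :
    besselEntire ν w = ((√Real.pi * Real.Gamma (ν + 1 / 2) : ℝ) : ℂ)⁻¹ *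
      unitTransform (fun s => (poissonWeight ν s : ℂ)) w := by
  have hc := continuous_poissonWeight hν
  have hsum := intervalIntegral.hasSum_integral_of_dominated_convergence
    (μ := volume) (a := (-1 : ℝ)) (b := 1)
    (F := fun (k : ℕ) (s : ℝ) => (poissonWeight ν s : ℂ) *
      ((-1) ^ k * (w * s) ^ (2 * k) / ((2 * k).factorial : ℂ)))
    (f := fun s => (poissonWeight ν s : ℂ) * Complex.cos (w * s))
    (fun k s => ‖poissonWeight ν s‖ * (‖w‖ ^ (2 * k) / (2 * k).factorial))
    (fun k => Continuous.aestronglyMeasurable (by fun_prop))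
    (fun k => Eventually.of_forall fun s hs => ?_)
    (Eventually.of_forall fun s _ => ?_) ?_
    (Eventually.of_forall fun s _ => (Complex.hasSum_cos _).mul_left _)
  · rw [← unitTransform_poissonWeight_eq_cos hν] at hsum
    have hterm : ∀ k : ℕ, (∫ s in (-1 : ℝ)..1, (poissonWeight ν s : ℂ) *
        ((-1) ^ k * (w * s) ^ (2 * k) / ((2 * k).factorial : ℂ)))
        = ((√Real.pi * Real.Gamma (ν + 1 / 2) : ℝ) : ℂ) *
          ((-1) ^ k / ((k.factorial : ℂ) * Complex.Gamma ((ν : ℂ) + k + 1)) *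
            (w / 2) ^ (2 * k)) := by
      intro k
      have e1 : ∀ s : ℝ, (poissonWeight ν s : ℂ) *
          ((-1) ^ k * (w * s) ^ (2 * k) / ((2 * k).factorial : ℂ))
          = ((-1) ^ k * w ^ (2 * k) / ((2 * k).factorial : ℂ)) *
            ((s ^ (2 * k) * poissonWeight ν s : ℝ) : ℂ) := by
        intro s; push_cast; ring
      simp only [e1]
      rw [intervalIntegral.integral_const_mul, intervalIntegral.integral_ofReal]
      change _ * ((poissonMoment ν k : ℝ) : ℂ) = _
      have hm := congrArg (fun r : ℝ => (r : ℂ)) (poissonMoment_div_factorial hν k)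
      have hG : Complex.Gamma ((ν : ℂ) + k + 1) = ((Real.Gamma (ν + k + 1) : ℝ) : ℂ) := by
        rw [← Complex.Gamma_ofReal]; push_cast; rfl
      rw [hG]
      have h4 : (w / 2) ^ (2 * k) = w ^ (2 * k) / 4 ^ k := by
        rw [div_pow, pow_mul 2 2 k]; norm_num
      rw [h4]
      push_cast at hm ⊢
      calc _ = (-1) ^ k * w ^ (2 * k) * ((poissonMoment ν k : ℂ) / ((2 * k).factorial : ℂ)) := by
            ring
        _ = _ := by rw [hm]; ring
    simp only [hterm] at hsum
    have hne : ((√Real.pi * Real.Gamma (ν + 1 / 2) : ℝ) : ℂ) ≠ 0 := by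
      have := Real.Gamma_pos_of_pos (s := ν + 1 / 2) (by linarith)
      have h2 := Real.sqrt_pos.2 Real.pi_pos
      exact_mod_cast (mul_pos h2 this).ne'
    rw [← hsum.tsum_eq, tsum_mul_left, ← mul_assoc, inv_mul_cancel₀ hne, one_mul]
    rfl
  · have hs' := abs_le_one_of_mem_uIoc hs
    rw [norm_mul, Complex.norm_real, norm_div, norm_mul, norm_pow, norm_neg, norm_one, one_pow,
      one_mul, norm_pow, norm_mul, Complex.norm_real, Complex.norm_natCast, Real.norm_eq_abs s]
    gcongr
    exact mul_le_of_le_one_right (norm_nonneg _) hs'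
  · refine Summable.mul_left _ ?_
    exact (Real.summable_pow_div_factorial ‖w‖).comp_injective
      (mul_right_injective₀ (two_ne_zero (α := ℕ)))
  · simp only [tsum_mul_left]
    exact Continuous.intervalIntegrable (by fun_prop) _ _

/-- The Fourier–Laplace transform of `(is)^n (1 - s²)^{ν - 1/2}`, up to the factor
of the Poisson representation: the `n`-th derivative of `besselEntire`. -/
def besselEntireDeriv (ν : ℝ) (n : ℕ) (w : ℂ) : ℂ :=
  ((√Real.pi * Real.Gamma (ν + 1 / 2) : ℝ) : ℂ)⁻¹ *
    unitTransform (fun s => (poissonWeight ν s : ℂ) * (Complex.I * s) ^ n) w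

lemma besselEntireDeriv_zero {ν : ℝ} (hν : 1 / 2 < ν) :
    besselEntireDeriv ν 0 = besselEntire ν := by
  funext w
  simp [besselEntireDeriv, besselEntire_eq_unitTransform hν]

lemma hasDerivAt_besselEntireDeriv {ν : ℝ} (hν : 1 / 2 < ν) (n : ℕ) (w : ℂ) :
    HasDerivAt (besselEntireDeriv ν n) (besselEntireDeriv ν (n + 1) w) w := by
  have hc := continuous_poissonWeight hν
  have := (hasDerivAt_unitTransform (k := fun s => (poissonWeight ν s : ℂ) * (Complex.I * s) ^ n)
    (by fun_prop) w).const_mul ((√Real.pi * Real.Gamma (ν + 1 / 2) : ℝ) : ℂ)⁻¹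
  refine this.congr_deriv ?_
  simp only [besselEntireDeriv, pow_succ, mul_assoc]

lemma exists_norm_besselEntireDeriv_le {ν : ℝ} (hν : 1 / 2 < ν) (n : ℕ) (R : ℝ) :
    ∃ C, 0 ≤ C ∧ ∀ w : ℂ, ‖w‖ ≤ R → ‖besselEntireDeriv ν n w‖ ≤ C := by
  have hc := continuous_poissonWeight hν
  obtain ⟨C, hC0, hC⟩ := exists_norm_unitTransform_le
    (k := fun s => (poissonWeight ν s : ℂ) * (Complex.I * s) ^ n) (by fun_prop) R
  refine ⟨‖((√Real.pi * Real.Gamma (ν + 1 / 2) : ℝ) : ℂ)⁻¹‖ * C, by positivity, fun w hw => ?_⟩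
  rw [besselEntireDeriv, norm_mul]
  exact mul_le_mul_of_nonneg_left (hC w hw) (norm_nonneg _)

/-- The differential equation `w Φ'' + (2ν + 1) Φ' + w Φ = 0`. -/
lemma besselEntire_ode {ν : ℝ} (hν : 1 / 2 < ν) (w : ℂ) :
    w * besselEntireDeriv ν 2 w + (2 * ν + 1) * besselEntireDeriv ν 1 w
      + w * besselEntireDeriv ν 0 w = 0 := by
  have hc := continuous_poissonWeight hν
  have hc1 := continuous_poissonWeight (ν := ν + 1) (by linarith)
  -- The derivative of -i(1 - s²)^{ν+1/2} e^{iws} is exactly the integrand of the left side, and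
  -- this primitive vanishes at both ends.
  have key := intervalIntegral.integral_eq_sub_of_hasDerivAt_of_le (a := (-1 : ℝ)) (b := 1)
    (f := fun s : ℝ => -Complex.I * ((poissonWeight (ν + 1) s : ℂ) *
      Complex.exp (Complex.I * w * s)))
    (f' := fun s : ℝ => w * ((poissonWeight ν s : ℂ) * (Complex.I * s) ^ 2 *
        Complex.exp (Complex.I * w * s))
      + (2 * ν + 1) * ((poissonWeight ν s : ℂ) * (Complex.I * s) ^ 1 *
        Complex.exp (Complex.I * w * s))
      + w * ((poissonWeight ν s : ℂ) * (Complex.I * s) ^ 0 *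
        Complex.exp (Complex.I * w * s))) (by norm_num)
    (Continuous.continuousOn (by fun_prop)) (fun s hs => ?_)
    (Continuous.intervalIntegrable (by fun_prop) _ _)
  · have hint : ∀ (c : ℂ) (n : ℕ), IntervalIntegrable (fun s : ℝ => c * ((poissonWeight ν s : ℂ) *
        (Complex.I * s) ^ n * Complex.exp (Complex.I * w * s))) volume (-1) 1 :=
      fun c n => Continuous.intervalIntegrable (by fun_prop) _ _
    rw [intervalIntegral.integral_add ((hint _ _).add (hint _ _)) (hint _ _),
      intervalIntegral.integral_add (hint _ _) (hint _ _),
      intervalIntegral.integral_const_mul, intervalIntegral.integral_const_mul,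
      intervalIntegral.integral_const_mul,
      poissonWeight_one (by linarith), poissonWeight_neg_one (by linarith)] at key
    simp only [besselEntireDeriv, unitTransform]
    simp only [Complex.ofReal_zero, zero_mul, mul_zero, sub_zero] at key
    linear_combination ((√Real.pi * Real.Gamma (ν + 1 / 2) : ℝ) : ℂ)⁻¹ * key
  · have h1 : HasDerivAt (fun s : ℝ => Complex.exp (Complex.I * w * s))
        (Complex.exp (Complex.I * w * s) * (Complex.I * w)) s := by
      have h : HasDerivAt (fun s : ℂ => Complex.I * w * s) (Complex.I * w) (s : ℂ) := by
        simpa using (hasDerivAt_id (s : ℂ)).const_mul (Complex.I * w)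
      exact h.cexp.comp_ofReal
    have h2 := ((hasDerivAt_poissonWeight_succ (ν := ν) hs).ofReal_comp.mul h1).const_mul
      (-Complex.I)
    refine h2.congr_deriv ?_
    rw [poissonWeight_succ hν ⟨hs.1.le, hs.2.le⟩]
    push_cast
    linear_combination (-w * (poissonWeight ν s : ℂ) * Complex.exp (Complex.I * w * s)) *
      Complex.I_sq

/-! ### The normalized Bessel function `√w J_ν(w)` -/

/-- The function `√w J_ν(w)` with the principal branch of the power. -/
def sqrtBessel (ν : ℝ) (w : ℂ) : ℂ :=
  (2 : ℂ) ^ (-ν : ℂ) * w ^ ((ν + 1 / 2 : ℝ) : ℂ) * besselEntireDeriv ν 0 w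

/-- The derivative of `sqrtBessel`. -/
def sqrtBesselDeriv (ν : ℝ) (w : ℂ) : ℂ :=
  (2 : ℂ) ^ (-ν : ℂ) * w ^ ((ν + 1 / 2 : ℝ) : ℂ) *
    (((ν + 1 / 2 : ℝ) : ℂ) / w * besselEntireDeriv ν 0 w + besselEntireDeriv ν 1 w)

lemma hasDerivAt_cpow_div {w c : ℂ} (hw : w ∈ Complex.slitPlane) :
    HasDerivAt (fun w : ℂ => w ^ c) (w ^ c * (c / w)) w := by
  have h := (hasDerivAt_id w).cpow_const (c := c) hw
  refine h.congr_deriv ?_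
  simp only [id, mul_one]
  rw [Complex.cpow_sub _ _ (Complex.slitPlane_ne_zero hw), Complex.cpow_one]
  ring

lemma hasDerivAt_sqrtBessel {ν : ℝ} (hν : 1 / 2 < ν) {w : ℂ} (hw : w ∈ Complex.slitPlane) :
    HasDerivAt (sqrtBessel ν) (sqrtBesselDeriv ν w) w := by
  have h := ((hasDerivAt_cpow_div (c := ((ν + 1 / 2 : ℝ) : ℂ)) hw).const_mul
    ((2 : ℂ) ^ (-ν : ℂ))).mul (hasDerivAt_besselEntireDeriv hν 0 w)
  refine h.congr_deriv ?_
  simp only [sqrtBesselDeriv, zero_add]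
  ring

/-- The factor √w removes the first-order term of Bessel's equation, leaving the centrifugal
potential with coefficient ν² - 1/4. -/
lemma hasDerivAt_sqrtBesselDeriv {ν : ℝ} (hν : 1 / 2 < ν) {w : ℂ}
    (hw : w ∈ Complex.slitPlane) :
    HasDerivAt (sqrtBesselDeriv ν) ((((ν ^ 2 - 1 / 4 : ℝ) : ℂ) / w ^ 2 - 1) * sqrtBessel ν w) w := by
  have hw0 := Complex.slitPlane_ne_zero hw
  have hd : HasDerivAt (fun w : ℂ => ((ν + 1 / 2 : ℝ) : ℂ) / w)
      (-((ν + 1 / 2 : ℝ) : ℂ) / w ^ 2) w := by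
    have := (hasDerivAt_inv hw0).const_mul ((ν + 1 / 2 : ℝ) : ℂ)
    simp only [div_eq_mul_inv]
    exact this.congr_deriv (by ring_nf)
  have h := ((hasDerivAt_cpow_div (c := ((ν + 1 / 2 : ℝ) : ℂ)) hw).const_mul
    ((2 : ℂ) ^ (-ν : ℂ))).mul ((hd.mul (hasDerivAt_besselEntireDeriv hν 0 w)).add
      (hasDerivAt_besselEntireDeriv hν 1 w))
  refine h.congr_deriv ?_
  have ode := besselEntire_ode hν w
  have h2 : besselEntireDeriv ν 2 w = -(2 * ν + 1) / w * besselEntireDeriv ν 1 w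
      - besselEntireDeriv ν 0 w := by
    field_simp
    linear_combination ode
  simp only [zero_add, sqrtBessel, Nat.reduceAdd, Pi.add_apply, Pi.mul_apply]
  rw [h2]
  push_cast
  field_simp
  ring

/-! ### The modulated function `e^{iw} √w J_ν(w)` -/

/-- The function `e^{iw} √w J_ν(w)`. -/
def modBessel (ν : ℝ) (w : ℂ) : ℂ := Complex.exp (Complex.I * w) * sqrtBessel ν w

/-- The derivative of `modBessel`. -/
def modBesselDeriv (ν : ℝ) (w : ℂ) : ℂ :=
  Complex.exp (Complex.I * w) * (Complex.I * sqrtBessel ν w + sqrtBesselDeriv ν w)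

lemma hasDerivAt_exp_I_mul (w : ℂ) :
    HasDerivAt (fun w : ℂ => Complex.exp (Complex.I * w))
      (Complex.exp (Complex.I * w) * Complex.I) w := by
  have h : HasDerivAt (fun w : ℂ => Complex.I * w) Complex.I w := by
    simpa using (hasDerivAt_id w).const_mul Complex.I
  exact h.cexp

lemma hasDerivAt_modBessel {ν : ℝ} (hν : 1 / 2 < ν) {w : ℂ} (hw : w ∈ Complex.slitPlane) :
    HasDerivAt (modBessel ν) (modBesselDeriv ν w) w := by
  refine ((hasDerivAt_exp_I_mul w).mul (hasDerivAt_sqrtBessel hν hw)).congr_deriv ?_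
  simp only [modBesselDeriv]
  ring

/-- The modulation e^{iw} cancels the -1 of the equation for √w J_ν; what is left besides 2iH'
decays like w^{-2}. -/
lemma hasDerivAt_modBesselDeriv {ν : ℝ} (hν : 1 / 2 < ν) {w : ℂ} (hw : w ∈ Complex.slitPlane) :
    HasDerivAt (modBesselDeriv ν) (2 * Complex.I * modBesselDeriv ν w
      + ((ν ^ 2 - 1 / 4 : ℝ) : ℂ) / w ^ 2 * modBessel ν w) w := by
  refine ((hasDerivAt_exp_I_mul w).mul (((hasDerivAt_sqrtBessel hν hw).const_mul Complex.I).add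
    (hasDerivAt_sqrtBesselDeriv hν hw))).congr_deriv ?_
  simp only [modBesselDeriv, modBessel, Pi.add_apply]
  linear_combination (-Complex.exp (Complex.I * w) * sqrtBessel ν w) * Complex.I_sq

/-- The closed first quadrant without the origin. -/
def quadrant : Set ℂ := {w | 0 ≤ w.re ∧ 0 ≤ w.im ∧ w ≠ 0}

lemma quadrant_subset_slitPlane : quadrant ⊆ Complex.slitPlane := by
  rintro w ⟨h1, h2, h3⟩
  rw [Complex.mem_slitPlane_iff]
  rcases h1.lt_or_eq with h | h
  · exact Or.inl h
  · refine Or.inr fun h4 => h3 (Complex.ext h.symm h4)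

lemma smul_mem_quadrant {w : ℂ} (hw : w ∈ quadrant) {r : ℝ} (hr : 0 < r) :
    (r : ℂ) * w ∈ quadrant := by
  refine ⟨?_, ?_, mul_ne_zero (by exact_mod_cast hr.ne') hw.2.2⟩
  · simpa using mul_nonneg hr.le hw.1
  · simpa using mul_nonneg hr.le hw.2.1

lemma norm_exp_I_mul_le_one {w : ℂ} (hw : 0 ≤ w.im) : ‖Complex.exp (Complex.I * w)‖ ≤ 1 := by
  rw [Complex.norm_exp]
  simpa using hw

lemma norm_cpow_mul_div {w : ℂ} {μ : ℝ} (hw0 : w ≠ 0) :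
    ‖w ^ (μ : ℂ) * (μ / w)‖ = |μ| * ‖w‖ ^ (μ - 1) := by
  rw [norm_mul, Complex.norm_cpow_real, norm_div, Complex.norm_real, Real.norm_eq_abs,
    Real.rpow_sub_one (norm_ne_zero_iff.2 hw0)]
  ring

lemma sqrtBesselDeriv_eq (ν : ℝ) (w : ℂ) : sqrtBesselDeriv ν w = (2 : ℂ) ^ (-ν : ℂ) *
    (w ^ ((ν + 1 / 2 : ℝ) : ℂ) * (((ν + 1 / 2 : ℝ) : ℂ) / w) * besselEntireDeriv ν 0 w
      + w ^ ((ν + 1 / 2 : ℝ) : ℂ) * besselEntireDeriv ν 1 w) := by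
  rw [sqrtBesselDeriv]; ring

/-- The exponent is the one produced by differentiating w^{ν+1/2}. Its positivity gives boundedness
near 0 and also the limits at x = 0. -/
lemma exists_norm_sqrtBessel_le {ν : ℝ} (hν : 1 / 2 < ν) :
    ∃ C, 0 ≤ C ∧ ∀ w : ℂ, w ≠ 0 → ‖w‖ ≤ 1 →
      ‖sqrtBessel ν w‖ ≤ C * ‖w‖ ^ (ν - 1 / 2) ∧ ‖sqrtBesselDeriv ν w‖ ≤ C * ‖w‖ ^ (ν - 1 / 2) := by
  obtain ⟨C0, hC0, h0⟩ := exists_norm_besselEntireDeriv_le hν 0 1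
  obtain ⟨C1, hC1, h1⟩ := exists_norm_besselEntireDeriv_le hν 1 1
  refine ⟨‖(2 : ℂ) ^ (-ν : ℂ)‖ * ((ν + 1 / 2) * C0 + C1), by positivity, fun w hw0 hw => ?_⟩
  have hwp : 0 < ‖w‖ := norm_pos_iff.2 hw0
  have e1 : ‖w‖ ^ (ν + 1 / 2) ≤ ‖w‖ ^ (ν - 1 / 2) :=
    Real.rpow_le_rpow_of_exponent_ge hwp hw (by linarith)
  have hb0 := h0 w hw
  have hb1 := h1 w hw
  have hr : 0 ≤ ‖w‖ ^ (ν - 1 / 2) := by positivity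
  constructor
  · rw [sqrtBessel, norm_mul, norm_mul, Complex.norm_cpow_real, mul_assoc, mul_assoc]
    refine mul_le_mul_of_nonneg_left ?_ (norm_nonneg _)
    calc ‖w‖ ^ (ν + 1 / 2) * ‖besselEntireDeriv ν 0 w‖ ≤ ‖w‖ ^ (ν - 1 / 2) * C0 := by gcongr
      _ ≤ ((ν + 1 / 2) * C0 + C1) * ‖w‖ ^ (ν - 1 / 2) := by
        have : C0 ≤ (ν + 1 / 2) * C0 + C1 := by nlinarith
        nlinarith
  · rw [sqrtBesselDeriv_eq, norm_mul, mul_assoc ‖(2 : ℂ) ^ (-ν : ℂ)‖]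
    refine mul_le_mul_of_nonneg_left (le_trans (norm_add_le _ _) ?_) (norm_nonneg _)
    rw [norm_mul, norm_cpow_mul_div hw0, norm_mul, Complex.norm_cpow_real,
      abs_of_pos (by linarith), show ν + 1 / 2 - 1 = ν - 1 / 2 by ring]
    calc (ν + 1 / 2) * ‖w‖ ^ (ν - 1 / 2) * ‖besselEntireDeriv ν 0 w‖
          + ‖w‖ ^ (ν + 1 / 2) * ‖besselEntireDeriv ν 1 w‖
        ≤ (ν + 1 / 2) * ‖w‖ ^ (ν - 1 / 2) * C0 + ‖w‖ ^ (ν - 1 / 2) * C1 := by gcongr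
      _ = _ := by ring

lemma exists_norm_modBessel_le_of_norm_le_one {ν : ℝ} (hν : 1 / 2 < ν) :
    ∃ C, 0 ≤ C ∧ ∀ w ∈ quadrant, ‖w‖ ≤ 1 → ‖modBessel ν w‖ ≤ C ∧ ‖modBesselDeriv ν w‖ ≤ C := by
  obtain ⟨C, hC, h⟩ := exists_norm_sqrtBessel_le hν
  refine ⟨2 * C, by positivity, fun w hw hw1 => ?_⟩
  obtain ⟨h0, h1⟩ := h w hw.2.2 hw1
  have hr : ‖w‖ ^ (ν - 1 / 2) ≤ 1 := Real.rpow_le_one (norm_nonneg _) hw1 (by linarith)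
  have h0' : ‖sqrtBessel ν w‖ ≤ C := h0.trans (mul_le_of_le_one_right hC hr)
  have h1' : ‖sqrtBesselDeriv ν w‖ ≤ C := h1.trans (mul_le_of_le_one_right hC hr)
  have he := norm_exp_I_mul_le_one hw.2.1
  constructor
  · rw [modBessel, norm_mul]
    nlinarith [norm_nonneg (sqrtBessel ν w)]
  · rw [modBesselDeriv, norm_mul]
    have : ‖Complex.I * sqrtBessel ν w + sqrtBesselDeriv ν w‖ ≤ 2 * C := by
      refine (norm_add_le _ _).trans ?_
      rw [norm_mul, Complex.norm_I]
      linarith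
    calc _ ≤ 1 * (2 * C) := mul_le_mul he this (norm_nonneg _) zero_le_one
      _ = 2 * C := one_mul _

/-- Used with c = 2iw, whose real part -2 Im w is nonpositive on the quadrant: this is the
dissipation in the energy estimate. -/
lemma real_inner_mul_self (c u : ℂ) : inner ℝ u (c * u) = c.re * ‖u‖ ^ 2 := by
  rw [Complex.inner, Complex.sq_norm, Complex.normSq_apply]
  simp only [Complex.mul_re, Complex.mul_im, Complex.conj_re, Complex.conj_im]
  ring

/-- The combination `2iH - H'` of `H = modBessel` and its derivative. -/
def modBesselTail (ν : ℝ) (w : ℂ) : ℂ := 2 * Complex.I * modBessel ν w - modBesselDeriv ν w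

/-- In this combination the 2iH' terms cancel, so the derivative is of order w^{-2} wherever H is
bounded. -/
lemma hasDerivAt_modBesselTail {ν : ℝ} (hν : 1 / 2 < ν) {w : ℂ} (hw : w ∈ Complex.slitPlane) :
    HasDerivAt (modBesselTail ν) (-(((ν ^ 2 - 1 / 4 : ℝ) : ℂ) / w ^ 2 * modBessel ν w)) w := by
  refine (((hasDerivAt_modBessel hν hw).const_mul (2 * Complex.I)).sub
    (hasDerivAt_modBesselDeriv hν hw)).congr_deriv ?_
  ring

lemma hasDerivAt_comp_ray {f : ℂ → ℂ} {f' w : ℂ} {r : ℝ} (hf : HasDerivAt f f' (r * w)) :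
    HasDerivAt (fun r : ℝ => f (r * w)) (w * f') r := by
  have h : HasDerivAt (fun z : ℂ => z * w) w (r : ℂ) := by
    simpa using (hasDerivAt_id (r : ℂ)).mul_const w
  exact ((HasDerivAt.comp (r : ℂ) hf h).congr_deriv (mul_comm _ _)).comp_ofReal

/-- The energy `|H'|² + |2iH - H'|²` on a ray of the quadrant is at most its value at the unit
circle, up to a constant. -/
lemma energy_le {ν : ℝ} (hν : 1 / 2 < ν) {w : ℂ} (hw : w ∈ quadrant) (hw1 : ‖w‖ = 1) {r : ℝ}
    (hr : 1 ≤ r) :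
    ‖modBesselDeriv ν (r * w)‖ ^ 2 + ‖modBesselTail ν (r * w)‖ ^ 2 ≤
      (‖modBesselDeriv ν w‖ ^ 2 + ‖modBesselTail ν w‖ ^ 2) *
        Real.exp (2 * (ν ^ 2 - 1 / 4)) := by
  set lam : ℝ := ν ^ 2 - 1 / 4 with hlam
  have hlam0 : 0 < lam := by nlinarith
  set E : ℝ → ℝ := fun r => ‖modBesselDeriv ν (r * w)‖ ^ 2 + ‖modBesselTail ν (r * w)‖ ^ 2
    with hE
  set E' : ℝ → ℝ := fun r =>
    2 * inner ℝ (modBesselDeriv ν (r * w)) (w * (2 * Complex.I * modBesselDeriv ν (r * w)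
      + (lam : ℂ) / (r * w) ^ 2 * modBessel ν (r * w)))
    + 2 * inner ℝ (modBesselTail ν (r * w))
      (w * -((lam : ℂ) / (r * w) ^ 2 * modBessel ν (r * w))) with hE'
  have hderiv : ∀ s : ℝ, 0 < s → HasDerivAt E (E' s) s := by
    intro s hs
    have hs' := quadrant_subset_slitPlane (smul_mem_quadrant hw hs)
    exact (hasDerivAt_comp_ray (hasDerivAt_modBesselDeriv hν hs')).norm_sq.add
      (hasDerivAt_comp_ray (hasDerivAt_modBesselTail hν hs')).norm_sq
  -- With u = H', v = 2iH - H', the term 2iH' contributes -4 Im w |u|² ≤ 0. The rest is at most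
  -- 2(λ/s²)|H|(|u| + |v|), and 2|H| ≤ |u| + |v|.
  have hbound : ∀ s : ℝ, 0 < s → E' s ≤ 2 * lam / s ^ 2 * E s := by
    intro s hs
    set u := modBesselDeriv ν (s * w)
    set v := modBesselTail ν (s * w) with hv
    set h := modBessel ν (s * w)
    have hh : 2 * ‖h‖ ≤ ‖u‖ + ‖v‖ := by
      have : u + v = 2 * Complex.I * h := by rw [hv, modBesselTail]; ring
      have h2 := norm_add_le u v
      rw [this] at h2
      simpa using h2
    set q : ℂ := w * ((lam : ℂ) / (s * w) ^ 2 * h) with hq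
    have hqn : ‖q‖ = lam / s ^ 2 * ‖h‖ := by
      rw [hq, norm_mul, norm_mul, norm_div, norm_pow, norm_mul, hw1, Complex.norm_real,
        Complex.norm_real, Real.norm_of_nonneg hlam0.le, Real.norm_of_nonneg hs.le, mul_one,
        one_mul]
    have e1 : E' s = 2 * inner ℝ u ((2 * Complex.I * w) * u) + 2 * inner ℝ u q
        - 2 * inner ℝ v q := by
      simp only [hE']
      rw [show w * (2 * Complex.I * u + (lam : ℂ) / (s * w) ^ 2 * h)
        = (2 * Complex.I * w) * u + q by rw [hq]; ring, inner_add_right,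
        show w * -((lam : ℂ) / (s * w) ^ 2 * h) = -q by rw [hq]; ring, inner_neg_right]
      ring
    have i1 := real_inner_mul_self (2 * Complex.I * w) u
    have i2 := real_inner_le_norm u q
    have i3 := neg_le_of_abs_le (abs_real_inner_le_norm v q)
    have i4 : (2 * Complex.I * w).re = -2 * w.im := by simp
    have i5 : 0 ≤ w.im * ‖u‖ ^ 2 := mul_nonneg hw.2.1 (by positivity)
    have hc : 0 ≤ lam / s ^ 2 := by positivity
    have i6 : ‖q‖ * (‖u‖ + ‖v‖) ≤ lam / s ^ 2 * (‖u‖ ^ 2 + ‖v‖ ^ 2) := by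
      rw [hqn, mul_assoc]
      refine mul_le_mul_of_nonneg_left ?_ hc
      nlinarith [sq_nonneg (‖u‖ - ‖v‖), norm_nonneg u, norm_nonneg v, norm_nonneg h]
    have : E s = ‖u‖ ^ 2 + ‖v‖ ^ 2 := rfl
    rw [e1, i1, i4, this, mul_div_assoc]
    nlinarith
  have hexp : ∀ s : ℝ, 0 < s → HasDerivAt (fun s : ℝ => Real.exp (2 * lam * s⁻¹))
      (Real.exp (2 * lam * s⁻¹) * (2 * lam * -(s ^ 2)⁻¹)) s := fun s hs =>
    ((hasDerivAt_inv hs.ne').const_mul (2 * lam)).exp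
  have hprod : ∀ s : ℝ, 0 < s → HasDerivAt (fun s => E s * Real.exp (2 * lam * s⁻¹))
      (E' s * Real.exp (2 * lam * s⁻¹)
        + E s * (Real.exp (2 * lam * s⁻¹) * (2 * lam * -(s ^ 2)⁻¹))) s :=
    fun s hs => (hderiv s hs).mul (hexp s hs)
  -- Grönwall with integrating factor e^{2λ/s}, which is at least 1 and equals e^{2λ} at s = 1.
  have hanti : AntitoneOn (fun s => E s * Real.exp (2 * lam * s⁻¹)) (Set.Ici 1) := by
    refine antitoneOn_of_deriv_nonpos (convex_Ici 1)
      (fun s hs => (hprod s (one_pos.trans_le hs)).continuousAt.continuousWithinAt)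
      (fun s hs => ?_) (fun s hs => ?_)
    · rw [interior_Ici] at hs
      exact (hprod s (one_pos.trans hs)).differentiableAt.differentiableWithinAt
    · rw [interior_Ici] at hs
      have hs0 : (0 : ℝ) < s := one_pos.trans hs
      rw [(hprod s hs0).deriv]
      have := mul_le_mul_of_nonneg_right (hbound s hs0) (Real.exp_pos (2 * lam * s⁻¹)).le
      rw [div_eq_mul_inv] at this
      linarith
  have h1 := hanti (Set.self_mem_Ici) hr hr
  have h2 : E r ≤ E r * Real.exp (2 * lam * r⁻¹) := by
    refine le_mul_of_one_le_right (by positivity) (Real.one_le_exp ?_)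
    have : 0 < r := by linarith
    positivity
  have h3 : E 1 = ‖modBesselDeriv ν w‖ ^ 2 + ‖modBesselTail ν w‖ ^ 2 := by
    simp only [hE, Complex.ofReal_one, one_mul]
  simp only [inv_one, mul_one] at h1
  rw [h3] at h1
  exact h2.trans h1

/-- `e^{iw} √w J_ν(w)` and its derivative are bounded on the quadrant. -/
theorem exists_norm_modBessel_le {ν : ℝ} (hν : 1 / 2 < ν) :
    ∃ C, 0 ≤ C ∧ ∀ w ∈ quadrant, ‖modBessel ν w‖ ≤ C ∧ ‖modBesselDeriv ν w‖ ≤ C := by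
  obtain ⟨C, hC, h⟩ := exists_norm_modBessel_le_of_norm_le_one hν
  set X := Real.exp (2 * (ν ^ 2 - 1 / 4)) with hX
  have hX0 : 0 < X := Real.exp_pos _
  -- On the unit circle |H'| ≤ C and |2iH - H'| ≤ 3C, so the initial energy is at most (1 + 9)C².
  set D := √(10 * C ^ 2 * X) with hD
  refine ⟨max C D, hC.trans (le_max_left _ _), fun w hw => ?_⟩
  rcases le_total ‖w‖ 1 with hw1 | hw1
  · exact ⟨(h w hw hw1).1.trans (le_max_left _ _), (h w hw hw1).2.trans (le_max_left _ _)⟩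
  · have hpos : 0 < ‖w‖ := by linarith
    have hne : (‖w‖ : ℂ) ≠ 0 := by exact_mod_cast hpos.ne'
    set w₁ : ℂ := ((‖w‖⁻¹ : ℝ) : ℂ) * w with hw₁
    have hw₁q : w₁ ∈ quadrant := smul_mem_quadrant hw (by positivity)
    have hw₁1 : ‖w₁‖ = 1 := by
      rw [hw₁, norm_mul, Complex.norm_real, Real.norm_of_nonneg (by positivity),
        inv_mul_cancel₀ hpos.ne']
    have hww : (‖w‖ : ℂ) * w₁ = w := by
      rw [hw₁]; push_cast; rw [← mul_assoc, mul_inv_cancel₀ hne, one_mul]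
    have he := energy_le hν hw₁q hw₁1 hw1
    rw [hww] at he
    obtain ⟨b0, b1⟩ := h w₁ hw₁q hw₁1.le
    have hT : ‖modBesselTail ν w₁‖ ≤ 3 * C := by
      rw [modBesselTail]
      refine (norm_sub_le _ _).trans ?_
      simp only [norm_mul, Complex.norm_I, Complex.norm_ofNat, mul_one]
      linarith
    have hE : (‖modBesselDeriv ν w₁‖ ^ 2 + ‖modBesselTail ν w₁‖ ^ 2) * X ≤ 10 * C ^ 2 * X := by
      refine mul_le_mul_of_nonneg_right ?_ hX0.le
      nlinarith [norm_nonneg (modBesselDeriv ν w₁), norm_nonneg (modBesselTail ν w₁)]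
    have hu : ‖modBesselDeriv ν w‖ ≤ D := Real.le_sqrt_of_sq_le (by nlinarith)
    have hv : ‖modBesselTail ν w‖ ≤ D := Real.le_sqrt_of_sq_le (by nlinarith)
    have hh : 2 * ‖modBessel ν w‖ ≤ ‖modBesselDeriv ν w‖ + ‖modBesselTail ν w‖ := by
      have e : modBesselDeriv ν w + modBesselTail ν w = 2 * Complex.I * modBessel ν w := by
        rw [modBesselTail]; ring
      have h2 := norm_add_le (modBesselDeriv ν w) (modBesselTail ν w)
      rw [e] at h2
      simpa using h2
    exact ⟨le_max_of_le_right (by linarith), le_max_of_le_right hu⟩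

/-! ### Asymptotics on the imaginary axis -/

/-- Substitution s = x/r - 1, centred at the endpoint s = -1 where e^{-rs} is largest. The indicator
fixes the domain, as dominated convergence requires. -/
lemma rpow_mul_integral_poissonWeight {ν r : ℝ} (hr : 0 < r) :
    r ^ (ν + 1 / 2) * (Real.exp (-r) *
        ∫ s in (-1 : ℝ)..1, poissonWeight ν s * Real.exp (-(r * s)))
      = ∫ x in Set.Ioi (0 : ℝ), (Set.Ioc 0 (2 * r)).indicator
          (fun x => Real.exp (-x) * x ^ (ν - 1 / 2) * (2 - x / r) ^ (ν - 1 / 2)) x := by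
  have h1 : ∫ s in (-1 : ℝ)..1, poissonWeight ν s * Real.exp (-(r * s))
      = r⁻¹ * ∫ x in (0 : ℝ)..(2 * r), poissonWeight ν (r⁻¹ * x + -1) *
        Real.exp (-(r * (r⁻¹ * x + -1))) := by
    rw [intervalIntegral.integral_comp_mul_add
      (fun s => poissonWeight ν s * Real.exp (-(r * s))) (inv_ne_zero hr.ne')]
    rw [smul_eq_mul, inv_inv, ← mul_assoc, inv_mul_cancel₀ hr.ne', one_mul]
    congr 1
    · ring
    · field_simp; norm_num
  rw [h1, setIntegral_indicator measurableSet_Ioc,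
    Set.inter_eq_right.2 Set.Ioc_subset_Ioi_self,
    ← intervalIntegral.integral_of_le (by positivity), ← mul_assoc, ← mul_assoc,
    ← intervalIntegral.integral_const_mul]
  refine intervalIntegral.integral_congr fun x hx => ?_
  rw [Set.uIcc_of_le (by positivity)] at hx
  have hxr : 0 ≤ 2 - x / r := by
    rw [sub_nonneg, div_le_iff₀ hr]; exact hx.2
  have e1 : poissonWeight ν (r⁻¹ * x + -1)
      = (x ^ (ν - 1 / 2) / r ^ (ν - 1 / 2)) * (2 - x / r) ^ (ν - 1 / 2) := by
    rw [poissonWeight, ← Real.div_rpow hx.1 hr.le, ← Real.mul_rpow (div_nonneg hx.1 hr.le) hxr]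
    congr 1
    field_simp
    ring
  have e2 : Real.exp (-r) * Real.exp (-(r * (r⁻¹ * x + -1))) = Real.exp (-x) := by
    rw [← Real.exp_add]; congr 1; field_simp; ring
  have e3 : r ^ (ν + 1 / 2) = r ^ (ν - 1 / 2) * r := by
    rw [← Real.rpow_add_one hr.ne']; congr 1; ring
  have hp : 0 < r ^ (ν - 1 / 2) := by positivity
  rw [e1, e3, ← e2]
  field_simp

/-- Laplace's method: 2 - x/r tends to 2 and is bounded by it, so the Gamma integrand times
2^{ν-1/2} is both limit and majorant. -/
lemma tendsto_rpow_mul_integral_poissonWeight {ν : ℝ} (hν : 1 / 2 < ν) :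
    Tendsto (fun r : ℝ => r ^ (ν + 1 / 2) * (Real.exp (-r) *
        ∫ s in (-1 : ℝ)..1, poissonWeight ν s * Real.exp (-(r * s)))) atTop
      (𝓝 (2 ^ (ν - 1 / 2) * Real.Gamma (ν + 1 / 2))) := by
  have hlim : 2 ^ (ν - 1 / 2) * Real.Gamma (ν + 1 / 2)
      = ∫ x in Set.Ioi (0 : ℝ), Real.exp (-x) * x ^ (ν - 1 / 2) * 2 ^ (ν - 1 / 2) := by
    rw [integral_mul_const, Real.Gamma_eq_integral (by linarith),
      show ν + 1 / 2 - 1 = ν - 1 / 2 by ring, mul_comm]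
  have hint : IntegrableOn (fun x : ℝ => Real.exp (-x) * x ^ (ν - 1 / 2)) (Set.Ioi 0) := by
    have := Real.GammaIntegral_convergent (s := ν + 1 / 2) (by linarith)
    rwa [show ν + 1 / 2 - 1 = ν - 1 / 2 by ring] at this
  rw [hlim]
  refine Tendsto.congr' (f₁ := fun r => ∫ x in Set.Ioi (0 : ℝ), (Set.Ioc 0 (2 * r)).indicator
    (fun x => Real.exp (-x) * x ^ (ν - 1 / 2) * (2 - x / r) ^ (ν - 1 / 2)) x)
    ((eventually_gt_atTop 0).mono fun r hr => (rpow_mul_integral_poissonWeight hr).symm) ?_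
  have hq : 0 ≤ ν - 1 / 2 := by linarith
  refine tendsto_integral_filter_of_dominated_convergence
    (fun x => Real.exp (-x) * x ^ (ν - 1 / 2) * 2 ^ (ν - 1 / 2))
    (Eventually.of_forall fun r => ?_) ((eventually_gt_atTop 0).mono fun r hr => ?_)
    (hint.mul_const _) ?_
  · refine Measurable.aestronglyMeasurable (Measurable.indicator ?_ measurableSet_Ioc)
    fun_prop
  · filter_upwards [ae_restrict_mem measurableSet_Ioi] with x hx
    have hx : 0 < x := hx
    by_cases hm : x ∈ Set.Ioc 0 (2 * r)
    · rw [Set.indicator_of_mem hm]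
      have hxr : 0 ≤ 2 - x / r := by
        rw [sub_nonneg, div_le_iff₀ hr]; exact hm.2
      have hxr2 : 2 - x / r ≤ 2 := by
        have : 0 ≤ x / r := by positivity
        linarith
      rw [Real.norm_of_nonneg (by positivity)]
      gcongr
    · rw [Set.indicator_of_notMem hm, norm_zero]
      positivity
  · filter_upwards [ae_restrict_mem measurableSet_Ioi] with x hx
    have hx : 0 < x := hx
    have h1 : Tendsto (fun r : ℝ => Real.exp (-x) * x ^ (ν - 1 / 2) * (2 - x / r) ^ (ν - 1 / 2))
        atTop (𝓝 (Real.exp (-x) * x ^ (ν - 1 / 2) * 2 ^ (ν - 1 / 2))) := by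
      refine Tendsto.const_mul _ ?_
      have h2 : Tendsto (fun r : ℝ => 2 - x / r) atTop (𝓝 (2 - 0)) :=
        tendsto_const_nhds.sub (tendsto_const_nhds.div_atTop tendsto_id)
      rw [sub_zero] at h2
      exact h2.rpow_const (Or.inl two_ne_zero)
    refine h1.congr' ((eventually_gt_atTop x).mono fun r hr => ?_)
    have hm : x ∈ Set.Ioc 0 (2 * r) := ⟨hx, by linarith⟩
    simp only [Set.indicator_of_mem hm]

lemma ofReal_mul_cpow_real {r : ℝ} (hr : 0 < r) {z : ℂ} (hz : z ≠ 0) (c : ℝ) :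
    ((r : ℂ) * z) ^ (c : ℂ) = ((r ^ c : ℝ) : ℂ) * z ^ (c : ℂ) := by
  have hr' : (r : ℂ) ≠ 0 := by exact_mod_cast hr.ne'
  rw [Complex.cpow_def_of_ne_zero (mul_ne_zero hr' hz), Complex.log_ofReal_mul hr hz,
    Complex.ofReal_cpow hr.le, Complex.cpow_def_of_ne_zero hr', Complex.cpow_def_of_ne_zero hz,
    ← Complex.exp_add, Complex.ofReal_log hr.le, add_mul]

/-- The limit `i^{ν + 1/2} / √(2π)` of `e^{iw} √w J_ν(w)` along the imaginary axis. -/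
def modBesselLimit (ν : ℝ) : ℂ := Complex.I ^ ((ν + 1 / 2 : ℝ) : ℂ) / (√(2 * Real.pi) : ℝ)

/-- At w = ir Poisson's integral is the real Laplace integral of the weight, and e^{iw} = e^{-r}
compensates its growth. -/
lemma tendsto_modBessel_imaginary {ν : ℝ} (hν : 1 / 2 < ν) :
    Tendsto (fun r : ℝ => modBessel ν (r * Complex.I)) atTop (𝓝 (modBesselLimit ν)) := by
  set κ : ℝ := (√Real.pi * Real.Gamma (ν + 1 / 2))⁻¹ with hκ
  have hG : 0 < Real.Gamma (ν + 1 / 2) := Real.Gamma_pos_of_pos (by linarith)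
  have h1 := (((tendsto_rpow_mul_integral_poissonWeight hν).const_mul
    ((2 : ℝ) ^ (-ν) * κ)).ofReal).mul_const (Complex.I ^ ((ν + 1 / 2 : ℝ) : ℂ))
  have hlim : (2 : ℝ) ^ (-ν) * κ * (2 ^ (ν - 1 / 2) * Real.Gamma (ν + 1 / 2))
      = (√(2 * Real.pi))⁻¹ := by
    have e : (2 : ℝ) ^ (-ν) * 2 ^ (ν - 1 / 2) = (√2)⁻¹ := by
      rw [← Real.rpow_add two_pos, Real.sqrt_eq_rpow, ← Real.rpow_neg two_pos.le]
      congr 1; ring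
    rw [hκ, Real.sqrt_mul two_pos.le, mul_inv, mul_inv]
    calc _ = ((2 : ℝ) ^ (-ν) * 2 ^ (ν - 1 / 2)) * (√Real.pi)⁻¹ *
          ((Real.Gamma (ν + 1 / 2))⁻¹ * Real.Gamma (ν + 1 / 2)) := by ring
      _ = _ := by rw [e, inv_mul_cancel₀ hG.ne', mul_one]
  rw [hlim] at h1
  have hl : ((((√(2 * Real.pi))⁻¹ : ℝ) : ℂ)) * Complex.I ^ ((ν + 1 / 2 : ℝ) : ℂ)
      = modBesselLimit ν := by
    rw [modBesselLimit]; push_cast; ring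
  have h1' : Tendsto _ atTop (𝓝 (modBesselLimit ν)) := hl ▸ h1
  refine h1'.congr' ((eventually_gt_atTop 0).mono fun r hr => ?_)
  have hT : unitTransform (fun s => (poissonWeight ν s : ℂ) * (Complex.I * s) ^ 0)
      (r * Complex.I)
      = ((∫ s in (-1 : ℝ)..1, poissonWeight ν s * Real.exp (-(r * s)) : ℝ) : ℂ) := by
    rw [unitTransform, ← intervalIntegral.integral_ofReal]
    refine intervalIntegral.integral_congr fun s _ => ?_
    have e : Complex.I * (r * Complex.I) * s = ((-(r * s) : ℝ) : ℂ) := by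
      push_cast
      linear_combination (r * s : ℂ) * Complex.I_sq
    simp only [e, pow_zero, mul_one]
    push_cast; rfl
  have hE : Complex.exp (Complex.I * (r * Complex.I)) = ((Real.exp (-r) : ℝ) : ℂ) := by
    have e : Complex.I * (r * Complex.I) = ((-r : ℝ) : ℂ) := by
      push_cast
      linear_combination (r : ℂ) * Complex.I_sq
    rw [e, Complex.ofReal_exp]
  have h2 : (2 : ℂ) ^ (-ν : ℂ) = (((2 : ℝ) ^ (-ν) : ℝ) : ℂ) := by
    rw [Complex.ofReal_cpow two_pos.le]; push_cast; rfl
  simp only [modBessel, sqrtBessel, besselEntireDeriv, hT, hE, h2,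
    ofReal_mul_cpow_real hr Complex.I_ne_zero]
  rw [hκ]
  push_cast
  ring

/-! ### Asymptotics on the real axis -/

/-- A function on `[1, ∞)` whose derivative is `O(r⁻²)` has a limit, with rate `O(r⁻¹)`. -/
lemma exists_limit_of_norm_deriv_le {f f' : ℝ → ℂ} {C : ℝ}
    (hf : ∀ r, 1 ≤ r → HasDerivAt f (f' r) r) (hC : ∀ r, 1 ≤ r → ‖f' r‖ ≤ C / r ^ 2) :
    ∃ L, ∀ r, 1 ≤ r → ‖f r - L‖ ≤ C / r := by
  have hC0 : 0 ≤ C := by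
    have := (norm_nonneg _).trans (hC 1 le_rfl)
    simpa using this
  have key : ∀ r s, 1 ≤ r → r ≤ s → ‖f s - f r‖ ≤ C / r := by
    intro r s hr hrs
    have hpos : ∀ x ∈ Set.Icc r s, 0 < x := fun x hx => by linarith [hx.1]
    have hB : ∀ x ∈ Set.Icc r s, HasDerivAt (fun x => C * r⁻¹ - C * x⁻¹) (C / x ^ 2) x := by
      intro x hx
      have := ((hasDerivAt_inv (hpos x hx).ne').const_mul C).const_sub (C * r⁻¹)
      exact this.congr_deriv (by ring)
    have hF : ∀ x ∈ Set.Icc r s, HasDerivAt (fun x => f x - f r) (f' x) x := fun x hx =>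
      (hf x (by linarith [hx.1])).sub_const _
    have := image_norm_le_of_norm_deriv_right_le_deriv_boundary'
      (f := fun x => f x - f r) (f' := f') (a := r) (b := s)
      (B := fun x => C * r⁻¹ - C * x⁻¹) (B' := fun x => C / x ^ 2)
      (fun x hx => (hF x hx).continuousAt.continuousWithinAt)
      (fun x hx => (hF x ⟨hx.1, hx.2.le⟩).hasDerivWithinAt)
      (by simp)
      (fun x hx => (hB x hx).continuousAt.continuousWithinAt)
      (fun x hx => (hB x ⟨hx.1, hx.2.le⟩).hasDerivWithinAt)
      (fun x hx => hC x (by linarith [hx.1])) (Set.right_mem_Icc.2 hrs)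
    refine this.trans ?_
    have h1 : 0 ≤ C * s⁻¹ := mul_nonneg hC0 (inv_nonneg.2 (by linarith))
    rw [div_eq_mul_inv]
    linarith
  have htend : Tendsto (fun r : ℝ => C / r) atTop (𝓝 0) :=
    tendsto_const_nhds.div_atTop tendsto_id
  -- The truncation by 1 is needed because f is controlled only on [1, ∞).
  have hcauchy : CauchySeq (fun r : ℝ => f (max r 1)) := by
    refine cauchySeq_of_le_tendsto_0' (fun r => C / max r 1) (fun n m hnm => ?_) ?_
    · rw [dist_comm, dist_eq_norm]
      exact key _ _ (le_max_right _ _) (max_le_max_right _ hnm)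
    · refine htend.congr' ((eventually_ge_atTop 1).mono fun r hr => ?_)
      simp only [max_eq_left hr]
  obtain ⟨L, hL⟩ := cauchySeq_tendsto_of_complete hcauchy
  refine ⟨L, fun r hr => ?_⟩
  rw [norm_sub_rev]
  refine le_of_tendsto (hL.sub_const (f r)).norm
    ((eventually_ge_atTop r).mono fun s hs => ?_)
  exact key r _ hr (hs.trans (le_max_left _ _))

/-- If `f` and `f'` converge at infinity, then the limit of `f'` is zero. -/
lemma limit_deriv_eq_zero {f f' : ℝ → ℂ} {a m : ℂ} (hf : ∀ r, 0 < r → HasDerivAt f (f' r) r)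
    (ha : Tendsto f atTop (𝓝 a)) (hm : Tendsto f' atTop (𝓝 m)) : m = 0 := by
  have h1 : Tendsto (fun r => f (r + 1) - f r) atTop (𝓝 0) := by
    simpa using (ha.comp (tendsto_atTop_add_const_right _ 1 tendsto_id)).sub ha
  refine tendsto_nhds_unique (?_ : Tendsto (fun r => f (r + 1) - f r) atTop (𝓝 m)) h1
  rw [Metric.tendsto_atTop]
  intro ε hε
  obtain ⟨N, hN⟩ := Metric.tendsto_atTop.1 hm (ε / 2) (half_pos hε)
  refine ⟨max N 1, fun r hr => ?_⟩
  have hrN : N ≤ r := (le_max_left _ _).trans hr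
  have hr1 : 1 ≤ r := (le_max_right _ _).trans hr
  -- The mean value inequality for f(x) - mx over an interval of length one shows that f(r + 1) -
  -- f(r) is close to m.
  have hF : ∀ x ∈ Set.Icc r (r + 1), HasDerivWithinAt (fun x : ℝ => f x - m * x) (f' x - m)
      (Set.Icc r (r + 1)) x := by
    intro x hx
    have hl : HasDerivAt (fun x : ℝ => m * (x : ℂ)) m x := by
      simpa using ((hasDerivAt_id (x : ℂ)).const_mul m).comp_ofReal
    exact ((hf x (by linarith [hx.1])).sub hl).hasDerivWithinAt
  have := norm_image_sub_le_of_norm_deriv_le_segment' hF (C := ε / 2) (fun x hx => by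
    have := hN x (hrN.trans hx.1)
    rw [dist_eq_norm] at this
    exact this.le) (r + 1) (Set.right_mem_Icc.2 (by linarith))
  rw [dist_eq_norm]
  have e : f (r + 1) - m * ((r + 1 : ℝ) : ℂ) - (f r - m * r) = f (r + 1) - f r - m := by
    push_cast; ring
  rw [e] at this
  linarith

/-- Mean value inequality on the convex part Re w + Im w ≥ r of the quadrant. There |w| ≥ r/2, so
the derivative is at most 4λC/r², while the points r and ir are at distance at most 2r. -/
lemma norm_modBesselTail_sub_le {ν C : ℝ} (hν : 1 / 2 < ν)
    (hC : ∀ w ∈ quadrant, ‖modBessel ν w‖ ≤ C ∧ ‖modBesselDeriv ν w‖ ≤ C) {r : ℝ} (hr : 0 < r) :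
    ‖modBesselTail ν (r * Complex.I) - modBesselTail ν r‖ ≤ 8 * (ν ^ 2 - 1 / 4) * C / r := by
  set s : Set ℂ := {w | 0 ≤ w.re} ∩ {w | 0 ≤ w.im} ∩ {w | r ≤ w.re + w.im} with hs
  have hlam : 0 < ν ^ 2 - 1 / 4 := by nlinarith
  have hconv : Convex ℝ s := by
    refine ((convex_halfSpace_re_ge 0).inter (convex_halfSpace_im_ge 0)).inter ?_
    exact convex_halfSpace_ge (f := fun w : ℂ => w.re + w.im)
      ⟨fun x y => by simp; ring, fun c x => by simp; ring⟩ r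
  have hnorm : ∀ w ∈ s, r / 2 ≤ ‖w‖ := by
    intro w hw
    have h1 := Complex.re_le_norm w
    have h2 := (le_abs_self _).trans (Complex.abs_im_le_norm w)
    have h3 : r ≤ w.re + w.im := hw.2
    linarith
  have hq : ∀ w ∈ s, w ∈ quadrant := fun w hw => ⟨hw.1.1, hw.1.2, fun h => by
    have := hnorm w hw
    rw [h, norm_zero] at this
    linarith⟩
  have h := Convex.norm_image_sub_le_of_norm_hasDerivWithin_le (𝕜 := ℂ) (s := s)
    (f := modBesselTail ν)
    (f' := fun w => -(((ν ^ 2 - 1 / 4 : ℝ) : ℂ) / w ^ 2 * modBessel ν w))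
    (x := (r : ℂ)) (y := r * Complex.I) (C := (ν ^ 2 - 1 / 4) / (r / 2) ^ 2 * C)
    (fun w hw => (hasDerivAt_modBesselTail hν
      (quadrant_subset_slitPlane (hq w hw))).hasDerivWithinAt)
    (fun w hw => ?_) hconv ?_ ?_
  · refine h.trans ?_
    have hn : ‖(r : ℂ) * Complex.I - r‖ ≤ 2 * r := by
      refine (norm_sub_le _ _).trans ?_
      rw [norm_mul, Complex.norm_I, Complex.norm_real, Real.norm_of_nonneg hr.le]
      linarith
    have hC0 : 0 ≤ C := (norm_nonneg _).trans (hC 1 ⟨by simp, by simp, one_ne_zero⟩).1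
    calc _ ≤ (ν ^ 2 - 1 / 4) / (r / 2) ^ 2 * C * (2 * r) := by gcongr
      _ = _ := by field_simp; ring
  · rw [norm_neg, norm_mul, norm_div, norm_pow, Complex.norm_real, Real.norm_of_nonneg hlam.le]
    have := hnorm w hw
    have h2 := (hC w (hq w hw)).1
    gcongr
  · simp [hs, hr.le]
  · simp [hs, hr.le]

/-- The asymptotics of `e^{ir} √r J_ν(r)` for real `r → ∞`. -/
theorem exists_modBessel_asymptotics {ν : ℝ} (hν : 1 / 2 < ν) :
    ∃ D : ℂ, ∃ C : ℝ, ∀ r : ℝ, 1 ≤ r →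
      ‖modBessel ν r - (modBesselLimit ν + D * Complex.exp (2 * Complex.I * r))‖ ≤ C / r := by
  obtain ⟨C, hC0, hC⟩ := exists_norm_modBessel_le hν
  set lam : ℝ := ν ^ 2 - 1 / 4 with hlam
  have hlam0 : 0 < lam := by nlinarith
  have hone : (1 : ℂ) ∈ quadrant := ⟨by simp, by simp, one_ne_zero⟩
  have hI : Complex.I ∈ quadrant := ⟨by simp, by simp, Complex.I_ne_zero⟩
  have hreal : ∀ r : ℝ, 0 < r → (r : ℂ) ∈ quadrant := fun r hr => by
    simpa using smul_mem_quadrant hone hr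
  have hnorm : ∀ r : ℝ, 0 < r → ‖(lam : ℂ) / (r : ℂ) ^ 2 * modBessel ν r‖ ≤ lam * C / r ^ 2 := by
    intro r hr
    rw [norm_mul, norm_div, norm_pow, Complex.norm_real, Complex.norm_real,
      Real.norm_of_nonneg hlam0.le, Real.norm_of_nonneg hr.le, div_mul_eq_mul_div]
    have := (hC r (hreal r hr)).1
    gcongr
  obtain ⟨L, hL⟩ := exists_limit_of_norm_deriv_le (C := lam * C)
    (f := fun r : ℝ => modBesselTail ν r)
    (f' := fun r : ℝ => -((lam : ℂ) / (r : ℂ) ^ 2 * modBessel ν r))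
    (fun r hr => (hasDerivAt_modBesselTail hν
      (quadrant_subset_slitPlane (hreal r (by linarith)))).comp_ofReal)
    (fun r hr => by rw [norm_neg]; exact hnorm r (by linarith))
  -- The factor e^{-2ir} integrates out the term 2iH' of H'', so the derivative is again O(r^{-2}).
  obtain ⟨D, hD⟩ := exists_limit_of_norm_deriv_le (C := lam * C)
    (f := fun r : ℝ => Complex.exp (-(2 * Complex.I * r)) * modBesselDeriv ν r)
    (f' := fun r : ℝ => Complex.exp (-(2 * Complex.I * r)) *
      ((lam : ℂ) / (r : ℂ) ^ 2 * modBessel ν r))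
    (fun r hr => by
      have h1 : HasDerivAt (fun z : ℂ => -(2 * Complex.I * z)) (-(2 * Complex.I)) (r : ℂ) := by
        exact ((hasDerivAt_id (r : ℂ)).const_mul (2 * Complex.I)).neg.congr_deriv (by simp)
      have h2 := (h1.cexp.mul (hasDerivAt_modBesselDeriv hν
        (quadrant_subset_slitPlane (hreal r (by linarith))))).comp_ofReal
      exact h2.congr_deriv (by rw [hlam]; ring))
    (fun r hr => by
      rw [norm_mul, Complex.norm_exp]
      simpa using hnorm r (by linarith))
  have hLlim : Tendsto (fun r : ℝ => modBesselTail ν r) atTop (𝓝 L) := by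
    rw [tendsto_iff_norm_sub_tendsto_zero]
    refine squeeze_zero' (Eventually.of_forall fun _ => norm_nonneg _)
      ((eventually_ge_atTop 1).mono hL) (tendsto_const_nhds.div_atTop tendsto_id)
  have hLim : Tendsto (fun r : ℝ => modBesselTail ν (r * Complex.I)) atTop (𝓝 L) := by
    have h1 : Tendsto (fun r : ℝ => modBesselTail ν (r * Complex.I) - modBesselTail ν r) atTop
        (𝓝 0) := by
      rw [tendsto_zero_iff_norm_tendsto_zero]
      exact squeeze_zero' (Eventually.of_forall fun _ => norm_nonneg _)
        ((eventually_gt_atTop 0).mono fun r hr => norm_modBesselTail_sub_le hν hC hr)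
        (tendsto_const_nhds.div_atTop tendsto_id)
    simpa using h1.add hLlim
  have hH := tendsto_modBessel_imaginary hν
  -- On the imaginary axis H and 2iH - H' both converge, hence so does H'. Its limit must be 0 since
  -- H itself converges.
  have hLval : L = 2 * Complex.I * modBesselLimit ν := by
    have h0 := limit_deriv_eq_zero (f := fun r : ℝ => modBessel ν (r * Complex.I))
      (f' := fun r : ℝ => Complex.I * (2 * Complex.I * modBessel ν (r * Complex.I)
        - modBesselTail ν (r * Complex.I)))
      (fun r hr => (hasDerivAt_comp_ray (hasDerivAt_modBessel hν
        (quadrant_subset_slitPlane (smul_mem_quadrant hI hr)))).congr_deriv (by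
          rw [modBesselTail]; ring)) hH
      (((hH.const_mul (2 * Complex.I)).sub hLim).const_mul Complex.I)
    have := (mul_eq_zero.1 h0).resolve_left Complex.I_ne_zero
    exact (sub_eq_zero.1 this).symm
  -- H is the sum of 2iH - H' and H', divided by 2i. The two errors λC/r add up, and |2i| = 2 halves
  -- them.
  refine ⟨D / (2 * Complex.I), lam * C, fun r hr => ?_⟩
  have h2I : (2 * Complex.I : ℂ) ≠ 0 := mul_ne_zero two_ne_zero Complex.I_ne_zero
  have hexp : Complex.exp (2 * Complex.I * r) * Complex.exp (-(2 * Complex.I * r)) = 1 := by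
    rw [← Complex.exp_add, add_neg_cancel, Complex.exp_zero]
  have e : 2 * Complex.I * (modBessel ν r -
      (modBesselLimit ν + D / (2 * Complex.I) * Complex.exp (2 * Complex.I * r)))
      = (modBesselTail ν r - L) + Complex.exp (2 * Complex.I * r) *
        (Complex.exp (-(2 * Complex.I * r)) * modBesselDeriv ν r - D) := by
    have e1 : 2 * Complex.I * (D / (2 * Complex.I)) = D := mul_div_cancel₀ _ h2I
    rw [hLval, modBesselTail]
    linear_combination (-Complex.exp (2 * Complex.I * r)) * e1 - modBesselDeriv ν r * hexp
  have hn := congrArg norm e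
  have hexp1 : ‖Complex.exp (2 * Complex.I * r)‖ = 1 := by
    rw [Complex.norm_exp]; simp
  have h3 := norm_add_le (modBesselTail ν r - L) (Complex.exp (2 * Complex.I * r) *
        (Complex.exp (-(2 * Complex.I * r)) * modBesselDeriv ν r - D))
  rw [← hn, norm_mul, norm_mul, norm_mul, Complex.norm_I, hexp1, Complex.norm_ofNat] at h3
  have h4 := hL r hr
  have h5 := hD r hr
  linarith

/-! ### The Fresnel integral -/

/-- The primitive eighth root of unity `e^{iπ/4} = (1 + i)/√2`. -/
def eighthRoot : ℂ := Complex.exp (Complex.I * (Real.pi / 4 : ℝ))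

lemma eighthRoot_eq : eighthRoot = (√2 / 2 : ℝ) + (√2 / 2 : ℝ) * Complex.I := by
  rw [eighthRoot, mul_comm, Complex.exp_mul_I, ← Complex.ofReal_cos, ← Complex.ofReal_sin,
    Real.cos_pi_div_four, Real.sin_pi_div_four]

lemma eighthRoot_sq : eighthRoot ^ 2 = Complex.I := by
  rw [eighthRoot, ← Complex.exp_nat_mul,
    show ((2 : ℕ) : ℂ) * (Complex.I * (Real.pi / 4 : ℝ)) = Real.pi / 2 * Complex.I by
      push_cast; ring, Complex.exp_pi_div_two_mul_I]

lemma norm_eighthRoot : ‖eighthRoot‖ = 1 := by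
  rw [eighthRoot, Complex.norm_exp]; simp

/-- The integrand `e^{-ρ² + 2iζsρ}`, `ζ = e^{iπ/4}`, of the complementary Fresnel integral. -/
def fresnelIntegrand (s ρ : ℝ) : ℂ :=
  Complex.exp (-(ρ : ℂ) ^ 2 + 2 * Complex.I * eighthRoot * s * ρ)

lemma norm_fresnelIntegrand (s ρ : ℝ) :
    ‖fresnelIntegrand s ρ‖ = Real.exp (-ρ ^ 2 - √2 * s * ρ) := by
  rw [fresnelIntegrand, Complex.norm_exp, eighthRoot_eq]
  congr 1
  simp [pow_two]
  ring

/-- Completing the square, -√2 sρ ≤ s² + ρ²/2; this gives a Gaussian majorant locally uniform in s.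
-/
lemma norm_fresnelIntegrand_le {s c ρ : ℝ} (hs : |s| ≤ c) :
    ‖fresnelIntegrand s ρ‖ ≤ Real.exp (c ^ 2) * Real.exp (-(1 / 2) * ρ ^ 2) := by
  rw [norm_fresnelIntegrand, ← Real.exp_add]
  refine Real.exp_le_exp.2 ?_
  have h2 : √2 ^ 2 = 2 := Real.sq_sqrt two_pos.le
  have h3 : s ^ 2 ≤ c ^ 2 := sq_le_sq' (by linarith [neg_abs_le s]) (by linarith [le_abs_self s])
  nlinarith [sq_nonneg (√2 * s + ρ)]

lemma continuous_fresnelIntegrand (s : ℝ) : Continuous (fresnelIntegrand s) := by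
  unfold fresnelIntegrand; fun_prop

lemma integrableOn_fresnelIntegrand (s : ℝ) :
    IntegrableOn (fresnelIntegrand s) (Set.Ioi 0) := by
  refine Integrable.mono' (g := fun ρ => Real.exp (|s| ^ 2) * Real.exp (-(1 / 2) * ρ ^ 2)) ?_
    (continuous_fresnelIntegrand s).aestronglyMeasurable
    (Eventually.of_forall fun ρ => norm_fresnelIntegrand_le le_rfl)
  exact ((integrable_exp_neg_mul_sq (by norm_num)).const_mul _).integrableOn

/-- The complementary Fresnel integral without its phase. -/
def fresnelTail (s : ℝ) : ℂ := eighthRoot * ∫ ρ in Set.Ioi (0 : ℝ), fresnelIntegrand s ρ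

lemma hasDerivAt_fresnelIntegrand_left (s ρ : ℝ) :
    HasDerivAt (fun s => fresnelIntegrand s ρ)
      (2 * Complex.I * eighthRoot * ρ * fresnelIntegrand s ρ) s := by
  have h : HasDerivAt (fun s : ℂ => -(ρ : ℂ) ^ 2 + 2 * Complex.I * eighthRoot * s * ρ)
      (2 * Complex.I * eighthRoot * ρ) (s : ℂ) :=
    ((((hasDerivAt_id (s : ℂ)).const_mul (2 * Complex.I * eighthRoot)).mul_const
      (ρ : ℂ)).const_add _).congr_deriv (by simp)
  exact h.cexp.comp_ofReal.congr_deriv (by rw [fresnelIntegrand]; ring)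

lemma hasDerivAt_fresnelIntegrand_right (s ρ : ℝ) :
    HasDerivAt (fresnelIntegrand s)
      ((2 * Complex.I * eighthRoot * s - 2 * ρ) * fresnelIntegrand s ρ) ρ := by
  have h : HasDerivAt (fun ρ : ℂ => -ρ ^ 2 + 2 * Complex.I * eighthRoot * s * ρ)
      (2 * Complex.I * eighthRoot * s - 2 * ρ) (ρ : ℂ) :=
    (((hasDerivAt_pow 2 (ρ : ℂ)).neg).add ((hasDerivAt_id (ρ : ℂ)).const_mul
      (2 * Complex.I * eighthRoot * s))).congr_deriv (by simp; ring)
  exact h.cexp.comp_ofReal.congr_deriv (by rw [fresnelIntegrand]; ring)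

lemma hasDerivAt_fresnelTail_aux (s : ℝ) :
    IntegrableOn (fun ρ : ℝ => 2 * Complex.I * eighthRoot * ρ * fresnelIntegrand s ρ)
      (Set.Ioi 0) ∧
    HasDerivAt (fun s => ∫ ρ in Set.Ioi (0 : ℝ), fresnelIntegrand s ρ)
      (∫ ρ in Set.Ioi (0 : ℝ), 2 * Complex.I * eighthRoot * ρ * fresnelIntegrand s ρ) s := by
  refine hasDerivAt_integral_of_dominated_loc_of_deriv_le
    (μ := volume.restrict (Set.Ioi (0 : ℝ)))
    (F := fun s ρ => fresnelIntegrand s ρ)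
    (F' := fun s ρ => 2 * Complex.I * eighthRoot * ρ * fresnelIntegrand s ρ)
    (bound := fun ρ => 2 * Real.exp ((|s| + 1) ^ 2) * (ρ * Real.exp (-(1 / 2) * ρ ^ 2)))
    (s := Metric.ball s 1) (Metric.ball_mem_nhds s one_pos)
    (Eventually.of_forall fun s' => (continuous_fresnelIntegrand s').aestronglyMeasurable)
    (integrableOn_fresnelIntegrand s) ?_ ?_ ?_
    (Eventually.of_forall fun ρ s' _ => hasDerivAt_fresnelIntegrand_left s' ρ)
  · have := continuous_fresnelIntegrand s
    exact Continuous.aestronglyMeasurable (by fun_prop)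
  · filter_upwards [ae_restrict_mem measurableSet_Ioi] with ρ hρ s' hs'
    have hρ : 0 < ρ := hρ
    have hs : |s'| ≤ |s| + 1 := by
      have h1 : |s' - s| < 1 := by simpa [Real.dist_eq] using hs'
      have h2 := abs_sub_abs_le_abs_sub s' s
      linarith
    have h := norm_fresnelIntegrand_le (ρ := ρ) hs
    simp only [norm_mul, Complex.norm_I, norm_eighthRoot, Complex.norm_real, Complex.norm_ofNat,
      Real.norm_of_nonneg hρ.le, mul_one]
    calc 2 * ρ * ‖fresnelIntegrand s' ρ‖
        ≤ 2 * ρ * (Real.exp ((|s| + 1) ^ 2) * Real.exp (-(1 / 2) * ρ ^ 2)) := by gcongr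
      _ = _ := by ring
  · exact ((integrable_mul_exp_neg_mul_sq (by norm_num)).const_mul _).integrableOn

lemma tendsto_fresnelIntegrand (s : ℝ) : Tendsto (fresnelIntegrand s) atTop (𝓝 0) := by
  rw [tendsto_zero_iff_norm_tendsto_zero]
  refine squeeze_zero (fun _ => norm_nonneg _) (fun ρ => norm_fresnelIntegrand_le le_rfl)
    (?_ : Tendsto (fun ρ : ℝ => Real.exp (|s| ^ 2) * Real.exp (-(1 / 2) * ρ ^ 2)) atTop (𝓝 0))
  have h : Tendsto (fun ρ : ℝ => -(1 / 2) * ρ ^ 2) atTop atBot :=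
    (tendsto_pow_atTop two_ne_zero).const_mul_atTop_of_neg (by norm_num)
  rw [← mul_zero (Real.exp (|s| ^ 2))]
  exact (Real.tendsto_exp_atBot.comp h).const_mul (Real.exp (|s| ^ 2))

/-- The ρ-derivative of the integrand integrates to -1. Because ζ² = i, this relates the
s-derivative of the integral to the integral itself. -/
lemma hasDerivAt_fresnelTail (s : ℝ) :
    HasDerivAt fresnelTail (-1 - 2 * Complex.I * s * fresnelTail s) s := by
  obtain ⟨hint, hd⟩ := hasDerivAt_fresnelTail_aux s
  refine (hd.const_mul eighthRoot).congr_deriv ?_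
  have hint0 := integrableOn_fresnelIntegrand s
  have e : ∀ ρ : ℝ, (2 * Complex.I * eighthRoot * s - 2 * ρ) * fresnelIntegrand s ρ
      = 2 * Complex.I * eighthRoot * s * fresnelIntegrand s ρ
        + eighthRoot * (2 * Complex.I * eighthRoot * ρ * fresnelIntegrand s ρ) := by
    intro ρ
    linear_combination (-2 * Complex.I * ρ * fresnelIntegrand s ρ) * eighthRoot_sq
      - 2 * ρ * fresnelIntegrand s ρ * Complex.I_sq
  have key := integral_Ioi_of_hasDerivAt_of_tendsto' (a := (0 : ℝ))
    (fun ρ _ => hasDerivAt_fresnelIntegrand_right s ρ) (by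
      simp only [e]
      exact (hint0.const_mul _).add (hint.const_mul _)) (tendsto_fresnelIntegrand s)
  simp only [e] at key
  rw [integral_add (hint0.const_mul _) (hint.const_mul _), integral_const_mul,
    integral_const_mul] at key
  have h0 : fresnelIntegrand s 0 = 1 := by simp [fresnelIntegrand]
  rw [h0] at key
  rw [fresnelTail]
  linear_combination key

lemma fresnelTail_zero : fresnelTail 0 = eighthRoot * (√Real.pi / 2 : ℝ) := by
  rw [fresnelTail]
  congr 1
  have h := integral_gaussian_Ioi 1
  rw [div_one] at h
  rw [← h, ← integral_complex_ofReal]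
  congr 1
  ext ρ
  simp [fresnelIntegrand]

lemma norm_fresnelTail_le {s : ℝ} (hs : 0 ≤ s) : ‖fresnelTail s‖ ≤ √Real.pi / 2 := by
  rw [fresnelTail, norm_mul, norm_eighthRoot, one_mul]
  have h := integral_gaussian_Ioi 1
  rw [div_one] at h
  rw [← h]
  refine norm_integral_le_of_norm_le (integrable_exp_neg_mul_sq one_pos).integrableOn ?_
  filter_upwards [ae_restrict_mem measurableSet_Ioi] with ρ hρ
  have hρ : 0 < ρ := hρ
  rw [norm_fresnelIntegrand]
  refine Real.exp_le_exp.2 ?_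
  have : 0 ≤ √2 * s * ρ := by positivity
  linarith

/-- Dominated convergence: for s ≥ 0 the integrand is below e^{-ρ²} in norm, and it decays pointwise
for ρ > 0. -/
lemma tendsto_fresnelTail : Tendsto fresnelTail atTop (𝓝 0) := by
  have h : Tendsto (fun s => ∫ ρ in Set.Ioi (0 : ℝ), fresnelIntegrand s ρ) atTop
      (𝓝 (∫ _ in Set.Ioi (0 : ℝ), (0 : ℂ))) := by
    refine tendsto_integral_filter_of_dominated_convergence
      (fun ρ => Real.exp (-1 * ρ ^ 2))
      (Eventually.of_forall fun s => (continuous_fresnelIntegrand s).aestronglyMeasurable)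
      ((eventually_ge_atTop 0).mono fun s hs => ?_)
      (integrable_exp_neg_mul_sq one_pos).integrableOn ?_
    · filter_upwards [ae_restrict_mem measurableSet_Ioi] with ρ hρ
      have hρ : 0 < ρ := hρ
      rw [norm_fresnelIntegrand]
      refine Real.exp_le_exp.2 ?_
      have : 0 ≤ √2 * s * ρ := by positivity
      linarith
    · filter_upwards [ae_restrict_mem measurableSet_Ioi] with ρ hρ
      have hρ : 0 < ρ := hρ
      rw [tendsto_zero_iff_norm_tendsto_zero]
      simp only [norm_fresnelIntegrand]
      refine Real.tendsto_exp_atBot.comp ?_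
      have h1 : Tendsto (fun s : ℝ => (√2 * ρ) * s) atTop atTop :=
        tendsto_id.const_mul_atTop (by positivity)
      have h2 := tendsto_atBot_add_const_left atTop (-ρ ^ 2) (tendsto_neg_atTop_atBot.comp h1)
      refine h2.congr fun s => ?_
      simp only [Function.comp]
      ring
  have h2 := h.const_mul eighthRoot
  rwa [integral_zero, mul_zero] at h2

/-- The Fresnel integral `∫₀ˢ e^{iτ²} dτ`. -/
def fresnel (s : ℝ) : ℂ := ∫ τ in (0 : ℝ)..s, Complex.exp (Complex.I * (τ : ℂ) ^ 2)

lemma hasDerivAt_fresnel (s : ℝ) :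
    HasDerivAt fresnel (Complex.exp (Complex.I * (s : ℂ) ^ 2)) s :=
  Continuous.deriv_integral (fun τ : ℝ => Complex.exp (Complex.I * (τ : ℂ) ^ 2)) (by fun_prop) 0 s ▸
    (intervalIntegral.integral_hasDerivAt_right
      (Continuous.intervalIntegrable (by fun_prop) _ _)
      (Continuous.stronglyMeasurableAtFilter (by fun_prop) _ _)
      (Continuous.continuousAt (by fun_prop))).differentiableAt.hasDerivAt

lemma continuous_fresnel : Continuous fresnel :=
  continuous_iff_continuousAt.2 fun s => (hasDerivAt_fresnel s).continuousAt

lemma fresnel_neg (s : ℝ) : fresnel (-s) = -fresnel s := by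
  have := intervalIntegral.integral_comp_neg (a := (0 : ℝ)) (b := s)
    (fun τ : ℝ => Complex.exp (Complex.I * (τ : ℂ) ^ 2))
  simp only [Complex.ofReal_neg, neg_sq, neg_zero] at this
  rw [fresnel, fresnel, this, intervalIntegral.integral_symm]

/-- The limit of the Fresnel integral. -/
def fresnelLimit : ℂ := eighthRoot * (√Real.pi / 2 : ℝ)

/-- The equation for `fresnelTail` makes e^{is²} `fresnelTail` an antiderivative of -e^{is²}, so the
sum with the Fresnel integral is constant. At s = 0 it is a Gaussian integral; no contour has to be
rotated. -/
lemma fresnel_eq (s : ℝ) :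
    fresnel s = fresnelLimit - Complex.exp (Complex.I * (s : ℂ) ^ 2) * fresnelTail s := by
  have hexp : ∀ s : ℝ, HasDerivAt (fun s : ℝ => Complex.exp (Complex.I * (s : ℂ) ^ 2))
      (Complex.exp (Complex.I * (s : ℂ) ^ 2) * (Complex.I * (2 * s))) s := by
    intro s
    have h : HasDerivAt (fun z : ℂ => Complex.I * z ^ 2) (Complex.I * (2 * s)) (s : ℂ) :=
      ((hasDerivAt_pow 2 (s : ℂ)).const_mul Complex.I).congr_deriv (by simp)
    exact h.cexp.comp_ofReal
  have hd : ∀ s : ℝ, HasDerivAt (fun s : ℝ => fresnel s +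
      Complex.exp (Complex.I * (s : ℂ) ^ 2) * fresnelTail s) 0 s := by
    intro s
    exact ((hasDerivAt_fresnel s).add ((hexp s).mul (hasDerivAt_fresnelTail s))).congr_deriv
      (by ring)
  have hconst := is_const_of_deriv_eq_zero (fun s => (hd s).differentiableAt)
    (fun s => (hd s).deriv) s 0
  have h0 : fresnel 0 = 0 := by simp [fresnel]
  simp only [h0, fresnelTail_zero, Complex.ofReal_zero] at hconst
  rw [fresnelLimit]
  simp only [ne_eq, OfNat.ofNat_ne_zero, not_false_eq_true, zero_pow, mul_zero, Complex.exp_zero,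
    one_mul, zero_add] at hconst
  linear_combination hconst

lemma norm_exp_I_mul_sq (s : ℝ) : ‖Complex.exp (Complex.I * (s : ℂ) ^ 2)‖ = 1 := by
  rw [← Complex.ofReal_pow, mul_comm, Complex.norm_exp_ofReal_mul_I]

lemma norm_fresnel_le (s : ℝ) : ‖fresnel s‖ ≤ √Real.pi := by
  have key : ∀ s : ℝ, 0 ≤ s → ‖fresnel s‖ ≤ √Real.pi := by
    intro s hs
    rw [fresnel_eq]
    refine (norm_sub_le _ _).trans ?_
    rw [norm_mul, norm_exp_I_mul_sq, one_mul, fresnelLimit, norm_mul, norm_eighthRoot, one_mul,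
      Complex.norm_real, Real.norm_of_nonneg (by positivity)]
    linarith [norm_fresnelTail_le hs]
  rcases le_total 0 s with hs | hs
  · exact key s hs
  · have := key (-s) (by linarith)
    rwa [fresnel_neg, norm_neg] at this

lemma tendsto_fresnel_atTop : Tendsto fresnel atTop (𝓝 fresnelLimit) := by
  have h : Tendsto (fun s : ℝ => Complex.exp (Complex.I * (s : ℂ) ^ 2) * fresnelTail s) atTop
      (𝓝 0) := by
    rw [tendsto_zero_iff_norm_tendsto_zero]
    simp only [norm_mul, norm_exp_I_mul_sq, one_mul]
    simpa using tendsto_fresnelTail.norm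
  simpa [funext fresnel_eq] using tendsto_const_nhds.sub h

lemma tendsto_fresnel_atBot : Tendsto fresnel atBot (𝓝 (-fresnelLimit)) := by
  have h := (tendsto_fresnel_atTop.comp tendsto_neg_atBot_atTop).neg
  refine h.congr fun s => ?_
  simp [fresnel_neg]

/-! ### Concentration of the free kernel -/

lemma tendsto_fresnel_div {a : ℝ} (ha : a ≠ 0) :
    Tendsto (fun ε : ℝ => fresnel (a / ε)) (𝓝[>] 0) (𝓝 (SignType.sign a * fresnelLimit)) := by
  simp only [div_eq_mul_inv]
  rcases ha.lt_or_gt with h | h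
  · rw [sign_neg h]
    have h1 : Tendsto (fun ε : ℝ => a * ε⁻¹) (𝓝[>] 0) atBot :=
      tendsto_inv_nhdsGT_zero.const_mul_atTop_of_neg h
    simpa [Function.comp_def] using tendsto_fresnel_atBot.comp h1
  · rw [sign_pos h]
    have h1 : Tendsto (fun ε : ℝ => a * ε⁻¹) (𝓝[>] 0) atTop :=
      tendsto_inv_nhdsGT_zero.const_mul_atTop h
    simpa [Function.comp_def] using tendsto_fresnel_atTop.comp h1

/-- Integration by parts replaces the oscillating kernel by Fresnel integrals, which are bounded and
converge to a sign function for y ≠ c; dominated convergence then applies. The sign of c is left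
open to cover both centres x and -x. -/
lemma tendsto_integral_fresnelKernel_aux {b c : ℝ} (hb : 0 < b) (hc0 : c ≠ 0) (hcb : c < b)
    {φ φ' : ℝ → ℂ} (hφ : ContinuousOn φ (Set.Icc 0 b)) (hφ' : ContinuousOn φ' (Set.Icc 0 b))
    (hd : ∀ y ∈ Set.Ioo 0 b, HasDerivAt φ (φ' y) y) :
    Tendsto (fun ε : ℝ => ∫ y in (0 : ℝ)..b,
        φ y * (ε⁻¹ * Complex.exp (Complex.I * (((y - c) / ε : ℝ) : ℂ) ^ 2))) (𝓝[>] 0)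
      (𝓝 (φ b * fresnelLimit - φ 0 * (SignType.sign (0 - c) * fresnelLimit)
        - ∫ y in (0 : ℝ)..b, φ' y * (SignType.sign (y - c) * fresnelLimit))) := by
  have hII : IntervalIntegrable φ' volume 0 b :=
    ContinuousOn.intervalIntegrable (by rwa [Set.uIcc_of_le hb.le])
  have hparts : ∀ ε : ℝ, 0 < ε → ∫ y in (0 : ℝ)..b,
        φ y * (ε⁻¹ * Complex.exp (Complex.I * (((y - c) / ε : ℝ) : ℂ) ^ 2))
      = φ b * fresnel ((b - c) / ε) - φ 0 * fresnel ((0 - c) / ε)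
        - ∫ y in (0 : ℝ)..b, φ' y * fresnel ((y - c) / ε) := by
    intro ε hε
    have hv : ∀ y : ℝ, HasDerivAt (fun y : ℝ => fresnel ((y - c) / ε))
        (ε⁻¹ * Complex.exp (Complex.I * (((y - c) / ε : ℝ) : ℂ) ^ 2)) y := by
      intro y
      have h1 : HasDerivAt (fun y : ℝ => (y - c) / ε) ε⁻¹ y :=
        (((hasDerivAt_id y).sub_const c).div_const ε).congr_deriv (by simp)
      refine ((hasDerivAt_fresnel ((y - c) / ε)).scomp y h1).congr_deriv ?_
      rw [Complex.real_smul, Complex.ofReal_inv]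
    refine intervalIntegral.integral_mul_deriv_eq_deriv_mul_of_hasDeriv_right
      (by rwa [Set.uIcc_of_le hb.le])
      (fun y _ => (hv y).continuousAt.continuousWithinAt)
      (fun y hy => ?_) (fun y _ => (hv y).hasDerivWithinAt) hII
      (Continuous.intervalIntegrable (by fun_prop) _ _)
    rw [min_eq_left hb.le, max_eq_right hb.le] at hy
    exact (hd y hy).hasDerivWithinAt
  refine Tendsto.congr' (eventually_nhdsWithin_of_forall fun ε hε => (hparts ε hε).symm) ?_
  refine Tendsto.sub (Tendsto.sub ?_ ?_) ?_
  · have := (tendsto_fresnel_div (a := b - c) (by linarith)).const_mul (φ b)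
    rwa [sign_pos (sub_pos.2 hcb), SignType.coe_one, one_mul] at this
  · exact (tendsto_fresnel_div (a := 0 - c) (by simpa using hc0)).const_mul (φ 0)
  · refine intervalIntegral.tendsto_integral_filter_of_dominated_convergence
      (fun y => ‖φ' y‖ * √Real.pi) (Eventually.of_forall fun ε => ?_)
      (Eventually.of_forall fun ε => Eventually.of_forall fun y _ => ?_)
      (hII.norm.mul_const _) ?_
    · refine AEStronglyMeasurable.mul ?_ ?_
      · exact hII.def'.aestronglyMeasurable
      · exact (continuous_fresnel.comp (by fun_prop)).aestronglyMeasurable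
    · rw [norm_mul]
      exact mul_le_mul_of_nonneg_left (norm_fresnel_le _) (norm_nonneg _)
    · have : ∀ᵐ y : ℝ, y ≠ c := by simp [ae_iff, measure_singleton]
      filter_upwards [this] with y hy _
      exact (tendsto_fresnel_div (sub_ne_zero.2 hy)).const_mul _

/-- The free kernel centred at an interior point reproduces `φ` in the limit. -/
lemma tendsto_integral_fresnelKernel_of_mem {b c : ℝ} (hc0 : 0 < c) (hcb : c < b)
    {φ φ' : ℝ → ℂ} (hφ : ContinuousOn φ (Set.Icc 0 b)) (hφ' : ContinuousOn φ' (Set.Icc 0 b))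
    (hd : ∀ y ∈ Set.Ioo 0 b, HasDerivAt φ (φ' y) y) :
    Tendsto (fun ε : ℝ => ∫ y in (0 : ℝ)..b,
        φ y * (ε⁻¹ * Complex.exp (Complex.I * (((y - c) / ε : ℝ) : ℂ) ^ 2))) (𝓝[>] 0)
      (𝓝 (2 * fresnelLimit * φ c)) := by
  have hb : 0 < b := hc0.trans hcb
  have h := tendsto_integral_fresnelKernel_aux hb hc0.ne' hcb hφ hφ' hd
  have hII : ∀ u ∈ Set.Icc 0 b, ∀ v ∈ Set.Icc 0 b, IntervalIntegrable φ' volume u v :=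
    fun u hu v hv => (hφ'.mono (Set.uIcc_subset_Icc hu hv)).intervalIntegrable
  have m0 : (0 : ℝ) ∈ Set.Icc 0 b := ⟨le_rfl, hb.le⟩
  have mc : c ∈ Set.Icc 0 b := ⟨hc0.le, hcb.le⟩
  have mb : b ∈ Set.Icc 0 b := ⟨hb.le, le_rfl⟩
  have hFTC : ∀ u ∈ Set.Icc 0 b, ∀ v ∈ Set.Icc 0 b, u ≤ v →
      ∫ y in u..v, φ' y = φ v - φ u := fun u hu v hv huv =>
    intervalIntegral.integral_eq_sub_of_hasDerivAt_of_le huv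
      (hφ.mono (Set.Icc_subset_Icc hu.1 hv.2))
      (fun y hy => hd y ⟨hu.1.trans_lt hy.1, hy.2.trans_le hv.2⟩) (hII u hu v hv)
  -- Splitting at the jump y = c, the boundary values φ(0) and φ(b) cancel and 2φ(c) times the
  -- Fresnel limit remains.
  have e1 : ∫ y in (0 : ℝ)..c, φ' y * (SignType.sign (y - c) * fresnelLimit)
      = (φ c - φ 0) * -fresnelLimit := by
    rw [← hFTC 0 m0 c mc hc0.le, ← intervalIntegral.integral_mul_const]
    refine intervalIntegral.integral_congr_ae ?_
    have : ∀ᵐ y : ℝ, y ≠ c := by simp [ae_iff, measure_singleton]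
    filter_upwards [this] with y hy hy2
    rw [Set.uIoc_of_le hc0.le] at hy2
    rw [sign_neg (sub_neg.2 (lt_of_le_of_ne hy2.2 hy))]
    simp
  have e2 : ∫ y in c..b, φ' y * (SignType.sign (y - c) * fresnelLimit)
      = (φ b - φ c) * fresnelLimit := by
    rw [← hFTC c mc b mb hcb.le, ← intervalIntegral.integral_mul_const]
    refine intervalIntegral.integral_congr_ae (Eventually.of_forall fun y hy => ?_)
    rw [Set.uIoc_of_le hcb.le] at hy
    rw [sign_pos (sub_pos.2 hy.1)]
    simp
  have i1 : IntervalIntegrable (fun y => φ' y * (SignType.sign (y - c) * fresnelLimit))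
      volume 0 c := by
    refine ((hII 0 m0 c mc).mul_const (-fresnelLimit)).congr_ae ?_
    rw [Filter.EventuallyEq, ae_restrict_iff' measurableSet_uIoc]
    have : ∀ᵐ y : ℝ, y ≠ c := by simp [ae_iff, measure_singleton]
    filter_upwards [this] with y hy hy2
    rw [Set.uIoc_of_le hc0.le] at hy2
    rw [sign_neg (sub_neg.2 (lt_of_le_of_ne hy2.2 hy))]
    simp
  have i2 : IntervalIntegrable (fun y => φ' y * (SignType.sign (y - c) * fresnelLimit))
      volume c b := by
    refine ((hII c mc b mb).mul_const fresnelLimit).congr fun y hy => ?_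
    rw [Set.uIoc_of_le hcb.le] at hy
    simp only [sign_pos (sub_pos.2 hy.1)]
    simp
  rw [← intervalIntegral.integral_add_adjacent_intervals i1 i2, e1, e2,
    sign_neg (by linarith : 0 - c < 0), SignType.coe_neg, SignType.coe_one] at h
  convert h using 2
  ring

/-- The free kernel centred outside the interval vanishes in the limit. -/
lemma tendsto_integral_fresnelKernel_of_neg {b c : ℝ} (hb : 0 < b) (hc0 : c < 0)
    {φ φ' : ℝ → ℂ} (hφ : ContinuousOn φ (Set.Icc 0 b)) (hφ' : ContinuousOn φ' (Set.Icc 0 b))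
    (hd : ∀ y ∈ Set.Ioo 0 b, HasDerivAt φ (φ' y) y) :
    Tendsto (fun ε : ℝ => ∫ y in (0 : ℝ)..b,
        φ y * (ε⁻¹ * Complex.exp (Complex.I * (((y - c) / ε : ℝ) : ℂ) ^ 2))) (𝓝[>] 0)
      (𝓝 0) := by
  have h := tendsto_integral_fresnelKernel_aux hb hc0.ne (hc0.trans hb) hφ hφ' hd
  have e : ∫ y in (0 : ℝ)..b, φ' y * (SignType.sign (y - c) * fresnelLimit)
      = (φ b - φ 0) * fresnelLimit := by
    have hFTC : ∫ y in (0 : ℝ)..b, φ' y = φ b - φ 0 :=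
      intervalIntegral.integral_eq_sub_of_hasDerivAt_of_le hb.le hφ hd
        (ContinuousOn.intervalIntegrable (by rwa [Set.uIcc_of_le hb.le]))
    rw [← hFTC, ← intervalIntegral.integral_mul_const]
    refine intervalIntegral.integral_congr fun y hy => ?_
    rw [Set.uIcc_of_le hb.le] at hy
    simp only [sign_pos (sub_pos.2 (hc0.trans_le hy.1))]
    simp
  rw [e, sign_pos (by linarith : 0 < 0 - c), SignType.coe_one] at h
  convert h using 2
  ring

/-! ### Time interval, sector and absolute continuity -/

lemma timeInterval_pos {T : EReal} {t : ℝ} (ht : t ∈ timeInterval T) : 0 < t := ht.1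

lemma ordConnected_timeInterval (T : EReal) : (timeInterval T).OrdConnected :=
  ⟨fun _ hs _ ht _ hu => ⟨hs.1.trans_le hu.1, (EReal.coe_le_coe_iff.2 hu.2).trans_lt ht.2⟩⟩

lemma acOn_of_hasDerivAt {E : Type*} [NormedAddCommGroup E] [NormedSpace ℝ E] [CompleteSpace E]
    {f f' : ℝ → E} {I : Set ℝ} (hI : I.OrdConnected) (hf : ∀ x ∈ I, HasDerivAt f (f' x) x)
    (hf' : ContinuousOn f' I) : ACOn f I := by
  refine ⟨f', hf'.locallyIntegrableOn hI.measurableSet, fun x hx y hy => ?_⟩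
  have hsub : Set.uIcc x y ⊆ I := hI.uIcc_subset hx hy
  exact (intervalIntegral.integral_eq_sub_of_hasDerivAt (fun s hs => hf s (hsub hs))
    (hf'.mono hsub).intervalIntegrable).symm

lemma acOn_congr {E : Type*} [NormedAddCommGroup E] [NormedSpace ℝ E] {f g : ℝ → E} {I : Set ℝ}
    (h : ACOn f I) (hfg : ∀ x ∈ I, g x = f x) : ACOn g I := by
  obtain ⟨k, hk, hf⟩ := h
  exact ⟨k, hk, fun x hx y hy => by rw [hfg x hx, hfg y hy, hf x hx y hy]⟩

lemma acOn_zero (I : Set ℝ) : ACOn (fun _ => (0 : ℂ)) I :=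
  ⟨fun _ => 0, (locallyIntegrable_const 0).locallyIntegrableOn I, fun x _ y _ => by simp⟩

/-- The restriction to the real line of a holomorphic function is absolutely continuous. -/
lemma acOn_of_differentiableOn {F : ℂ → ℂ} {U : Set ℂ} {I : Set ℝ} (hU : IsOpen U)
    (hF : DifferentiableOn ℂ F U) (hI : I.OrdConnected) (hIU : ∀ x ∈ I, (x : ℂ) ∈ U) :
    ACOn (fun x : ℝ => F x) I := by
  refine acOn_of_hasDerivAt hI (f' := fun x : ℝ => deriv F x)
    (fun x hx => ((hF.differentiableAt (hU.mem_nhds (hIU x hx))).hasDerivAt).comp_ofReal) ?_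
  exact (hF.deriv hU).continuousOn.comp Complex.continuous_ofReal.continuousOn hIU

/-- Each half of the double sector stays off the imaginary axis, which lets the sign of Re z take
over the role of the sign of y. -/
lemma doubleSector_cases {z : ℂ} (hz : z ∈ doubleSector (Real.pi / 4)) :
    (0 < z.re ∧ 0 ≤ z.im) ∨ (z.re < 0 ∧ z.im ≤ 0) := by
  have key : ∀ u : ℂ, u ≠ 0 → Complex.arg u ∈ Set.Icc 0 (Real.pi / 4) →
      0 < u.re ∧ 0 ≤ u.im := by
    intro u hu h
    refine ⟨?_, Complex.arg_nonneg_iff.1 h.1⟩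
    have hlt : |Complex.arg u| < Real.pi / 2 := by
      rw [abs_of_nonneg h.1]; linarith [h.2, Real.pi_pos]
    exact (Complex.abs_arg_lt_pi_div_two_iff.1 hlt).resolve_right hu
  obtain ⟨h0, h | h⟩ := hz
  · exact Or.inl (key z h0 h)
  · have := key (-z) (neg_ne_zero.2 h0) h
    simp only [Complex.neg_re, Complex.neg_im] at this
    exact Or.inr ⟨by linarith [this.1], by linarith [this.2]⟩

lemma re_ne_zero_of_mem_doubleSector {z : ℂ} (hz : z ∈ doubleSector (Real.pi / 4)) :
    z.re ≠ 0 := by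
  rcases doubleSector_cases hz with h | h
  · exact h.1.ne'
  · exact h.1.ne

/-! ### Gated functions -/

/-- The value `v` if `b > 0`, and zero otherwise. -/
def gate (b : ℝ) (v : ℂ) : ℂ := if 0 < b then v else 0

lemma gate_of_pos {b : ℝ} (hb : 0 < b) (v : ℂ) : gate b v = v := if_pos hb

lemma gate_of_nonpos {b : ℝ} (hb : b ≤ 0) (v : ℂ) : gate b v = 0 := if_neg hb.not_gt

lemma norm_gate_le {b R : ℝ} {v : ℂ} (hR : 0 ≤ R) (h : 0 < b → ‖v‖ ≤ R) : ‖gate b v‖ ≤ R := by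
  rcases lt_or_ge 0 b with hb | hb
  · rw [gate_of_pos hb]; exact h hb
  · rw [gate_of_nonpos hb, norm_zero]; exact hR

lemma hasDerivAt_gate_const {F : ℝ → ℂ} {b s : ℝ} {d : ℂ} (h : 0 < b → HasDerivAt F d s) :
    HasDerivAt (fun s => gate b (F s)) (gate b d) s := by
  rcases lt_or_ge 0 b with hb | hb
  · simpa only [gate_of_pos hb] using h hb
  · simpa only [gate_of_nonpos hb] using hasDerivAt_const s (0 : ℂ)

/-- Away from xc = 0 the gate is locally constantly open or closed, so F need be differentiable only
where it is open. -/
lemma hasDerivAt_gate_mul {F : ℝ → ℂ} {c x : ℝ} {d : ℂ} (hx : x * c ≠ 0)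
    (h : 0 < x * c → HasDerivAt F d x) :
    HasDerivAt (fun x => gate (x * c) (F x)) (gate (x * c) d) x := by
  have hcont : Continuous fun x : ℝ => x * c := by fun_prop
  rcases hx.lt_or_gt with hb | hb
  · rw [gate_of_nonpos hb.le]
    refine (hasDerivAt_const x (0 : ℂ)).congr_of_eventuallyEq ?_
    filter_upwards [hcont.continuousAt.eventually_lt continuousAt_const hb] with u hu
    exact gate_of_nonpos hu.le _
  · rw [gate_of_pos hb]
    refine (h hb).congr_of_eventuallyEq ?_
    filter_upwards [continuousAt_const.eventually_lt hcont.continuousAt hb] with u hu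
    exact gate_of_pos hu _

lemma deriv_gate_mul {F F₁ : ℝ → ℂ} {c x : ℝ} (hc : c ≠ 0) (hx : x ≠ 0)
    (h : ∀ x, 0 < x * c → HasDerivAt F (F₁ x) x) :
    deriv (fun x => gate (x * c) (F x)) x = gate (x * c) (F₁ x) :=
  (hasDerivAt_gate_mul (mul_ne_zero hx hc) (h x)).deriv

lemma hasDerivAt_deriv_gate_mul {F F₁ : ℝ → ℂ} {c x : ℝ} {d : ℂ} (hc : c ≠ 0) (hx : x ≠ 0)
    (h : ∀ x, 0 < x * c → HasDerivAt F (F₁ x) x) (h₁ : 0 < x * c → HasDerivAt F₁ d x) :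
    HasDerivAt (deriv fun x => gate (x * c) (F x)) (gate (x * c) d) x := by
  refine (hasDerivAt_gate_mul (mul_ne_zero hx hc) h₁).congr_of_eventuallyEq ?_
  filter_upwards [isOpen_ne.mem_nhds hx] with u hu
  exact deriv_gate_mul hc hu h

/-! ### The kernel with complex arguments -/

/-- The amplitude `t^{-1/2}`. -/
def amplitude (t : ℂ) : ℂ := t ^ (-(1 / 2) : ℂ)

lemma hasDerivAt_amplitude {t : ℂ} (ht : t ∈ Complex.slitPlane) :
    HasDerivAt amplitude (amplitude t * (-1 / (2 * t))) t :=
  (hasDerivAt_cpow_div ht).congr_deriv (by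
    have := Complex.slitPlane_ne_zero ht
    rw [amplitude]; field_simp)

lemma amplitude_ofReal {t : ℝ} (ht : 0 < t) : amplitude t = (((√t)⁻¹ : ℝ) : ℂ) := by
  rw [amplitude, show (-(1 / 2) : ℂ) = ((-(1 / 2) : ℝ) : ℂ) by push_cast; ring,
    ← Complex.ofReal_cpow ht.le, Real.rpow_neg ht.le, ← Real.sqrt_eq_rpow]

lemma norm_amplitude {t : ℝ} (ht : 0 < t) : ‖amplitude t‖ = (√t)⁻¹ := by
  rw [amplitude_ofReal ht, Complex.norm_real, Real.norm_of_nonneg (by positivity)]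

/-- The phase `e^{i(x² + z²)/(4t)}`. -/
def phase (t x z : ℂ) : ℂ := Complex.exp (Complex.I * (x ^ 2 + z ^ 2) / (4 * t))

lemma hasDerivAt_phase_x (t x z : ℂ) :
    HasDerivAt (fun x => phase t x z) (phase t x z * (Complex.I * x / (2 * t))) x := by
  have h : HasDerivAt (fun x : ℂ => Complex.I * (x ^ 2 + z ^ 2) / (4 * t))
      (Complex.I * x / (2 * t)) x :=
    ((((hasDerivAt_pow 2 x).add_const (z ^ 2)).const_mul Complex.I).div_const (4 * t)).congr_deriv
      (by push_cast; rw [pow_one, show 4 * t = 2 * (2 * t) by ring,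
            show Complex.I * (2 * x) = 2 * (Complex.I * x) by ring,
            mul_div_mul_left _ _ two_ne_zero])
  exact h.cexp

lemma hasDerivAt_phase_z (t x z : ℂ) :
    HasDerivAt (phase t x) (phase t x z * (Complex.I * z / (2 * t))) z := by
  have h := hasDerivAt_phase_x t z x
  have e : (fun u => phase t u x) = phase t x := by
    funext u; simp only [phase]; rw [add_comm]
  rw [e] at h
  exact h.congr_deriv (by simp only [phase]; rw [add_comm])

lemma hasDerivAt_phase_t {t : ℂ} (ht : t ≠ 0) (x z : ℂ) :
    HasDerivAt (fun t => phase t x z)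
      (phase t x z * (-Complex.I * (x ^ 2 + z ^ 2) / (4 * t ^ 2))) t := by
  have h : HasDerivAt (fun t : ℂ => Complex.I * (x ^ 2 + z ^ 2) / (4 * t))
      (-Complex.I * (x ^ 2 + z ^ 2) / (4 * t ^ 2)) t := by
    have := (hasDerivAt_inv ht).const_mul (Complex.I * (x ^ 2 + z ^ 2) / 4)
    refine (this.congr_deriv (by field_simp)).congr_of_eventuallyEq
      (Eventually.of_forall fun u => ?_)
    simp only [div_eq_mul_inv, mul_inv]
    ring
  exact h.cexp

/-- The argument `xz/(2t)` of the Bessel function. -/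
def besselArg (t x z : ℂ) : ℂ := x * z / (2 * t)

lemma hasDerivAt_besselArg_x (t x z : ℂ) :
    HasDerivAt (fun x => besselArg t x z) (z / (2 * t)) x :=
  (((hasDerivAt_id x).mul_const z).div_const (2 * t)).congr_deriv (by simp)

lemma hasDerivAt_besselArg_z (t x z : ℂ) :
    HasDerivAt (besselArg t x) (x / (2 * t)) z :=
  (((hasDerivAt_id z).const_mul x).div_const (2 * t)).congr_deriv (by simp)

lemma hasDerivAt_besselArg_t {t : ℂ} (ht : t ≠ 0) (x z : ℂ) :
    HasDerivAt (fun t => besselArg t x z) (-(x * z) / (2 * t ^ 2)) t := by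
  have := (hasDerivAt_inv ht).const_mul (x * z / 2)
  refine (this.congr_deriv (by field_simp)).congr_of_eventuallyEq
    (Eventually.of_forall fun u => ?_)
  simp only [besselArg, div_eq_mul_inv, mul_inv]
  ring

/-- The kernel for `xz` in the right half plane, up to a constant factor. -/
def kernelCore (ν : ℝ) (t x z : ℂ) : ℂ :=
  amplitude t * phase t x z * sqrtBessel ν (besselArg t x z)

/-- The first `x`-derivative of `kernelCore`. -/
def kernelCoreX (ν : ℝ) (t x z : ℂ) : ℂ :=
  amplitude t * phase t x z * (Complex.I * x / (2 * t) * sqrtBessel ν (besselArg t x z)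
    + z / (2 * t) * sqrtBesselDeriv ν (besselArg t x z))

/-- The second `x`-derivative of `kernelCore`. -/
def kernelCoreXX (ν : ℝ) (t x z : ℂ) : ℂ :=
  amplitude t * phase t x z *
    ((Complex.I / (2 * t) + (Complex.I * x / (2 * t)) ^ 2 + (z / (2 * t)) ^ 2 *
        (((ν ^ 2 - 1 / 4 : ℝ) : ℂ) / besselArg t x z ^ 2 - 1)) * sqrtBessel ν (besselArg t x z)
      + 2 * (Complex.I * x / (2 * t)) * (z / (2 * t)) * sqrtBesselDeriv ν (besselArg t x z))

/-- The `t`-derivative of `kernelCore`. -/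
def kernelCoreT (ν : ℝ) (t x z : ℂ) : ℂ :=
  amplitude t * phase t x z *
    ((-1 / (2 * t) - Complex.I * (x ^ 2 + z ^ 2) / (4 * t ^ 2)) * sqrtBessel ν (besselArg t x z)
      - x * z / (2 * t ^ 2) * sqrtBesselDeriv ν (besselArg t x z))

section Derivatives

variable {ν : ℝ} {t x z : ℂ}

lemma hasDerivAt_kernelCore_x (hν : 1 / 2 < ν) (hw : besselArg t x z ∈ Complex.slitPlane) :
    HasDerivAt (fun x => kernelCore ν t x z) (kernelCoreX ν t x z) x := by
  have h := ((hasDerivAt_phase_x t x z).const_mul (amplitude t)).mul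
    (HasDerivAt.comp x (hasDerivAt_sqrtBessel hν hw) (hasDerivAt_besselArg_x t x z))
  exact h.congr_deriv (by simp only [kernelCoreX, Function.comp]; ring)

lemma differentiableAt_kernelCore_z (hν : 1 / 2 < ν) (hw : besselArg t x z ∈ Complex.slitPlane) :
    DifferentiableAt ℂ (kernelCore ν t x) z :=
  (((hasDerivAt_phase_z t x z).const_mul (amplitude t)).mul
    (HasDerivAt.comp z (hasDerivAt_sqrtBessel hν hw)
      (hasDerivAt_besselArg_z t x z))).differentiableAt

lemma hasDerivAt_kernelCoreX_x (hν : 1 / 2 < ν) (hw : besselArg t x z ∈ Complex.slitPlane) :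
    HasDerivAt (fun x => kernelCoreX ν t x z) (kernelCoreXX ν t x z) x := by
  have hl : HasDerivAt (fun x : ℂ => Complex.I * x / (2 * t)) (Complex.I / (2 * t)) x :=
    (((hasDerivAt_id x).const_mul Complex.I).div_const (2 * t)).congr_deriv (by simp)
  have hK := HasDerivAt.comp x (hasDerivAt_sqrtBessel hν hw) (hasDerivAt_besselArg_x t x z)
  have hK' := HasDerivAt.comp x (hasDerivAt_sqrtBesselDeriv hν hw) (hasDerivAt_besselArg_x t x z)
  have h := ((hasDerivAt_phase_x t x z).const_mul (amplitude t)).mul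
    ((hl.mul hK).add (hK'.const_mul (z / (2 * t))))
  exact h.congr_deriv (by
    simp only [kernelCoreXX, Function.comp, Pi.add_apply, Pi.mul_apply]; ring)

lemma hasDerivAt_kernelCore_t (hν : 1 / 2 < ν) (hw : besselArg t x z ∈ Complex.slitPlane)
    (ht : t ∈ Complex.slitPlane) :
    HasDerivAt (fun t => kernelCore ν t x z) (kernelCoreT ν t x z) t := by
  have ht0 := Complex.slitPlane_ne_zero ht
  have h := ((hasDerivAt_amplitude ht).mul (hasDerivAt_phase_t ht0 x z)).mul
    (HasDerivAt.comp t (hasDerivAt_sqrtBessel hν hw) (hasDerivAt_besselArg_t ht0 x z))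
  exact h.congr_deriv (by
    simp only [kernelCoreT, Function.comp, Pi.mul_apply]; ring)

end Derivatives

/-- With w = xz/(2t), the factor (z/(2t))² turns λ/w² into λ/x². After that the coefficients of √w
J_ν and of its derivative agree separately. -/
lemma kernelCore_schrodinger {ν : ℝ} {t x z : ℂ} (ht : t ≠ 0) (hx : x ≠ 0) (hz : z ≠ 0) :
    Complex.I * kernelCoreT ν t x z = -kernelCoreXX ν t x z
      + ((ν ^ 2 - 1 / 4 : ℝ) : ℂ) / x ^ 2 * kernelCore ν t x z := by
  have e : (z / (2 * t)) ^ 2 * (((ν ^ 2 - 1 / 4 : ℝ) : ℂ) / besselArg t x z ^ 2 - 1)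
      = ((ν ^ 2 - 1 / 4 : ℝ) : ℂ) / x ^ 2 - z ^ 2 / (4 * t ^ 2) := by
    rw [besselArg]
    generalize ((ν ^ 2 - 1 / 4 : ℝ) : ℂ) = l
    field_simp
    ring
  simp only [kernelCoreT, kernelCoreXX, kernelCore]
  rw [e]
  generalize ((ν ^ 2 - 1 / 4 : ℝ) : ℂ) / x ^ 2 = l
  generalize sqrtBessel ν (besselArg t x z) = k
  generalize sqrtBesselDeriv ν (besselArg t x z) = k'
  generalize amplitude t * phase t x z = p
  field_simp
  linear_combination (-4 * p * k * z ^ 2) * Complex.I_sq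

/-! ### The continuation of the kernel -/

/-- The constant factor `1 / (√2 i^{ν+1})`. -/
def kernelConst (ν : ℝ) : ℂ := (((√2 : ℝ) : ℂ) * Complex.I ^ ((ν : ℂ) + 1))⁻¹

/-- The continuation of the Bessel kernel in the last variable. -/
def kernelCont (ν t x : ℝ) (z : ℂ) : ℂ := gate (x * z.re) (kernelConst ν * kernelCore ν t x z)

lemma besselArg_ofReal (t x y : ℝ) : besselArg t x y = ((x * y / (2 * t) : ℝ) : ℂ) := by
  rw [besselArg]; push_cast; rfl

lemma besselArg_re (t x : ℝ) (z : ℂ) : (besselArg t x z).re = x * z.re / (2 * t) := by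
  have : besselArg t x z = ((x / (2 * t) : ℝ) : ℂ) * z := by
    rw [besselArg]; push_cast; ring
  rw [this, Complex.re_ofReal_mul]; ring

lemma besselArg_im (t x : ℝ) (z : ℂ) : (besselArg t x z).im = x * z.im / (2 * t) := by
  have : besselArg t x z = ((x / (2 * t) : ℝ) : ℂ) * z := by
    rw [besselArg]; push_cast; ring
  rw [this, Complex.im_ofReal_mul]; ring

lemma besselArg_mem_slitPlane {t x : ℝ} {z : ℂ} (ht : 0 < t) (h : 0 < x * z.re) :
    besselArg t x z ∈ Complex.slitPlane :=
  Or.inl (by rw [besselArg_re]; positivity)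

lemma besselArg_mem_quadrant {t x : ℝ} {z : ℂ} (ht : 0 < t) (h : 0 < x * z.re)
    (hz : z ∈ doubleSector (Real.pi / 4)) : besselArg t x z ∈ quadrant := by
  refine ⟨by rw [besselArg_re]; positivity, ?_,
    Complex.slitPlane_ne_zero (besselArg_mem_slitPlane ht h)⟩
  rw [besselArg_im]
  have : 0 ≤ x * z.im := by
    rcases doubleSector_cases hz with h1 | h1
    · exact mul_nonneg (pos_of_mul_pos_left h h1.1.le).le h1.2
    · refine mul_nonneg_of_nonpos_of_nonpos ?_ h1.2
      by_contra hx
      nlinarith [h1.1]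
  positivity

lemma ofReal_mem_slitPlane {t : ℝ} (ht : 0 < t) : (t : ℂ) ∈ Complex.slitPlane :=
  Or.inl (by simpa using ht)

lemma sqrtBessel_ofReal {ν : ℝ} (hν : 1 / 2 < ν) {r : ℝ} (hr : 0 < r) :
    sqrtBessel ν r = (√r : ℝ) * besselJ ν r := by
  have h1 : (2 : ℂ) ^ (-ν : ℂ) = (((2 : ℝ) ^ (-ν) : ℝ) : ℂ) := by
    rw [Complex.ofReal_cpow two_pos.le]; push_cast; rfl
  have h2 : ((r : ℂ) / 2) ^ (ν : ℂ) = (((r / 2) ^ ν : ℝ) : ℂ) := by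
    rw [Complex.ofReal_cpow (by positivity)]; push_cast; rfl
  rw [sqrtBessel, besselJ_eq, ← besselEntireDeriv_zero hν, h1, h2, ← Complex.ofReal_cpow hr.le,
    ← mul_assoc, ← Complex.ofReal_mul, ← Complex.ofReal_mul]
  congr 2
  rw [Real.rpow_add hr, ← Real.sqrt_eq_rpow, Real.div_rpow hr.le two_pos.le,
    Real.rpow_neg two_pos.le]
  ring

/-- The prefactor is redistributed as √(xy)/(2t) = 2^{-1/2} t^{-1/2} √(xy/(2t)), which supplies the
square root in √w J_ν(w). -/
lemma besselKernel_eq_kernelCont {ν : ℝ} (hν : 1 / 2 < ν) {t : ℝ} (ht : 0 < t) (x y : ℝ) :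
    besselKernel ν t x y = kernelCont ν t x y := by
  rw [kernelCont, Complex.ofReal_re]
  rcases lt_or_ge 0 (x * y) with h | h
  · rw [gate_of_pos h, besselKernel, heaviside, if_pos h, kernelCore, besselArg_ofReal,
      sqrtBessel_ofReal hν (by positivity), amplitude_ofReal ht, kernelConst, phase]
    have ht' : (t : ℂ) ≠ 0 := by exact_mod_cast ht.ne'
    have e1 : -((x : ℂ) ^ 2 + (y : ℂ) ^ 2) / (4 * Complex.I * t)
        = Complex.I * ((x : ℂ) ^ 2 + (y : ℂ) ^ 2) / (4 * t) := by
      rw [div_eq_div_iff (mul_ne_zero (mul_ne_zero (by norm_num) Complex.I_ne_zero) ht')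
        (mul_ne_zero (by norm_num) ht')]
      linear_combination (-(4 * (t : ℂ) * ((x : ℂ) ^ 2 + (y : ℂ) ^ 2))) * Complex.I_sq
    have e2 : √(x * y / (2 * t)) = √(x * y) / (√2 * √t) := by
      rw [Real.sqrt_div h.le, Real.sqrt_mul two_pos.le]
    have e3 : (1 * √(x * y) : ℝ) / (2 * t) = (√2)⁻¹ * (√t)⁻¹ * √(x * y / (2 * t)) := by
      rw [e2]
      have h2 : √2 * √2 = 2 := Real.mul_self_sqrt two_pos.le
      have h3 : √t * √t = t := Real.mul_self_sqrt ht.le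
      nth_rewrite 1 [← h2]
      nth_rewrite 1 [← h3]
      have : 0 < √t := Real.sqrt_pos.2 ht
      field_simp
    have e4 := congrArg (fun r : ℝ => (r : ℂ)) e3
    push_cast at e4 ⊢
    rw [e1]
    calc _ = ((1 * (√(x * y) : ℂ)) / (2 * t)) * (Complex.I ^ ((ν : ℂ) + 1))⁻¹ *
          Complex.exp (Complex.I * ((x : ℂ) ^ 2 + (y : ℂ) ^ 2) / (4 * t)) *
          besselJ ν (x * y / (2 * t)) := by
            rw [div_eq_mul_inv, div_eq_mul_inv, mul_inv, mul_inv, mul_inv]; ring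
      _ = _ := by rw [e4, mul_inv]; ring
  · rw [gate_of_nonpos h, besselKernel, heaviside, if_neg h.not_gt]
    simp

/-! ### Regularity and the differential equation -/

lemma differentiableAt_kernelCont {ν : ℝ} (hν : 1 / 2 < ν) {t x : ℝ} (ht : 0 < t) (hx : x ≠ 0)
    {z : ℂ} (hz : z.re ≠ 0) : DifferentiableAt ℂ (kernelCont ν t x) z := by
  have hcont : Continuous fun z : ℂ => x * z.re := by fun_prop
  rcases (mul_ne_zero hx hz).lt_or_gt with hb | hb
  · refine (differentiableAt_const (0 : ℂ)).congr_of_eventuallyEq ?_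
    filter_upwards [hcont.continuousAt.eventually_lt continuousAt_const hb] with u hu
    exact gate_of_nonpos hu.le _
  · refine ((differentiableAt_kernelCore_z hν
      (besselArg_mem_slitPlane ht hb)).const_mul (kernelConst ν)).congr_of_eventuallyEq ?_
    filter_upwards [continuousAt_const.eventually_lt hcont.continuousAt hb] with u hu
    exact gate_of_pos hu _

lemma hasDerivAt_constMul_kernelCore_x {ν : ℝ} (hν : 1 / 2 < ν) {t : ℝ} (ht : 0 < t) {z : ℂ}
    (x : ℝ) (h : 0 < x * z.re) :
    HasDerivAt (fun x : ℝ => kernelConst ν * kernelCore ν t x z)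
      (kernelConst ν * kernelCoreX ν t x z) x :=
  (hasDerivAt_kernelCore_x hν (besselArg_mem_slitPlane ht h)).comp_ofReal.const_mul _

lemma hasDerivAt_constMul_kernelCoreX_x {ν : ℝ} (hν : 1 / 2 < ν) {t : ℝ} (ht : 0 < t) {z : ℂ}
    (x : ℝ) (h : 0 < x * z.re) :
    HasDerivAt (fun x : ℝ => kernelConst ν * kernelCoreX ν t x z)
      (kernelConst ν * kernelCoreXX ν t x z) x :=
  (hasDerivAt_kernelCoreX_x hν (besselArg_mem_slitPlane ht h)).comp_ofReal.const_mul _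

lemma isOpen_setOf_besselArg_mem (t z : ℂ) :
    IsOpen {x : ℂ | besselArg t x z ∈ Complex.slitPlane} := by
  refine Complex.isOpen_slitPlane.preimage (f := fun x => besselArg t x z) ?_
  unfold besselArg
  fun_prop

lemma acOn_gate_mul {F : ℂ → ℂ} {U : Set ℂ} {I : Set ℝ} {c : ℝ} (hU : IsOpen U)
    (hF : DifferentiableOn ℂ F U) (hI : I.OrdConnected)
    (hIU : ∀ x ∈ I, 0 < x * c → (x : ℂ) ∈ U)
    (hsign : (∀ x ∈ I, 0 < x * c) ∨ ∀ x ∈ I, x * c ≤ 0) :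
    ACOn (fun x : ℝ => gate (x * c) (F x)) I := by
  rcases hsign with h | h
  · exact acOn_congr (acOn_of_differentiableOn hU hF hI fun x hx => hIU x hx (h x hx))
      fun x hx => gate_of_pos (h x hx) _
  · exact acOn_congr (acOn_zero I) fun x hx => gate_of_nonpos (h x hx) _

lemma acDot_gate_mul {F : ℂ → ℂ} {U : Set ℂ} {c : ℝ} (hU : IsOpen U)
    (hF : DifferentiableOn ℂ F U) (hIU : ∀ x : ℝ, 0 < x * c → (x : ℂ) ∈ U) :
    ACDot (fun x : ℝ => gate (x * c) (F x)) := by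
  constructor
  · refine acOn_gate_mul hU hF Set.ordConnected_Iio (fun x _ => hIU x) ?_
    rcases lt_or_ge c 0 with h | h
    · exact Or.inl fun x hx => mul_pos_of_neg_of_neg hx h
    · exact Or.inr fun x hx => mul_nonpos_of_nonpos_of_nonneg (le_of_lt hx) h
  · refine acOn_gate_mul hU hF Set.ordConnected_Ioi (fun x _ => hIU x) ?_
    rcases lt_or_ge 0 c with h | h
    · exact Or.inl fun x hx => mul_pos hx h
    · exact Or.inr fun x hx => mul_nonpos_of_nonneg_of_nonpos (le_of_lt hx) h

lemma acDot_congr {f g : ℝ → ℂ} (h : ACDot f) (hfg : ∀ x, x ≠ 0 → g x = f x) : ACDot g :=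
  ⟨acOn_congr h.1 fun x hx => hfg x (ne_of_lt hx), acOn_congr h.2 fun x hx => hfg x (ne_of_gt hx)⟩

/-- The sign of x Re z is constant in time and on each half-line, so there the kernel is either zero
or the restriction of a holomorphic function; the latter is absolutely continuous, as is its
derivative. -/
lemma ac12_kernelCont {ν : ℝ} (hν : 1 / 2 < ν) (T : EReal) {z : ℂ} (hz : z.re ≠ 0) :
    AC12 T (fun t x => kernelCont ν t x z) where
  time x hx := by
    rcases lt_or_ge 0 (x * z.re) with h | h
    · set U : Set ℂ := Complex.slitPlane ∩ (fun t => besselArg t x z) ⁻¹' Complex.slitPlane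
      have hU : IsOpen U := by
        refine ContinuousOn.isOpen_inter_preimage (fun t ht => ?_) Complex.isOpen_slitPlane
          Complex.isOpen_slitPlane
        exact (hasDerivAt_besselArg_t
          (Complex.slitPlane_ne_zero ht) x z).continuousAt.continuousWithinAt
      have hF : DifferentiableOn ℂ (fun t => kernelConst ν * kernelCore ν t x z) U :=
        fun t ht => ((hasDerivAt_kernelCore_t hν ht.2 ht.1).const_mul
          _).differentiableAt.differentiableWithinAt
      refine acOn_congr (acOn_of_differentiableOn hU hF (ordConnected_timeInterval T)
        fun t ht => ?_) fun t _ => gate_of_pos h _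
      exact ⟨ofReal_mem_slitPlane ht.1, besselArg_mem_slitPlane ht.1 h⟩
    · exact acOn_congr (acOn_zero _) fun t _ => gate_of_nonpos h _
  space t ht := acDot_gate_mul (F := fun x => kernelConst ν * kernelCore ν t x z)
    (isOpen_setOf_besselArg_mem t z)
    (fun _ hx => ((hasDerivAt_kernelCore_x hν hx).const_mul
      _).differentiableAt.differentiableWithinAt)
    (fun _ hx => besselArg_mem_slitPlane ht.1 hx)
  differentiable t ht x hx := (hasDerivAt_gate_mul (mul_ne_zero hx hz)
    (hasDerivAt_constMul_kernelCore_x hν ht.1 x)).differentiableAt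
  space_deriv t ht := acDot_congr
    (acDot_gate_mul (c := z.re) (F := fun x => kernelConst ν * kernelCoreX ν t x z)
      (isOpen_setOf_besselArg_mem t z)
      (fun _ hx => ((hasDerivAt_kernelCoreX_x hν hx).const_mul
        _).differentiableAt.differentiableWithinAt)
      (fun _ hx => besselArg_mem_slitPlane ht.1 hx))
    fun _ hx => deriv_gate_mul hz hx (hasDerivAt_constMul_kernelCore_x hν ht.1)

lemma solvesSchrodinger_kernelCont {ν lam : ℝ} (hν : 1 / 2 < ν) (hlam : ν ^ 2 - 1 / 4 = lam)
    (T : EReal) {z : ℂ} (hz : z.re ≠ 0) :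
    SolvesSchrodinger T (fun _ x => ((lam / x ^ 2 : ℝ) : ℂ)) (fun t x => kernelCont ν t x z) := by
  -- The equation holds at every point of the domain, not only almost everywhere.
  refine Eventually.of_forall fun q ht hx => ?_
  refine ⟨gate (q.2 * z.re) (kernelConst ν * kernelCoreT ν q.1 q.2 z),
    gate (q.2 * z.re) (kernelConst ν * kernelCoreXX ν q.1 q.2 z), ?_, ?_, ?_⟩
  · exact hasDerivAt_gate_const fun h => (hasDerivAt_kernelCore_t hν
      (besselArg_mem_slitPlane ht.1 h) (ofReal_mem_slitPlane ht.1)).comp_ofReal.const_mul _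
  · exact hasDerivAt_deriv_gate_mul hz hx (hasDerivAt_constMul_kernelCore_x hν ht.1)
      (hasDerivAt_constMul_kernelCoreX_x hν ht.1 q.2)
  · simp only [kernelCont]
    rcases lt_or_ge 0 (q.2 * z.re) with h | h
    · have hz0 : z ≠ 0 := fun h0 => hz (by simp [h0])
      have := kernelCore_schrodinger (ν := ν) (t := q.1) (x := q.2) (z := z)
        (by exact_mod_cast ht.1.ne') (by exact_mod_cast hx) hz0
      rw [hlam] at this
      simp only [gate_of_pos h]
      push_cast
      linear_combination kernelConst ν * this
    · simp [gate_of_nonpos h]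

/-! ### Dirichlet conditions -/

lemma norm_phase_ofReal (t x y : ℝ) : ‖phase t x y‖ = 1 := by
  have e : Complex.I * ((x : ℂ) ^ 2 + (y : ℂ) ^ 2) / (4 * t)
      = (((x ^ 2 + y ^ 2) / (4 * t) : ℝ) : ℂ) * Complex.I := by push_cast; ring
  rw [phase, e, Complex.norm_exp_ofReal_mul_I]

lemma norm_kernelConst (ν : ℝ) : ‖kernelConst ν‖ ≤ 1 := by
  have h1 : ‖Complex.I ^ ((ν : ℂ) + 1)‖ = 1 := by
    rw [show (ν : ℂ) + 1 = ((ν + 1 : ℝ) : ℂ) by push_cast; rfl, Complex.norm_cpow_real,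
      Complex.norm_I, Real.one_rpow]
  rw [kernelConst, norm_inv, norm_mul, h1, mul_one, Complex.norm_real,
    Real.norm_of_nonneg (by positivity)]
  exact inv_le_one_of_one_le₀ (Real.one_le_sqrt.2 one_le_two)

lemma norm_besselArg_ofReal {t : ℝ} (ht : 0 < t) (x y : ℝ) :
    ‖besselArg t x y‖ = |x| * |y| / (2 * t) := by
  rw [besselArg_ofReal, Complex.norm_real, Real.norm_eq_abs, abs_div, abs_mul,
    abs_of_pos (by positivity : 0 < 2 * t)]

/-- For real arguments the phase has modulus one, so the bound |w|^{ν-1/2} near w = 0 decides. The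
limit of the derivative is needed because the transmission condition asks for its existence. -/
lemma tendsto_kernelCont_zero {ν : ℝ} (hν : 1 / 2 < ν) {t : ℝ} (ht : 0 < t) {y : ℝ}
    (hy : y ≠ 0) :
    Tendsto (fun x => kernelCont ν t x y) (𝓝[≠] 0) (𝓝 0) ∧
      Tendsto (deriv fun x => kernelCont ν t x y) (𝓝[≠] 0) (𝓝 0) := by
  obtain ⟨C, hC, h⟩ := exists_norm_sqrtBessel_le hν
  set g : ℝ → ℝ := fun x => C * (|x| * |y| / (2 * t)) ^ (ν - 1 / 2) with hg
  have hg0 : ∀ x, 0 ≤ g x := fun x => by positivity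
  have hgc : Continuous g := by
    refine continuous_const.mul (Continuous.rpow_const (by fun_prop) fun x => Or.inr ?_)
    linarith
  have hgz : g 0 = 0 := by
    simp only [hg, abs_zero, zero_mul, zero_div]
    rw [Real.zero_rpow (by linarith), mul_zero]
  have hsmall : ∀ᶠ x : ℝ in 𝓝[≠] 0, |x| * |y| / (2 * t) ≤ 1 := by
    refine nhdsWithin_le_nhds (Continuous.continuousAt (f := fun x : ℝ => |x| * |y| / (2 * t))
      (by fun_prop) |>.eventually_le_const (by simp))
  have hne : ∀ x : ℝ, x ≠ 0 → besselArg t x y ≠ 0 := fun x hx => by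
    rw [besselArg_ofReal]
    exact_mod_cast div_ne_zero (mul_ne_zero hx hy) (by positivity)
  have hb : ∀ᶠ x : ℝ in 𝓝[≠] 0, ‖sqrtBessel ν (besselArg t x y)‖ ≤ g x ∧
      ‖sqrtBesselDeriv ν (besselArg t x y)‖ ≤ g x := by
    filter_upwards [hsmall, self_mem_nhdsWithin] with x hx hx0
    have := h (besselArg t x y) (hne x hx0) (by rwa [norm_besselArg_ofReal ht])
    rwa [norm_besselArg_ofReal ht] at this
  constructor
  · refine squeeze_zero_norm' (a := fun x => (√t)⁻¹ * g x) ?_ ?_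
    · filter_upwards [hb] with x hx
      refine norm_gate_le (mul_nonneg (by positivity) (hg0 x)) fun _ => ?_
      rw [kernelCore, norm_mul, norm_mul, norm_mul, norm_amplitude ht, norm_phase_ofReal, mul_one]
      calc _ ≤ 1 * ((√t)⁻¹ * g x) := by
            gcongr
            · exact norm_kernelConst ν
            · exact hx.1
        _ = _ := one_mul _
    · have := (hgc.const_mul (√t)⁻¹).tendsto 0
      rw [hgz, mul_zero] at this
      exact this.mono_left nhdsWithin_le_nhds
  · refine squeeze_zero_norm'
      (a := fun x => (√t)⁻¹ * (|x| / (2 * t) * g x + |y| / (2 * t) * g x)) ?_ ?_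
    · filter_upwards [hb, self_mem_nhdsWithin] with x hx hx0
      have hd : deriv (fun x => kernelCont ν t x y) x
          = gate (x * (y : ℂ).re) (kernelConst ν * kernelCoreX ν t x y) :=
        deriv_gate_mul (by simpa using hy) hx0 (hasDerivAt_constMul_kernelCore_x hν ht)
      rw [hd]
      have hgx := hg0 x
      refine norm_gate_le (by positivity) fun _ => ?_
      rw [kernelCoreX, norm_mul, norm_mul, norm_mul, norm_amplitude ht, norm_phase_ofReal, mul_one]
      have e : ‖Complex.I * x / (2 * t) * sqrtBessel ν (besselArg t x y)
          + y / (2 * t) * sqrtBesselDeriv ν (besselArg t x y)‖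
          ≤ |x| / (2 * t) * g x + |y| / (2 * t) * g x := by
        refine (norm_add_le _ _).trans ?_
        simp only [norm_mul, norm_div, Complex.norm_I, Complex.norm_real, Complex.norm_ofNat,
          Real.norm_eq_abs, abs_of_pos ht, one_mul]
        gcongr
        · exact hx.1
        · exact hx.2
      calc _ ≤ 1 * ((√t)⁻¹ * (|x| / (2 * t) * g x + |y| / (2 * t) * g x)) := by
            gcongr
            exact norm_kernelConst ν
        _ = _ := one_mul _
    · have hc : Continuous fun x : ℝ => (√t)⁻¹ * (|x| / (2 * t) * g x + |y| / (2 * t) * g x) := by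
        fun_prop
      have := hc.tendsto 0
      simp only [hgz, mul_zero, add_zero] at this
      exact this.mono_left nhdsWithin_le_nhds

lemma transmissionCondition_besselKernel {ν : ℝ} (hν : 1 / 2 < ν) {t : ℝ} (ht : 0 < t) {y : ℝ}
    (hy : y ≠ 0) : TransmissionCondition 1 0 (fun x => besselKernel ν t x y) := by
  obtain ⟨h0, h1⟩ := tendsto_kernelCont_zero hν ht hy
  have e : (fun x => besselKernel ν t x y) = fun x => kernelCont ν t x y :=
    funext fun x => besselKernel_eq_kernelCont hν ht x y
  rw [e]
  have hp : 𝓝[>] (0 : ℝ) ≤ 𝓝[≠] 0 := nhdsWithin_mono 0 fun x hx => ne_of_gt hx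
  have hm : 𝓝[<] (0 : ℝ) ≤ 𝓝[≠] 0 := nhdsWithin_mono 0 fun x hx => ne_of_lt hx
  refine ⟨0, 0, 0, 0, h0.mono_left hp, h0.mono_left hm, h1.mono_left hp, h1.mono_left hm, ?_⟩
  simp

/-! ### Exponential bounds -/

/-- The factor of the continued kernel that remains after splitting off `e^{i(z-x)²/(4t)}`. -/
def kernelFactor (ν t x : ℝ) (z : ℂ) : ℂ :=
  gate (x * z.re) (kernelConst ν * (amplitude t * modBessel ν (besselArg t x z)))

/-- This fixes a(t) = 1/(4t): the cross term xz/(2t) of the square is the modulation e^{iw} absorbed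
in `modBessel`. -/
lemma kernelCont_eq_exp_mul (ν : ℝ) {t : ℝ} (ht : 0 < t) (x : ℝ) (z : ℂ) :
    kernelCont ν t x z = Complex.exp (Complex.I * ((4 * t)⁻¹ : ℝ) * (z - x) ^ 2) *
      kernelFactor ν t x z := by
  have ht' : (t : ℂ) ≠ 0 := by exact_mod_cast ht.ne'
  rw [kernelCont, kernelFactor]
  rcases lt_or_ge 0 (x * z.re) with h | h
  · have e : phase t x z = Complex.exp (Complex.I * ((4 * t)⁻¹ : ℝ) * (z - x) ^ 2) *
        Complex.exp (Complex.I * besselArg t x z) := by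
      rw [phase, ← Complex.exp_add, besselArg]
      congr 1
      push_cast
      field_simp
      ring
    rw [gate_of_pos h, gate_of_pos h, kernelCore, modBessel, e]
    ring
  · rw [gate_of_nonpos h, gate_of_nonpos h, mul_zero]

section FactorDerivatives

variable {ν : ℝ} {t : ℝ} {z : ℂ}

lemma hasDerivAt_factor_x (hν : 1 / 2 < ν) (ht : 0 < t) (x : ℝ) (h : 0 < x * z.re) :
    HasDerivAt (fun x : ℝ => kernelConst ν * (amplitude t * modBessel ν (besselArg t x z)))
      (kernelConst ν * (amplitude t * (z / (2 * t) * modBesselDeriv ν (besselArg t x z)))) x := by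
  have hw := besselArg_mem_slitPlane ht h
  have h1 := HasDerivAt.comp (x : ℂ) (hasDerivAt_modBessel hν hw)
    (hasDerivAt_besselArg_x t x z)
  exact ((h1.congr_deriv (mul_comm _ _)).comp_ofReal.const_mul _).const_mul _

/-- The chain-rule factor (z/(2t))² cancels the z in λ/w², so the coefficient λ/x² does not blow up
as z → 0. -/
lemma hasDerivAt_factor_xx (hν : 1 / 2 < ν) (ht : 0 < t) (x : ℝ) (h : 0 < x * z.re) :
    HasDerivAt
      (fun x : ℝ => kernelConst ν * (amplitude t * (z / (2 * t) * modBesselDeriv ν (besselArg t x z))))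
      (kernelConst ν * (amplitude t * (2 * Complex.I * (z / (2 * t)) ^ 2 *
        modBesselDeriv ν (besselArg t x z) + ((ν ^ 2 - 1 / 4 : ℝ) : ℂ) / (x : ℂ) ^ 2 *
          modBessel ν (besselArg t x z)))) x := by
  have hw := besselArg_mem_slitPlane ht h
  have h1 := HasDerivAt.comp (x : ℂ) (hasDerivAt_modBesselDeriv hν hw)
    (hasDerivAt_besselArg_x t x z)
  refine (((h1.comp_ofReal.const_mul (z / (2 * t))).const_mul _).const_mul _).congr_deriv ?_
  have hx0 : (x : ℂ) ≠ 0 := by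
    have : x ≠ 0 := fun h0 => by simp [h0] at h
    exact_mod_cast this
  have hz0 : z ≠ 0 := fun h0 => by simp [h0] at h
  have ht' : (t : ℂ) ≠ 0 := by exact_mod_cast ht.ne'
  have e : ((ν ^ 2 - 1 / 4 : ℝ) : ℂ) / besselArg t x z ^ 2 * (z / (2 * t)) ^ 2
      = ((ν ^ 2 - 1 / 4 : ℝ) : ℂ) / (x : ℂ) ^ 2 := by
    rw [besselArg]
    generalize ((ν ^ 2 - 1 / 4 : ℝ) : ℂ) = l
    field_simp
  rw [← e]
  ring

lemma hasDerivAt_factor_t (hν : 1 / 2 < ν) (ht : 0 < t) (x : ℝ) (h : 0 < x * z.re) :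
    HasDerivAt (fun t : ℝ => kernelConst ν * (amplitude t * modBessel ν (besselArg t x z)))
      (kernelConst ν * (amplitude t * (-1 / (2 * t) * modBessel ν (besselArg t x z)
        + -(x * z) / (2 * t ^ 2) * modBesselDeriv ν (besselArg t x z)))) t := by
  have ht' : (t : ℂ) ≠ 0 := by exact_mod_cast ht.ne'
  have hw := besselArg_mem_slitPlane ht h
  have h1 := HasDerivAt.comp (t : ℂ) (hasDerivAt_modBessel hν hw)
    (hasDerivAt_besselArg_t ht' x z)
  refine (((hasDerivAt_amplitude (ofReal_mem_slitPlane ht)).mul h1).comp_ofReal.const_mul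
    _).congr_deriv ?_
  simp only [Function.comp]
  ring

end FactorDerivatives

/-- The coefficients `A₀`, `A₁`, `A₂` of the exponential bounds. -/
def boundCoeff (C lam : ℝ) (j : Fin 3) (t x : ℝ) : ℝ :=
  ![(√t)⁻¹ * C, (√t)⁻¹ * ((2 * t)⁻¹ * C),
    (√t)⁻¹ * ((t ^ 2)⁻¹ * C + lam / x ^ 2 * C + ((2 * t)⁻¹ * C + |x| / (2 * t ^ 2) * C))] j

lemma boundCoeff_nonneg {C lam : ℝ} (hC : 0 ≤ C) (hlam : 0 ≤ lam) (j : Fin 3) {t : ℝ}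
    (ht : 0 < t) (x : ℝ) : 0 ≤ boundCoeff C lam j t x := by
  fin_cases j <;> simp only [boundCoeff, Fin.zero_eta, Fin.mk_one, Fin.reduceFinMk,
    Matrix.cons_val] <;> positivity

lemma isCoefficient_boundCoeff {C lam : ℝ} (hC : 0 ≤ C) (hlam : 0 ≤ lam) (T : EReal)
    (j : Fin 3) : IsCoefficient T (boundCoeff C lam j) := by
  refine ⟨fun q hq => ContinuousAt.continuousWithinAt ?_,
    fun t ht x _ => boundCoeff_nonneg hC hlam j ht.1 x⟩
  have ht : q.1 ≠ 0 := (timeInterval_pos hq.1).ne'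
  have hs : √q.1 ≠ 0 := (Real.sqrt_pos.2 (timeInterval_pos hq.1)).ne'
  have hx : q.2 ≠ 0 := hq.2
  fin_cases j <;> simp only [boundCoeff, Fin.zero_eta, Fin.mk_one, Fin.reduceFinMk,
    Matrix.cons_val] <;> fun_prop (disch := positivity)

lemma norm_const_mul_amplitude_le {ν t R E : ℝ} {v : ℂ} (ht : 0 < t) (hv : ‖v‖ ≤ R * E) :
    ‖kernelConst ν * (amplitude t * v)‖ ≤ (√t)⁻¹ * R * E := by
  rw [norm_mul, norm_mul, norm_amplitude ht]
  calc ‖kernelConst ν‖ * ((√t)⁻¹ * ‖v‖) ≤ 1 * ((√t)⁻¹ * (R * E)) := by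
        gcongr
        exact norm_kernelConst ν
    _ = _ := by ring

/-- Since H and H' are bounded on the quadrant, z enters only through powers up to |z|² from the
chain rule. These are at most 2e^{|z|}, whence p = 1 and B = 1. -/
lemma exponentialBounds_kernelCont {ν lam C : ℝ} (hν : 1 / 2 < ν) (hlam : ν ^ 2 - 1 / 4 = lam)
    (hC : 0 ≤ C) (hb : ∀ w ∈ quadrant, ‖modBessel ν w‖ ≤ C ∧ ‖modBesselDeriv ν w‖ ≤ C)
    (T : EReal) :
    ExponentialBounds T 1 0 (doubleSector (Real.pi / 4)) (kernelCont ν) (kernelFactor ν)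
      (fun t => (4 * t)⁻¹) 1 (boundCoeff C lam) (fun _ _ _ => 1) := by
  have hlam0 : 0 ≤ lam := by nlinarith
  have hE : ∀ z : ℂ, 1 ≤ Real.exp (1 * ‖z‖ ^ (1 : ℝ)) ∧ ‖z‖ ≤ Real.exp (1 * ‖z‖ ^ (1 : ℝ)) ∧
      ‖z‖ ^ 2 ≤ 2 * Real.exp (1 * ‖z‖ ^ (1 : ℝ)) := by
    intro z
    rw [Real.rpow_one, one_mul]
    have h0 := norm_nonneg z
    have h1 := Real.quadratic_le_exp_of_nonneg h0
    refine ⟨Real.one_le_exp h0, ?_, ?_⟩ <;> nlinarith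
  refine
    { ac := ?_
      pos := fun t ht => by have := timeInterval_pos ht; positivity
      tendsto := ?_
      decomposition := fun t ht x _ z _ => kernelCont_eq_exp_mul ν ht.1 x z
      p_mem := by norm_num
      coeffA := isCoefficient_boundCoeff hC hlam0 T
      coeffB := fun j => ⟨continuousOn_const, fun _ _ _ _ => zero_le_one⟩
      bound := fun t ht x hx z hz => ?_
      bound_x := fun t ht x hx z hz => ?_
      bound_xx := fun t ht x hx z hz => ?_
      bound_t := fun t ht x hx z hz => ?_
      -- A₀ = C/√t and √a = 1/(2√t), so the quotient is exactly 2C.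
      bounded_time := fun x hx => ⟨⟨2 * C, ?_⟩, ⟨1, by simp⟩⟩
      bounded_space := fun _ _ t ht => ⟨⟨|(√t)⁻¹ * C|, ?_⟩, ⟨1, by simp⟩⟩
      bounded_space_deriv := fun h => absurd rfl h }
  · refine acOn_of_hasDerivAt (ordConnected_timeInterval T)
      (f' := fun t => -4 / (4 * t) ^ 2) (fun t ht => ?_) (fun t ht => ?_)
    · have h4 : HasDerivAt (fun t : ℝ => 4 * t) 4 t := by
        simpa using (hasDerivAt_id t).const_mul (4 : ℝ)
      exact h4.inv (by have := timeInterval_pos ht; positivity)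
    · have := timeInterval_pos ht
      exact ContinuousAt.continuousWithinAt (by fun_prop (disch := positivity))
  · have h4 : Tendsto (fun t : ℝ => 4⁻¹ * t⁻¹) (𝓝[>] 0) atTop :=
      tendsto_inv_nhdsGT_zero.const_mul_atTop (by norm_num)
    exact h4.congr fun t => by rw [mul_inv]
  · obtain ⟨e0, e1, e2⟩ := hE z
    refine norm_gate_le (mul_nonneg (boundCoeff_nonneg hC hlam0 0 ht.1 x) (Real.exp_pos _).le)
      fun h => norm_const_mul_amplitude_le ht.1 ?_
    have := (hb _ (besselArg_mem_quadrant ht.1 h hz)).1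
    nlinarith
  · obtain ⟨e0, e1, e2⟩ := hE z
    refine ⟨_, hasDerivAt_gate_mul (mul_ne_zero hx (re_ne_zero_of_mem_doubleSector hz))
      (hasDerivAt_factor_x hν ht.1 x), ?_⟩
    refine norm_gate_le (mul_nonneg (boundCoeff_nonneg hC hlam0 1 ht.1 x) (Real.exp_pos _).le)
      fun h => norm_const_mul_amplitude_le ht.1 ?_
    have h1 := (hb _ (besselArg_mem_quadrant ht.1 h hz)).2
    have ht0 := timeInterval_pos ht
    simp only [norm_mul, norm_div, Complex.norm_real, Complex.norm_ofNat, Real.norm_eq_abs,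
      abs_of_pos ht0]
    calc _ ≤ Real.exp (1 * ‖z‖ ^ (1 : ℝ)) / (2 * t) * C := by gcongr
      _ = _ := by ring
  · obtain ⟨e0, e1, e2⟩ := hE z
    refine ⟨_, hasDerivAt_deriv_gate_mul (re_ne_zero_of_mem_doubleSector hz) hx
      (hasDerivAt_factor_x hν ht.1) (hasDerivAt_factor_xx hν ht.1 x), ?_⟩
    refine norm_gate_le (mul_nonneg (boundCoeff_nonneg hC hlam0 2 ht.1 x) (Real.exp_pos _).le)
      fun h => norm_const_mul_amplitude_le ht.1 ?_
    obtain ⟨h0, h1⟩ := hb _ (besselArg_mem_quadrant ht.1 h hz)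
    have ht0 := timeInterval_pos ht
    refine (norm_add_le _ _).trans ?_
    rw [hlam]
    simp only [norm_mul, norm_div, norm_pow, Complex.norm_real, Complex.norm_ofNat,
      Real.norm_eq_abs, abs_of_pos ht0, Complex.norm_I, mul_one, abs_of_nonneg hlam0, sq_abs]
    set E := Real.exp (1 * ‖z‖ ^ (1 : ℝ))
    have hE0 : 0 < E := Real.exp_pos _
    calc 2 * (‖z‖ / (2 * t)) ^ 2 * ‖modBesselDeriv ν (besselArg t x z)‖
          + lam / x ^ 2 * ‖modBessel ν (besselArg t x z)‖
        = ‖z‖ ^ 2 / (2 * t ^ 2) * ‖modBesselDeriv ν (besselArg t x z)‖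
          + lam / x ^ 2 * ‖modBessel ν (besselArg t x z)‖ * 1 := by field_simp
      _ ≤ 2 * E / (2 * t ^ 2) * C + lam / x ^ 2 * C * E := by gcongr
      _ = ((t ^ 2)⁻¹ * C + lam / x ^ 2 * C) * E := by field_simp
      -- A₂ is the sum of the coefficients for ∂ₓ² and ∂ₜ; here the part belonging to ∂ₜ is added
      -- for free.
      _ ≤ _ := by
        refine mul_le_mul_of_nonneg_right (le_add_of_nonneg_right ?_) hE0.le
        positivity
  · obtain ⟨e0, e1, e2⟩ := hE z
    refine ⟨_, hasDerivAt_gate_const (hasDerivAt_factor_t hν ht.1 x), ?_⟩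
    refine norm_gate_le (mul_nonneg (boundCoeff_nonneg hC hlam0 2 ht.1 x) (Real.exp_pos _).le)
      fun h => norm_const_mul_amplitude_le ht.1 ?_
    obtain ⟨h0, h1⟩ := hb _ (besselArg_mem_quadrant ht.1 h hz)
    have ht0 := timeInterval_pos ht
    refine (norm_add_le _ _).trans ?_
    simp only [norm_mul, norm_div, norm_neg, norm_one, norm_pow, Complex.norm_real,
      Complex.norm_ofNat, Real.norm_eq_abs, abs_of_pos ht0]
    set E := Real.exp (1 * ‖z‖ ^ (1 : ℝ))
    have hE0 : 0 < E := Real.exp_pos _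
    calc 1 / (2 * t) * ‖modBessel ν (besselArg t x z)‖
          + |x| * ‖z‖ / (2 * t ^ 2) * ‖modBesselDeriv ν (besselArg t x z)‖
        = 1 / (2 * t) * ‖modBessel ν (besselArg t x z)‖ * 1
          + |x| * ‖z‖ / (2 * t ^ 2) * ‖modBesselDeriv ν (besselArg t x z)‖ := by rw [mul_one]
      _ ≤ 1 / (2 * t) * C * E + |x| * E / (2 * t ^ 2) * C := by gcongr
      _ = ((2 * t)⁻¹ * C + |x| / (2 * t ^ 2) * C) * E := by field_simp
      _ ≤ _ := by
        refine mul_le_mul_of_nonneg_right (le_add_of_nonneg_left ?_) hE0.le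
        positivity
  · filter_upwards [self_mem_nhdsWithin] with t ht
    have ht0 : 0 < t := ht
    have hs : √((4 * t)⁻¹) = (2 * √t)⁻¹ := by
      rw [Real.sqrt_inv, Real.sqrt_mul (by norm_num), show (4 : ℝ) = 2 ^ 2 by norm_num,
        Real.sqrt_sq two_pos.le]
    have hst := Real.sqrt_pos.2 ht0
    have : boundCoeff C lam 0 t x / √((4 * t)⁻¹) = 2 * C := by
      rw [hs]
      simp only [boundCoeff, Matrix.cons_val]
      field_simp
    rw [this, abs_of_nonneg (by positivity)]
  · exact Eventually.of_forall fun x => le_rfl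

/-! ### The initial condition -/

lemma continuous_modBessel_ofReal {ν : ℝ} (hν : 1 / 2 < ν) :
    Continuous fun r : ℝ => modBessel ν r := by
  have h1 : Continuous fun r : ℝ => (r : ℂ) ^ ((ν + 1 / 2 : ℝ) : ℂ) :=
    Complex.continuous_ofReal_cpow_const (by rw [Complex.ofReal_re]; linarith)
  have h2 : Continuous (besselEntireDeriv ν 0) :=
    continuous_iff_continuousAt.2 fun w => (hasDerivAt_besselEntireDeriv hν 0 w).continuousAt
  unfold modBessel sqrtBessel
  fun_prop

/-- The rate 1/r is weakened because r^{-1} is not integrable at 0. Any exponent strictly between -1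
and -1/2 would serve: integrable at y = 0, yet strong enough to beat the prefactor ε⁻¹ at r ~ ε⁻².
For r ≤ 1 boundedness suffices. -/
lemma exists_modBessel_remainder_le {ν : ℝ} (hν : 1 / 2 < ν) :
    ∃ D : ℂ, ∃ C : ℝ, ∀ r : ℝ, 0 < r →
      ‖modBessel ν r - (modBesselLimit ν + D * Complex.exp (2 * Complex.I * r))‖
        ≤ C * r ^ (-(3 / 4) : ℝ) := by
  obtain ⟨D, C₁, h₁⟩ := exists_modBessel_asymptotics hν
  obtain ⟨C₂, hC₂, h₂⟩ := exists_norm_modBessel_le hν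
  have hone : (1 : ℂ) ∈ quadrant := ⟨by simp, by simp, one_ne_zero⟩
  have hC₁ : 0 ≤ C₁ := by simpa using (norm_nonneg _).trans (h₁ 1 le_rfl)
  refine ⟨D, max C₁ (C₂ + (‖modBesselLimit ν‖ + ‖D‖)), fun r hr => ?_⟩
  rcases le_total r 1 with h | h
  · have hexp : ‖Complex.exp (2 * Complex.I * r)‖ = 1 := by rw [Complex.norm_exp]; simp
    have hH := (h₂ r (by simpa using smul_mem_quadrant hone hr)).1
    have e1 : ‖modBessel ν r - (modBesselLimit ν + D * Complex.exp (2 * Complex.I * r))‖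
        ≤ C₂ + (‖modBesselLimit ν‖ + ‖D‖) := by
      refine (norm_sub_le _ _).trans (add_le_add hH ((norm_add_le _ _).trans ?_))
      rw [norm_mul, hexp, mul_one]
    have e2 : 1 ≤ r ^ (-(3 / 4) : ℝ) :=
      Real.one_le_rpow_of_pos_of_le_one_of_nonpos hr h (by norm_num)
    calc _ ≤ max C₁ (C₂ + (‖modBesselLimit ν‖ + ‖D‖)) * 1 := by
          rw [mul_one]; exact e1.trans (le_max_right _ _)
      _ ≤ _ := mul_le_mul_of_nonneg_left e2 (le_max_of_le_left hC₁)
  · refine (h₁ r h).trans ?_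
    rw [div_eq_mul_inv, ← Real.rpow_neg_one]
    have e : r ^ (-1 : ℝ) ≤ r ^ (-(3 / 4) : ℝ) := Real.rpow_le_rpow_of_exponent_le h (by norm_num)
    exact mul_le_mul (le_max_left _ _) e (by positivity) (le_max_of_le_left hC₁)

/-- The contribution to the initial condition of a remainder that decays like `r^{-3/4}`. -/
lemma tendsto_integral_remainder {R : ℝ → ℂ} {C : ℝ}
    (hR : ∀ r, 0 < r → ‖R r‖ ≤ C * r ^ (-(3 / 4) : ℝ)) {b x : ℝ} (hb : 0 < b) (hx : 0 < x)
    {φ : ℝ → ℂ} (hφ : ContinuousOn φ (Set.Icc 0 b)) :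
    Tendsto (fun ε : ℝ => ∫ y in (0 : ℝ)..b,
        φ y * (ε⁻¹ * Complex.exp (Complex.I * (((y - x) / ε : ℝ) : ℂ) ^ 2)) *
          R (2 * x * y / ε ^ 2)) (𝓝[>] 0) (𝓝 0) := by
  obtain ⟨m, hm⟩ := isCompact_Icc.exists_bound_of_continuousOn hφ
  have hm0 : 0 ≤ m := (norm_nonneg _).trans (hm 0 ⟨le_rfl, hb.le⟩)
  set K : ℝ := ∫ y in (0 : ℝ)..b, m * C * (2 * x) ^ (-(3 / 4) : ℝ) * y ^ (-(3 / 4) : ℝ)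
  have hint : IntervalIntegrable (fun y : ℝ => m * C * (2 * x) ^ (-(3 / 4) : ℝ) *
      y ^ (-(3 / 4) : ℝ)) volume 0 b :=
    (intervalIntegral.intervalIntegrable_rpow' (by norm_num)).const_mul _
  refine squeeze_zero_norm' (a := fun ε : ℝ => ε ^ (1 / 2 : ℝ) * K) ?_ ?_
  · filter_upwards [self_mem_nhdsWithin] with ε hε
    have hε : 0 < ε := hε
    rw [← intervalIntegral.integral_const_mul]
    refine intervalIntegral.norm_integral_le_of_norm_le hb.le
      (Eventually.of_forall fun y hy => ?_) (hint.const_mul _)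
    have hy0 : 0 < y := hy.1
    have h1 := hR (2 * x * y / ε ^ 2) (by positivity)
    -- The power ε^{3/2} is split so that one ε cancels the prefactor ε⁻¹ and ε^{1/2} is left over.
    have h2 : (2 * x * y / ε ^ 2) ^ (-(3 / 4) : ℝ)
        = (2 * x) ^ (-(3 / 4) : ℝ) * y ^ (-(3 / 4) : ℝ) * (ε ^ (1 / 2 : ℝ) * ε) := by
      rw [Real.div_rpow (by positivity) (by positivity), Real.mul_rpow (by positivity) hy0.le,
        ← Real.rpow_natCast, ← Real.rpow_mul hε.le, div_eq_mul_inv, ← Real.rpow_neg hε.le,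
        ← Real.rpow_add_one hε.ne']
      norm_num
    rw [norm_mul, norm_mul, norm_mul, norm_exp_I_mul_sq, Complex.norm_real,
      Real.norm_of_nonneg (inv_nonneg.2 hε.le), mul_one]
    calc ‖φ y‖ * ε⁻¹ * ‖R (2 * x * y / ε ^ 2)‖
        ≤ m * ε⁻¹ * (C * (2 * x * y / ε ^ 2) ^ (-(3 / 4) : ℝ)) := by
          gcongr
          exact hm y ⟨hy0.le, hy.2⟩
      _ = _ := by rw [h2]; field_simp
  · have h : Tendsto (fun ε : ℝ => ε ^ (1 / 2 : ℝ) * K) (𝓝 0) (𝓝 (0 ^ (1 / 2 : ℝ) * K)) :=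
      (Continuous.tendsto (Real.continuous_rpow_const (by norm_num)) 0).mul_const K
    rw [Real.zero_rpow (by norm_num), zero_mul] at h
    exact h.mono_left nhdsWithin_le_nhds

/-- The normalization of the kernel: i^{ν+1} = i^{ν+1/2} e^{iπ/4}, with the second factor coming
from the Fresnel integral. The outer 2 is from t^{-1/2} = 2/ε at t = ε²/4. -/
lemma kernelConst_mul_limits (ν : ℝ) :
    kernelConst ν * (2 * (modBesselLimit ν * (2 * fresnelLimit))) = 1 := by
  have hI : Complex.I ^ ((ν : ℂ) + 1) = Complex.I ^ ((ν + 1 / 2 : ℝ) : ℂ) * eighthRoot := by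
    have e : (ν : ℂ) + 1 = ((ν + 1 / 2 : ℝ) : ℂ) + 1 / 2 := by push_cast; ring
    rw [e, Complex.cpow_add _ _ Complex.I_ne_zero]
    congr 1
    rw [Complex.cpow_def_of_ne_zero Complex.I_ne_zero, Complex.log_I, eighthRoot]
    congr 1; push_cast; ring
  have h1 : Complex.I ^ ((ν + 1 / 2 : ℝ) : ℂ) ≠ 0 := by
    simp [Complex.cpow_eq_zero_iff, Complex.I_ne_zero]
  have h2 : eighthRoot ≠ 0 := Complex.exp_ne_zero _
  have h3 : ((√2 : ℝ) : ℂ) ≠ 0 := by simp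
  have h4 : ((√Real.pi : ℝ) : ℂ) ≠ 0 := by
    exact_mod_cast (Real.sqrt_pos.2 Real.pi_pos).ne'
  have h5 : ((√2 : ℝ) : ℂ) * ((√2 : ℝ) : ℂ) = 2 := by
    rw [← Complex.ofReal_mul, Real.mul_self_sqrt two_pos.le]; norm_num
  rw [kernelConst, modBesselLimit, fresnelLimit, hI, Real.sqrt_mul two_pos.le]
  push_cast
  field_simp
  linear_combination -h5

lemma kernelCore_eq_modBessel {ν : ℝ} {ε x y : ℝ} (hε : 0 < ε) :
    kernelCore ν ((ε ^ 2 / 4 : ℝ) : ℂ) x y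
      = 2 * (ε⁻¹ * Complex.exp (Complex.I * (((y - x) / ε : ℝ) : ℂ) ^ 2)) *
        modBessel ν ((2 * x * y / ε ^ 2 : ℝ) : ℂ) := by
  have hε' : (ε : ℂ) ≠ 0 := by exact_mod_cast hε.ne'
  have e1 : amplitude ((ε ^ 2 / 4 : ℝ) : ℂ) = 2 * ((ε⁻¹ : ℝ) : ℂ) := by
    rw [amplitude_ofReal (by positivity), show ε ^ 2 / 4 = (ε / 2) ^ 2 by ring,
      Real.sqrt_sq (by positivity)]
    push_cast
    field_simp
  have e2 : besselArg ((ε ^ 2 / 4 : ℝ) : ℂ) x y = ((2 * x * y / ε ^ 2 : ℝ) : ℂ) := by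
    rw [besselArg_ofReal]
    congr 1
    field_simp
    ring
  have e3 : phase ((ε ^ 2 / 4 : ℝ) : ℂ) x y
      = Complex.exp (Complex.I * (((y - x) / ε : ℝ) : ℂ) ^ 2) *
        Complex.exp (Complex.I * ((2 * x * y / ε ^ 2 : ℝ) : ℂ)) := by
    rw [phase, ← Complex.exp_add]
    congr 1
    push_cast
    field_simp
    ring
  rw [kernelCore, modBessel, e1, e2, e3]
  ring

/-- At t = ε²/4 the asymptotics split the kernel into a free kernel at x, a free kernel at -x and a
remainder; only the first survives. -/
lemma tendsto_integral_kernelCore {ν : ℝ} (hν : 1 / 2 < ν) {b x : ℝ} (hx : 0 < x) (hxb : x < b)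
    {φ φ' : ℝ → ℂ} (hφ : ContinuousOn φ (Set.Icc 0 b)) (hφ' : ContinuousOn φ' (Set.Icc 0 b))
    (hd : ∀ y ∈ Set.Ioo 0 b, HasDerivAt φ (φ' y) y) :
    Tendsto (fun ε : ℝ => ∫ y in (0 : ℝ)..b,
        kernelConst ν * kernelCore ν ((ε ^ 2 / 4 : ℝ) : ℂ) x y * φ y) (𝓝[>] 0) (𝓝 (φ x)) := by
  have hb : 0 < b := hx.trans hxb
  obtain ⟨D, C, hR⟩ := exists_modBessel_remainder_le hν
  set R : ℝ → ℂ := fun r =>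
    modBessel ν r - (modBesselLimit ν + D * Complex.exp (2 * Complex.I * r)) with hRdef
  have hRc : Continuous R := by
    have := continuous_modBessel_ofReal hν
    simp only [hRdef]
    fun_prop
  have l1 := tendsto_integral_fresnelKernel_of_mem hx hxb hφ hφ' hd
  have l2 := tendsto_integral_fresnelKernel_of_neg hb (neg_neg_of_pos hx) hφ hφ' hd
  have l3 := tendsto_integral_remainder hR hb hx hφ
  have l := ((((l1.const_mul (modBesselLimit ν)).add (l2.const_mul D)).add l3).const_mul 2).const_mul
    (kernelConst ν)
  have hval : kernelConst ν * (2 * (modBesselLimit ν * (2 * fresnelLimit * φ x) + D * 0 + 0))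
      = φ x := by
    linear_combination φ x * kernelConst_mul_limits ν
  rw [hval] at l
  refine l.congr' ?_
  filter_upwards [self_mem_nhdsWithin] with ε hε
  have hε : 0 < ε := hε
  have hφ0 : ContinuousOn φ (Set.uIcc 0 b) := by rwa [Set.uIcc_of_le hb.le]
  have i1 : ∀ c : ℝ, IntervalIntegrable (fun y => φ y *
      (ε⁻¹ * Complex.exp (Complex.I * (((y - c) / ε : ℝ) : ℂ) ^ 2))) volume 0 b := fun c =>
    (hφ0.mul (Continuous.continuousOn (by fun_prop))).intervalIntegrable
  have i3 : IntervalIntegrable (fun y => φ y *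
      (ε⁻¹ * Complex.exp (Complex.I * (((y - x) / ε : ℝ) : ℂ) ^ 2)) *
      R (2 * x * y / ε ^ 2)) volume 0 b :=
    ((hφ0.mul (Continuous.continuousOn (by fun_prop))).mul
      (Continuous.continuousOn (by fun_prop))).intervalIntegrable
  rw [← intervalIntegral.integral_const_mul, ← intervalIntegral.integral_const_mul,
    ← intervalIntegral.integral_add ((i1 x).const_mul _) ((i1 (-x)).const_mul _),
    ← intervalIntegral.integral_add (((i1 x).const_mul _).add ((i1 (-x)).const_mul _)) i3,
    ← intervalIntegral.integral_const_mul, ← intervalIntegral.integral_const_mul]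
  refine intervalIntegral.integral_congr fun y _ => ?_
  have hε' : (ε : ℂ) ≠ 0 := by exact_mod_cast hε.ne'
  -- (y + x)² - (y - x)² = 4xy: the factor e^{2ir} with r = 2xy/ε² moves the centre from x to -x.
  have e : Complex.exp (Complex.I * (((y - -x) / ε : ℝ) : ℂ) ^ 2)
      = Complex.exp (Complex.I * (((y - x) / ε : ℝ) : ℂ) ^ 2) *
        Complex.exp (2 * Complex.I * ((2 * x * y / ε ^ 2 : ℝ) : ℂ)) := by
    rw [← Complex.exp_add]
    congr 1
    push_cast
    field_simp
    ring
  simp only [kernelCore_eq_modBessel hε, hRdef]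
  rw [e]
  ring

lemma tendsto_integral_besselKernel_of_pos {ν : ℝ} (hν : 1 / 2 < ν) {b x : ℝ} (hx : 0 < x)
    (hxb : x < b) {φ : ℝ → ℂ} (hφ : ContDiffOn ℝ ∞ φ (Set.Icc (-b) b)) :
    Tendsto (fun t => ∫ y in (-b)..b, besselKernel ν t x y * φ y) (𝓝[>] 0) (𝓝 (φ x)) := by
  have hb : 0 < b := hx.trans hxb
  have hsub : Set.Icc 0 b ⊆ Set.Icc (-b) b := Set.Icc_subset_Icc (by linarith) le_rfl
  have hu : UniqueDiffOn ℝ (Set.Icc (-b) b) := uniqueDiffOn_Icc (by linarith)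
  have hφ' : ContinuousOn (derivWithin φ (Set.Icc (-b) b)) (Set.Icc (-b) b) :=
    hφ.continuousOn_derivWithin hu (by simp)
  have hd : ∀ y ∈ Set.Ioo 0 b, HasDerivAt φ (derivWithin φ (Set.Icc (-b) b) y) y := by
    intro y hy
    exact ((hφ.differentiableOn (by simp)) y ⟨by linarith [hy.1], hy.2.le⟩).hasDerivWithinAt.hasDerivAt
      (Icc_mem_nhds (by linarith [hy.1]) hy.2)
  have key := tendsto_integral_kernelCore hν hx hxb (hφ.continuousOn.mono hsub)
    (hφ'.mono hsub) hd
  have hε : Tendsto (fun t : ℝ => 2 * √t) (𝓝[>] 0) (𝓝[>] 0) := by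
    refine tendsto_nhdsWithin_iff.2 ⟨?_, ?_⟩
    · have : Tendsto (fun t : ℝ => 2 * √t) (𝓝 0) (𝓝 (2 * √0)) :=
        (Continuous.tendsto (by fun_prop) 0)
      rw [Real.sqrt_zero, mul_zero] at this
      exact this.mono_left nhdsWithin_le_nhds
    · filter_upwards [self_mem_nhdsWithin] with t ht
      have := Real.sqrt_pos.2 (show 0 < t from ht)
      exact mul_pos two_pos this
  refine (key.comp hε).congr' ?_
  filter_upwards [self_mem_nhdsWithin] with t ht
  have ht : 0 < t := ht
  have hεt : (2 * √t) ^ 2 / 4 = t := by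
    rw [mul_pow, Real.sq_sqrt ht.le]; ring
  simp only [Function.comp]
  have hneg : ∀ y ∈ Set.uIoc (-b) 0, besselKernel ν t x y * φ y = 0 := by
    intro y hy
    rw [Set.uIoc_of_le (by linarith)] at hy
    rw [besselKernel_eq_kernelCont hν ht, kernelCont, gate_of_nonpos, zero_mul]
    exact mul_nonpos_of_nonneg_of_nonpos hx.le hy.2
  have hpos : ∀ y ∈ Set.uIoc 0 b, kernelConst ν *
      kernelCore ν (((2 * √t) ^ 2 / 4 : ℝ) : ℂ) x y * φ y = besselKernel ν t x y * φ y := by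
    intro y hy
    rw [Set.uIoc_of_le hb.le] at hy
    rw [besselKernel_eq_kernelCont hν ht, kernelCont, Complex.ofReal_re,
      gate_of_pos (mul_pos hx hy.1), hεt]
  have hε0 : 0 < 2 * √t := mul_pos two_pos (Real.sqrt_pos.2 ht)
  -- In the modulated form the integrand is continuous up to y = 0, where the gate of the kernel
  -- closes.
  have i0 : IntervalIntegrable (fun y => kernelConst ν *
      kernelCore ν (((2 * √t) ^ 2 / 4 : ℝ) : ℂ) x y * φ y) volume 0 b := by
    simp only [kernelCore_eq_modBessel hε0]
    refine ContinuousOn.intervalIntegrable (ContinuousOn.mul (Continuous.continuousOn ?_) ?_)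
    · have h1 := (continuous_modBessel_ofReal hν).comp
        (show Continuous fun y : ℝ => 2 * x * y / (2 * √t) ^ 2 by fun_prop)
      simp only [Function.comp_def] at h1
      fun_prop
    · rw [Set.uIcc_of_le hb.le]; exact hφ.continuousOn.mono hsub
  have i1 : IntervalIntegrable (fun y => besselKernel ν t x y * φ y) volume 0 b :=
    i0.congr hpos
  have i2 : IntervalIntegrable (fun y => besselKernel ν t x y * φ y) volume (-b) 0 :=
    (intervalIntegrable_const (c := (0 : ℂ))).congr fun y hy => (hneg y hy).symm
  rw [← intervalIntegral.integral_add_adjacent_intervals i2 i1,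
    intervalIntegral.integral_congr_ae (g := fun _ => (0 : ℂ))
      (Eventually.of_forall hneg), intervalIntegral.integral_zero, zero_add]
  exact intervalIntegral.integral_congr_ae (Eventually.of_forall hpos)

lemma besselKernel_neg_right (ν t x y : ℝ) :
    besselKernel ν t x (-y) = besselKernel ν t (-x) y := by
  simp [besselKernel]

/-- Negative x is reduced to positive x by reflecting y and φ. -/
lemma tendsto_integral_besselKernel {ν : ℝ} (hν : 1 / 2 < ν) {b x : ℝ} (hx : x ≠ 0)
    (hxb : |x| < b) {φ : ℝ → ℂ} (hφ : ContDiffOn ℝ ∞ φ (Set.Icc (-b) b)) :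
    Tendsto (fun t => ∫ y in (-b)..b, besselKernel ν t x y * φ y) (𝓝[>] 0) (𝓝 (φ x)) := by
  rcases hx.lt_or_gt with h | h
  · have hφn : ContDiffOn ℝ ∞ (fun y => φ (-y)) (Set.Icc (-b) b) :=
      hφ.comp contDiff_neg.contDiffOn fun y hy => ⟨by linarith [hy.2], by linarith [hy.1]⟩
    have key := tendsto_integral_besselKernel_of_pos hν (neg_pos.2 h)
      (by rwa [abs_of_neg h] at hxb) hφn
    rw [neg_neg] at key
    refine key.congr fun t => ?_
    have := intervalIntegral.integral_comp_neg (a := -b) (b := b)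
      (fun y => besselKernel ν t x y * φ y)
    simp only [neg_neg, besselKernel_neg_right] at this
    exact this
  · exact tendsto_integral_besselKernel_of_pos hν h (by rwa [abs_of_pos h] at hxb) hφ

end SchrodingerGreen

end

theorem proposition5p2 (lam : ℝ) (hlam : 0 < lam) (T : EReal) (hT : 0 < T) :
    SchrodingerGreen.GreenAssumption T (fun _ x => ((lam / x ^ 2 : ℝ) : ℂ)) 1 0
      (SchrodingerGreen.besselKernel (√(1 / 4 + lam))) := by
  open SchrodingerGreen in
  set ν : ℝ := √(1 / 4 + lam) with hνdef
  have hν : 1 / 2 < ν := by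
    rw [hνdef, Real.lt_sqrt (by norm_num)]
    norm_num [hlam]
  have hl : ν ^ 2 - 1 / 4 = lam := by
    rw [hνdef, Real.sq_sqrt (by positivity)]; ring
  obtain ⟨C, hC, hb⟩ := exists_norm_modBessel_le hν
  -- Any angle below π/2 keeps Re z away from zero; π/4 is a convenient choice.
  refine ⟨Real.pi / 4, ⟨by positivity, by linarith [Real.pi_pos]⟩, kernelCont ν, ?_⟩
  exact
    { extends_G := fun t ht x _ y _ => (besselKernel_eq_kernelCont hν ht.1 x y).symm
      continuousOn := fun t ht x hx z hz => (differentiableAt_kernelCont hν ht.1 hx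
        (re_ne_zero_of_mem_doubleSector hz)).continuousAt.continuousWithinAt
      holomorphic := fun t ht x hx z hz => (differentiableAt_kernelCont hν ht.1 hx
        (re_ne_zero_of_mem_doubleSector (interior_subset hz))).differentiableWithinAt
      ac12 := fun z hz => ac12_kernelCont hν T (re_ne_zero_of_mem_doubleSector hz)
      schrodinger := fun z hz =>
        solvesSchrodinger_kernelCont hν hl T (re_ne_zero_of_mem_doubleSector hz)
      transmission := fun y hy t ht => transmissionCondition_besselKernel hν ht.1 hy
      -- Every x₀ > |x| works; nothing depends on this choice.
      initial := fun x hx => ⟨|x| + 1, lt_add_one _, fun φ hφ =>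
        tendsto_integral_besselKernel hν hx (lt_add_one _) hφ⟩
      bounds := ⟨_, _, _, _, _, exponentialBounds_kernelCont hν hl hC hb T⟩ }
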